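/- Let $j\ge 0$ be an integer, $p=2j+1$, and let $$F(z)=z^{p}e^{Az^2}\,\frac{\prod_{\nu}\bigl(1+\frac{z^2}{a_\nu}\bigr)}{\prod_{\mu}\bigl(1-\frac{z^2}{b_\mu}\bigr)},\qquad F(z)\not\equiv z^p,$$ where $A\ge 0$, the products are finite (possibly empty) or infinite, $a_\nu,b_\mu>0$, $\sum_\nu 1/a_\nu<\infty$ and $\sum_\mu 1/b_\mu<\infty$. Let $\alpha\in\mathbb{C}\setminus\{0\}$. An $\alpha$-point of $F$ is a solution of $F(z)=\alpha$; its multiplicity is its multiplicity as a zero of $F-\alpha$. Put $Q_l=\{z\ne0: 0<\operatorname{Arg}(z e^{-i\pi l/2})<\pi/2\}$ for $l\in\mathbb{Z}$ (the open quadrants, $Q_{l+4}=Q_l$), where $-\pi<\operatorname{Arg}\le\pi$. The $\alpha$-points of $F$ can be listed, each as many times as its multiplicity, in a finite or infinite sequence $(z_n)_{n=1}^{\omega}$, $1\le\omega\le\infty$, with $|z_1|\le|z_2|\le\cdots$. For every such listing the following holds (each assertion being about the indices $n$ for which all the terms it mentions exist). (iv) If $\operatorname{Im}\alpha^2\ne0$,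 then all $\alpha$-points are simple, $0<|z_1|<|z_2|<\cdots$, $\operatorname{Im}z_n^2\neq0$ for every $n$, and $z_n\in Q_l$ implies $z_{n+1}\in Q_{l+\operatorname{sign}(\operatorname{Im}\alpha^2)}$. Moreover, $\operatorname{Im}\alpha\,\operatorname{Im}z_1>0$ and $\operatorname{Re}\alpha\,\operatorname{Re}z_1>0$. (v) If $\operatorname{Im}\alpha=0$, then $0<|z_1|<|z_2|\le|z_3|<|z_4|\le|z_5|<\cdots$, there are no purely imaginary $\alpha$-points, real $\alpha$-points are simple or double, and all other $\alpha$-points are simple. Moreover, for each $n\ge1$: $|z_{2n}|=|z_{2n+1}|\Rightarrow z_{2n}=\overline{z_{2n+1}}$; $|z_{2n}|<|z_{2n+1}|\Rightarrow \operatorname{Arg}z_{2n}=\operatorname{Arg}z_{2n+1}\in\{0,\pi\}$; $\operatorname{Re}z_{2n-1}\operatorname{Re}z_{2n}<0$; and $\operatorname{Im}z_1=0$, $\alpha z_1>0$. (vi) If $\operatorname{Re}\alpha=0$, then $0<|z_1|\le|z_2|<|z_3|\le|z_4|<|z_5|\le\cdots$, there are no real $\alpha$-points, purely imaginary $\alpha$-points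 are simple or double, and all other $\alpha$-points are simple. Moreover, for each $n\ge1$: $|z_{2n-1}|=|z_{2n}|\Rightarrow z_{2n-1}=-\overline{z_{2n}}$; $|z_{2n-1}|<|z_{2n}|\Rightarrow \operatorname{Arg}z_{2n-1}=\operatorname{Arg}z_{2n}\in\{-\frac\pi2,\frac\pi2\}$; $\operatorname{Im}z_{2n}\operatorname{Im}z_{2n+1}<0$; and $\operatorname{Im}\alpha\,\operatorname{Im}z_1>0$, and $|z_1|<|z_2|\Rightarrow j=0$ (that is, $p=1$). -/

import Mathlib

open scoped ComplexConjugate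

noncomputable section

/-- The function `z ^ p * e ^ (A z ^ 2) * ∏ (1 + z ^ 2 / a ν) / ∏ (1 - z ^ 2 / b μ)`.
The index types of the two products may be empty, finite or infinite. At the poles the value
is the junk value `0`, so for `α ≠ 0` the solutions of `F z = α` are never poles. -/
def oddPF {ι κ : Type*} (p : ℕ) (A : ℝ) (a : ι → ℝ) (b : κ → ℝ) (z : ℂ) : ℂ :=
  z ^ p * Complex.exp ((A : ℂ) * z ^ 2) *
    (∏' ν, (1 + z ^ 2 / (a ν : ℂ))) / (∏' μ, (1 - z ^ 2 / (b μ : ℂ)))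

/-- Multiplicity of `w` as an `α`-point of `F`: the order of vanishing of `F - α` at `w`. -/
def alphaMult (F : ℂ → ℂ) (α w : ℂ) : ℕ∞ :=
  analyticOrderAt (fun ζ => F ζ - α) w

/-- The finite (`ω < ⊤`) or infinite (`ω = ⊤`) sequence `z 1, z 2, …` (terms `z n` with
`1 ≤ n ≤ ω`) lists all `α`-points of `F`, each as many times as its multiplicity, in the order of
non-decreasing absolute value. The values of `z` at other indices are irrelevant. -/
structure IsAlphaSeq (F : ℂ → ℂ) (α : ℂ) (ω : ℕ∞) (z : ℕ → ℂ) : Prop where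
  isAlphaPoint : ∀ n : ℕ, 1 ≤ n → (n : ℕ∞) ≤ ω → F (z n) = α
  card_eq : ∀ w : ℂ, F w = α →
    {n : ℕ | 1 ≤ n ∧ (n : ℕ∞) ≤ ω ∧ z n = w}.encard = alphaMult F α w
  norm_le : ∀ n : ℕ, 1 ≤ n → ((n + 1 : ℕ) : ℕ∞) ≤ ω → ‖z n‖ ≤ ‖z (n + 1)‖

/-- The open quadrants `Q l = {z ≠ 0 : 0 < Arg (z e ^ (- i π l / 2)) < π / 2}`, so that `Q 0` is
the first quadrant and `Q (l + 4) = Q l`. -/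
def quadrant (l : ℤ) : Set ℂ :=
  {z | z ≠ 0 ∧ 0 < (z * Complex.exp (-((l : ℂ) * (Real.pi : ℂ) / 2 * Complex.I))).arg ∧
    (z * Complex.exp (-((l : ℂ) * (Real.pi : ℂ) / 2 * Complex.I))).arg < Real.pi / 2}

end

/-! Put `z = exp ζ`, `ζ = x + i y`. The closed first quadrant without `0` becomes the strip `0 ≤ y ≤
π / 2`, on which `F` has a logarithm `f = u + i ψ`. Apart from the constant `p`, every contribution
to `f'` has positive imaginary part in the open strip: `2 A e^{2ζ}` when `A > 0`, `2 W / (1 + W)`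
with `W = e^{2ζ} / a`, and, after reflecting the strip in its middle line, the logarithms of the
pole factors. Since `F` is not `z ^ p`, at least one of them is present. Integration along segments
gives `Δψ Δx - Δu Δy > 0` (`crossIm_pos_of_deriv`), an inequality which survives on the edges, where
`ψ` may jump at zeros and poles.

Taking `Δx = 0`, `|F|` strictly decreases in `y`. So the level `|F| = |α|` meets each vertical
segment at most once and, completed by pieces of the edges, becomes the graph of a continuous
function `Y` (`exists_levelPath`). Along this graph `Δu ΔY ≥ 0`, hence the phase `ψ` is
nondecreasing, and it can repeat a value only at points of one and the same edge. The phase begins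
at `0` and reaches `π / 2`. `F` is real on the real axis and imaginary on the imaginary axis, so the
phase is locally constant wherever the graph is off the level; the ends of such plateaus are on the
level.

By `F (-z) = -F z` and `F (conj z) = conj (F z)`, every `α`-point is a reflection of a point of the
graph that lies on the level and whose phase is `± arg α` modulo `π`. Ordering `α`-points by modulus
therefore amounts to ordering them by phase. The possible phases are `kπ` for real `α`, `π / 2 + kπ`
for imaginary `α`, and `β, π - β, π + β, 2π - β, …` otherwise.

If `f - f ζ₀ ~ c (ζ - ζ₀)^(n+1)`, the cross term inequality forces `Im (c u^n) ≥ 0` for every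
direction `u` into the strip. A full circle of directions gives `n = 0`, a half circle gives `n ≤
1`: interior points are simple and edge points at most double. Consequently a generic phase carries
total multiplicity 1. A phase belonging to an edge carries 2 (a mirror pair, a double point, or both
ends of a plateau), except phase `0`, whose plateau comes from `x = -∞` and has only a right end.
Only the last phase attained can carry less (`levelSet_shape`, `levelSet_zero_shape`). Counting then
determines the phase of `z n` from `n` alone (`index_bounds`), and the signs of its cosine and sine
locate `z n`. -/

noncomputable section

/-! ### Cross terms on the strip -/

/-- The cross term `Δψ Δx - Δu Δy` of a function `g = u + i ψ` between two points. -/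
def crossIm (g : ℂ → ℂ) (ζ₁ ζ₂ : ℂ) : ℝ := ((g ζ₂ - g ζ₁) * conj (ζ₂ - ζ₁)).im

theorem crossIm_eq (g : ℂ → ℂ) (ζ₁ ζ₂ : ℂ) :
    crossIm g ζ₁ ζ₂ = ((g ζ₂).im - (g ζ₁).im) * (ζ₂.re - ζ₁.re)
      - ((g ζ₂).re - (g ζ₁).re) * (ζ₂.im - ζ₁.im) := by
  simp [crossIm, Complex.mul_im]; ring

/-- The closed strip `0 ≤ Im ζ ≤ π / 2`. -/
def logStrip : Set ℂ := {ζ | 0 ≤ ζ.im ∧ ζ.im ≤ Real.pi / 2}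

/-- The two points do not lie on the same boundary line of the strip. -/
def NotSameEdge (ζ₁ ζ₂ : ℂ) : Prop :=
  ¬ (ζ₁.im = 0 ∧ ζ₂.im = 0) ∧ ¬ (ζ₁.im = Real.pi / 2 ∧ ζ₂.im = Real.pi / 2)

/-- Along the segment, `Im (g · conj Δζ)` has derivative `Im g' · |Δζ|²`. Excluding segments inside
an edge keeps the open segment in the open strip, so nothing beyond continuity is needed at the end
points. -/
theorem crossIm_pos_of_deriv {g g' : ℂ → ℂ} {ζ₁ ζ₂ : ℂ} (h₁ : ζ₁ ∈ logStrip) (h₂ : ζ₂ ∈ logStrip)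
    (hne : ζ₁ ≠ ζ₂) (hedge : NotSameEdge ζ₁ ζ₂)
    (hg₁ : ContinuousWithinAt g logStrip ζ₁) (hg₂ : ContinuousWithinAt g logStrip ζ₂)
    (hd : ∀ ζ : ℂ, 0 < ζ.im → ζ.im < Real.pi / 2 → HasDerivAt g (g' ζ) ζ ∧ 0 < (g' ζ).im) :
    0 < crossIm g ζ₁ ζ₂ := by
  set l : ℝ → ℂ := fun t => ζ₁ + (t : ℂ) * (ζ₂ - ζ₁) with hl
  have him : ∀ t : ℝ, (l t).im = ζ₁.im + t * (ζ₂.im - ζ₁.im) := by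
    intro t; simp [hl, Complex.mul_im]
  have hlc : Continuous l := by fun_prop
  have hpi := Real.pi_pos
  have hint : ∀ t ∈ Set.Ioo (0 : ℝ) 1, 0 < (l t).im ∧ (l t).im < Real.pi / 2 := by
    rintro t ⟨ht0, ht1⟩
    rw [him]
    obtain ⟨e1, e2⟩ := hedge
    obtain ⟨a1, a2⟩ := h₁
    obtain ⟨b1, b2⟩ := h₂
    have hs : 0 < 1 - t := by linarith
    constructor
    · have : 0 < ζ₁.im ∨ 0 < ζ₂.im := by
        by_contra! h; exact e1 ⟨by linarith, by linarith⟩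
      rcases this with h | h
      · nlinarith [mul_pos hs h, mul_nonneg ht0.le b1]
      · nlinarith [mul_pos ht0 h, mul_nonneg hs.le a1]
    · have : ζ₁.im < Real.pi / 2 ∨ ζ₂.im < Real.pi / 2 := by
        by_contra! h; exact e2 ⟨by linarith, by linarith⟩
      rcases this with h | h
      · nlinarith [mul_lt_mul_of_pos_left h hs, mul_le_mul_of_nonneg_left b2 ht0.le]
      · nlinarith [mul_lt_mul_of_pos_left h ht0, mul_le_mul_of_nonneg_left a2 hs.le]
  have hl0 : l 0 = ζ₁ := by simp [hl]
  have hl1 : l 1 = ζ₂ := by simp [hl]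
  have hmem : ∀ t ∈ Set.Icc (0 : ℝ) 1, l t ∈ logStrip := by
    rintro t ⟨ht0, ht1⟩
    rcases ht0.eq_or_lt with rfl | ht0
    · rwa [hl0]
    rcases ht1.eq_or_lt with rfl | ht1
    · rwa [hl1]
    exact ⟨(hint t ⟨ht0, ht1⟩).1.le, (hint t ⟨ht0, ht1⟩).2.le⟩
  have hcont : ContinuousOn (fun t => g (l t)) (Set.Icc 0 1) := by
    intro t ht
    have key : ContinuousWithinAt g logStrip (l t) := by
      rcases ht.1.eq_or_lt with h | ht0
      · rw [← h, hl0]; exact hg₁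
      rcases ht.2.eq_or_lt with h | ht1
      · rw [h, hl1]; exact hg₂
      exact (hd _ (hint t ⟨ht0, ht1⟩).1
        (hint t ⟨ht0, ht1⟩).2).1.continuousAt.continuousWithinAt
    exact key.comp hlc.continuousWithinAt hmem
  have hder : ∀ t ∈ Set.Ioo (0 : ℝ) 1, HasDerivAt (fun t => (g (l t) * conj (ζ₂ - ζ₁)).im)
      ((g' (l t) * (ζ₂ - ζ₁) * conj (ζ₂ - ζ₁)).im) t := by
    intro t ht
    have h1 : HasDerivAt l (ζ₂ - ζ₁) t := by
      have h := ((hasDerivAt_id t).ofReal_comp.mul_const (ζ₂ - ζ₁)).const_add ζ₁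
      simpa [hl] using h
    have h2 := (hd _ (hint t ht).1 (hint t ht).2).1.comp t h1
    have h3 := (h2.mul_const (conj (ζ₂ - ζ₁)))
    exact (Complex.imCLM.hasFDerivAt.comp_hasDerivAt t h3)
  have hmono : StrictMonoOn (fun t => (g (l t) * conj (ζ₂ - ζ₁)).im) (Set.Icc 0 1) := by
    apply strictMonoOn_of_deriv_pos (convex_Icc 0 1)
    · exact Complex.continuous_im.comp_continuousOn (hcont.mul continuousOn_const)
    · intro t ht
      rw [interior_Icc] at ht
      rw [(hder t ht).deriv, mul_assoc, Complex.mul_conj, Complex.im_mul_ofReal]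
      exact mul_pos (hd _ (hint t ht).1 (hint t ht).2).2
        (Complex.normSq_pos.2 (sub_ne_zero.2 hne.symm))
  have := hmono (Set.left_mem_Icc.2 zero_le_one) (Set.right_mem_Icc.2 zero_le_one) zero_lt_one
  simp only [hl0, hl1] at this
  rw [crossIm, sub_mul, Complex.sub_im]
  linarith

/-! ### The logarithm of one factor -/

/-- The principal branch takes the upper value `π` on its cut, so it is continuous from above. This
matters on the imaginary axis, where `1 + z ^ 2 / a` may be negative. -/
theorem continuousWithinAt_log_of_im_nonneg {z : ℂ} (hz : z ≠ 0) :
    ContinuousWithinAt Complex.log {w | 0 ≤ w.im} z := by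
  by_cases h : z ∈ Complex.slitPlane
  · exact (continuousAt_clog h).continuousWithinAt
  · rw [Complex.mem_slitPlane_iff_not_le_zero, not_not] at h
    obtain ⟨h1, h2⟩ := Complex.le_def.1 h
    have hre : z.re < 0 := lt_of_le_of_ne h1 fun h0 => hz (Complex.ext h0 h2)
    exact Complex.continuousWithinAt_log_of_re_neg_of_im_zero hre h2

theorem exp_two_mul_im_nonneg {ζ : ℂ} (h : ζ ∈ logStrip) : 0 ≤ (Complex.exp (2 * ζ)).im := by
  rw [Complex.exp_im]
  refine mul_nonneg (Real.exp_pos _).le (Real.sin_nonneg_of_nonneg_of_le_pi ?_ ?_)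
  · simpa using h.1
  · have := h.2; simp; linarith

theorem exp_two_mul_im_pos {ζ : ℂ} (h0 : 0 < ζ.im) (h1 : ζ.im < Real.pi / 2) :
    0 < (Complex.exp (2 * ζ)).im := by
  rw [Complex.exp_im]
  refine mul_pos (Real.exp_pos _) (Real.sin_pos_of_pos_of_lt_pi ?_ ?_)
  · simpa using h0
  · simp; linarith

/-- The logarithm of one factor `1 + z ^ 2 / a` in the coordinate `z = exp ζ`. -/
def logFactor (a : ℝ) (ζ : ℂ) : ℂ := Complex.log (1 + Complex.exp (2 * ζ) / (a : ℂ))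

theorem factor_im (a : ℝ) (w : ℂ) : (1 + w / (a : ℂ)).im = w.im / a := by
  simp [Complex.div_ofReal_im]

theorem factor_re (a : ℝ) (w : ℂ) : (1 + w / (a : ℂ)).re = 1 + w.re / a := by
  simp [Complex.div_ofReal_re]

theorem logFactor_im_nonneg {a : ℝ} (ha : 0 < a) {ζ : ℂ} (h : ζ ∈ logStrip) :
    0 ≤ (logFactor a ζ).im := by
  rw [logFactor, Complex.log_im, Complex.arg_nonneg_iff, factor_im]
  exact div_nonneg (exp_two_mul_im_nonneg h) ha.le

theorem continuousWithinAt_logFactor {a : ℝ} (ha : 0 < a) {ζ : ℂ}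
    (hne : 1 + Complex.exp (2 * ζ) / (a : ℂ) ≠ 0) :
    ContinuousWithinAt (logFactor a) logStrip ζ := by
  refine (continuousWithinAt_log_of_im_nonneg hne).comp (t := {w | 0 ≤ w.im})
    (f := fun ζ => 1 + Complex.exp (2 * ζ) / (a : ℂ)) ?_ ?_
  · exact Continuous.continuousWithinAt (by fun_prop)
  · intro ξ hξ
    simp only [Set.mem_ofPred_eq, factor_im]
    exact div_nonneg (exp_two_mul_im_nonneg hξ) ha.le

theorem crossIm_logFactor_pos {a : ℝ} (ha : 0 < a) {ζ₁ ζ₂ : ℂ} (h₁ : ζ₁ ∈ logStrip)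
    (h₂ : ζ₂ ∈ logStrip) (n₁ : 1 + Complex.exp (2 * ζ₁) / (a : ℂ) ≠ 0)
    (n₂ : 1 + Complex.exp (2 * ζ₂) / (a : ℂ) ≠ 0) (hne : ζ₁ ≠ ζ₂) (hedge : NotSameEdge ζ₁ ζ₂) :
    0 < crossIm (logFactor a) ζ₁ ζ₂ := by
  refine crossIm_pos_of_deriv (g' := fun ζ => (2 * Complex.exp (2 * ζ) / (a : ℂ)) /
      (1 + Complex.exp (2 * ζ) / (a : ℂ))) h₁ h₂ hne hedge
    (continuousWithinAt_logFactor ha n₁) (continuousWithinAt_logFactor ha n₂) ?_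
  intro ζ h0 h1
  have hw := exp_two_mul_im_pos h0 h1
  have him : 0 < (1 + Complex.exp (2 * ζ) / (a : ℂ)).im := by
    rw [factor_im]; exact div_pos hw ha
  constructor
  · have hd : HasDerivAt (fun ζ : ℂ => 1 + Complex.exp (2 * ζ) / (a : ℂ))
        (2 * Complex.exp (2 * ζ) / (a : ℂ)) ζ := by
      have h := ((((hasDerivAt_id ζ).const_mul 2).cexp).div_const (a : ℂ)).const_add 1
      simpa [mul_comm] using h
    exact hd.clog (Or.inr him.ne')
  · set W := Complex.exp (2 * ζ) / (a : ℂ) with hW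
    have hWim : 0 < W.im := by rw [hW, Complex.div_ofReal_im]; exact div_pos hw ha
    have hne0 : 1 + W ≠ 0 := fun h => by rw [h] at him; simp at him
    have : 2 * Complex.exp (2 * ζ) / (a : ℂ) / (1 + W) = 2 * W / (1 + W) := by
      rw [hW]; ring
    rw [this, Complex.div_im]
    have hn : 0 < Complex.normSq (1 + W) := Complex.normSq_pos.2 hne0
    rw [← sub_div]
    -- `Im (2W / (1 + W)) = 2 Im W / |1 + W|²`.
    apply div_pos _ hn
    simp [Complex.mul_re, Complex.mul_im]
    nlinarith

/-- The argument is a step function, equal to `0` up to `1` and to `π` beyond. It gives the cross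
term on the upper edge, where strict positivity fails. -/
theorem arg_one_sub_ofReal_mono {r s : ℝ} (hrs : r ≤ s) :
    (1 - (r : ℂ)).arg ≤ (1 - (s : ℂ)).arg := by
  have e : ∀ t : ℝ, (1 - (t : ℂ)) = ((1 - t : ℝ) : ℂ) := fun t => by push_cast; ring
  rw [e, e]
  rcases le_or_gt 0 (1 - r) with h | h
  · rw [Complex.arg_ofReal_of_nonneg h]
    rcases le_or_gt 0 (1 - s) with h' | h'
    · rw [Complex.arg_ofReal_of_nonneg h']
    · rw [Complex.arg_ofReal_of_neg h']; exact Real.pi_pos.le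
  · rw [Complex.arg_ofReal_of_neg h, Complex.arg_ofReal_of_neg (by linarith)]

theorem exp_two_mul_of_im_eq_zero {ζ : ℂ} (h : ζ.im = 0) :
    Complex.exp (2 * ζ) = (Real.exp (2 * ζ.re) : ℂ) := by
  have : ζ = (ζ.re : ℂ) := Complex.ext rfl (by simp [h])
  rw [this]; push_cast; simp

theorem exp_two_mul_of_im_eq_pi_div_two {ζ : ℂ} (h : ζ.im = Real.pi / 2) :
    Complex.exp (2 * ζ) = -(Real.exp (2 * ζ.re) : ℂ) := by
  have : 2 * ζ = ((2 * ζ.re : ℝ) : ℂ) + Real.pi * Complex.I := by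
    apply Complex.ext
    · simp
    · simp [h]; ring
  rw [this, Complex.exp_add, Complex.exp_pi_mul_I]; push_cast; ring

theorem logFactor_im_of_im_eq_zero {a : ℝ} (ha : 0 < a) {ζ : ℂ} (h : ζ.im = 0) :
    (logFactor a ζ).im = 0 := by
  rw [logFactor, Complex.log_im, exp_two_mul_of_im_eq_zero h]
  have : (1 + (Real.exp (2 * ζ.re) : ℂ) / (a : ℂ)) = ((1 + Real.exp (2 * ζ.re) / a : ℝ) : ℂ) := by
    push_cast; ring
  rw [this]; exact Complex.arg_ofReal_of_nonneg (by positivity)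

theorem crossIm_logFactor_nonneg {a : ℝ} (ha : 0 < a) {ζ₁ ζ₂ : ℂ} (h₁ : ζ₁ ∈ logStrip)
    (h₂ : ζ₂ ∈ logStrip) (n₁ : 1 + Complex.exp (2 * ζ₁) / (a : ℂ) ≠ 0)
    (n₂ : 1 + Complex.exp (2 * ζ₂) / (a : ℂ) ≠ 0) :
    0 ≤ crossIm (logFactor a) ζ₁ ζ₂ := by
  by_cases hne : ζ₁ = ζ₂
  · simp [hne, crossIm]
  by_cases hedge : NotSameEdge ζ₁ ζ₂
  · exact (crossIm_logFactor_pos ha h₁ h₂ n₁ n₂ hne hedge).le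
  rw [NotSameEdge, ← not_or, not_not] at hedge
  rw [crossIm_eq]
  rcases hedge with ⟨e1, e2⟩ | ⟨e1, e2⟩
  · simp [logFactor_im_of_im_eq_zero ha e1, logFactor_im_of_im_eq_zero ha e2, e1, e2]
  · simp only [e1, e2, sub_self, mul_zero, sub_zero]
    have key : ∀ ζ : ℂ, ζ.im = Real.pi / 2 →
        (logFactor a ζ).im = (1 - ((Real.exp (2 * ζ.re) / a : ℝ) : ℂ)).arg := by
      intro ζ h
      rw [logFactor, Complex.log_im, exp_two_mul_of_im_eq_pi_div_two h]
      congr 1; push_cast; ring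
    rw [key _ e1, key _ e2]
    rcases le_total ζ₁.re ζ₂.re with h | h
    · refine mul_nonneg (sub_nonneg.2 (arg_one_sub_ofReal_mono ?_)) (sub_nonneg.2 h)
      gcongr
    · refine mul_nonneg_of_nonpos_of_nonpos (sub_nonpos.2 (arg_one_sub_ofReal_mono ?_))
        (sub_nonpos.2 h)
      gcongr

/-- Small `z` are handled by the estimate of `log (1 + z)`, the others by `|arg| ≤ π`. The linear
bound dominates the series of arguments by that of `1 / a ν`, even near zeros of factors. -/
theorem abs_arg_one_add_le (z : ℂ) : |(1 + z).arg| ≤ 2 * Real.pi * ‖z‖ := by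
  have hpi := Real.pi_gt_three
  rcases le_or_gt ‖z‖ (1 / 2) with h | h
  · have h1 := Complex.norm_log_one_add_half_le_self h
    have h2 := Complex.abs_im_le_norm (Complex.log (1 + z))
    rw [Complex.log_im] at h2
    nlinarith [norm_nonneg z]
  · have := Complex.abs_arg_le_pi (1 + z)
    nlinarith

theorem norm_exp_two_mul (ζ : ℂ) : ‖Complex.exp (2 * ζ)‖ = Real.exp (2 * ζ.re) := by
  rw [Complex.norm_exp]; simp

theorem abs_logFactor_im_le {a : ℝ} (ha : 0 < a) (ζ : ℂ) :
    |(logFactor a ζ).im| ≤ 2 * Real.pi * Real.exp (2 * ζ.re) * a⁻¹ := by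
  rw [logFactor, Complex.log_im]
  refine (abs_arg_one_add_le _).trans ?_
  rw [norm_div, norm_exp_two_mul, Complex.norm_real, Real.norm_of_nonneg ha.le, div_eq_mul_inv,
    ← mul_assoc]

/-- Up to height `π / 4` the number `e^{2ζ}` has nonnegative real part, so the factor has modulus at
least 1. -/
theorem logFactor_re_nonneg {a : ℝ} (ha : 0 < a) {ζ : ℂ} (h0 : 0 ≤ ζ.im)
    (h1 : ζ.im ≤ Real.pi / 4) : 0 ≤ (logFactor a ζ).re := by
  rw [logFactor, Complex.log_re]
  apply Real.log_nonneg
  refine le_trans ?_ (Complex.abs_re_le_norm _)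
  refine le_trans ?_ (le_abs_self _)
  rw [factor_re, Complex.exp_re]
  have : 0 ≤ Real.cos (2 * ζ).im := Real.cos_nonneg_of_neg_pi_div_two_le_of_le
    (by simp; linarith [Real.pi_pos]) (by simp; linarith)
  have := div_nonneg (mul_nonneg (Real.exp_pos (2 * ζ).re).le this) ha.le
  linarith

/-- Once `|z| ^ 2 > a`, the argument of `1 + z ^ 2 / a` is at least that of `z`. -/
theorem le_logFactor_im {a : ℝ} (ha : 0 < a) {ζ : ℂ} (h : ζ ∈ logStrip)
    (hx : a < Real.exp (2 * ζ.re)) : ζ.im ≤ (logFactor a ζ).im := by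
  rcases h.2.eq_or_lt with he | hlt
  · rw [logFactor, Complex.log_im, exp_two_mul_of_im_eq_pi_div_two he, he]
    have : (1 + -(Real.exp (2 * ζ.re) : ℂ) / (a : ℂ)) = ((1 - Real.exp (2 * ζ.re) / a : ℝ) : ℂ) := by
      push_cast; ring
    rw [this, Complex.arg_ofReal_of_neg]
    · linarith [Real.pi_pos]
    · rw [sub_neg, one_lt_div ha]; exact hx
  · rcases h.1.eq_or_lt with he | hgt
    · rw [← he]; exact logFactor_im_nonneg ha h
    -- `ξ` has the height of `ζ` and `|exp ξ|² = a`. There the factor is `1 + e^{2iy} = 2 cos y ·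
    -- e^{iy}`, with argument exactly `y`; moving right to `ζ` cannot decrease the argument, by the
    -- cross term inequality.
    set ξ : ℂ := ⟨Real.log a / 2, ζ.im⟩ with hξ
    have hξs : ξ ∈ logStrip := h
    have hfac : 1 + Complex.exp (2 * ξ) / (a : ℂ)
        = ((2 * Real.cos ζ.im : ℝ) : ℂ) * Complex.exp ((ζ.im : ℂ) * Complex.I) := by
      have : 2 * ξ = ((Real.log a : ℝ) : ℂ) + ((2 * ζ.im : ℝ) : ℂ) * Complex.I := by
        apply Complex.ext <;> simp [hξ]; ring
      rw [this, Complex.exp_add, ← Complex.ofReal_exp, Real.exp_log ha,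
        mul_div_cancel_left₀ _ (Complex.ofReal_ne_zero.2 ha.ne')]
      have e2 : Complex.exp (((2 * ζ.im : ℝ) : ℂ) * Complex.I)
          = Complex.exp ((ζ.im : ℂ) * Complex.I) * Complex.exp ((ζ.im : ℂ) * Complex.I) := by
        rw [← Complex.exp_add]; congr 1; push_cast; ring
      have e3 : (1 : ℂ) = Complex.exp ((ζ.im : ℂ) * Complex.I) * Complex.exp (-(ζ.im : ℂ) * Complex.I) := by
        rw [← Complex.exp_add]; ring_nf; simp
      rw [e2]; nth_rewrite 1 [e3]
      push_cast
      rw [Complex.two_cos]; ring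
    have hcos : 0 < 2 * Real.cos ζ.im := by
      have := Real.cos_pos_of_mem_Ioo (x := ζ.im) ⟨by linarith, hlt⟩
      linarith
    have hval : (logFactor a ξ).im = ζ.im := by
      rw [logFactor, Complex.log_im, hfac, Complex.arg_real_mul _ hcos, Complex.arg_exp_mul_I]
      exact (toIocMod_eq_self _).2 ⟨by linarith [Real.pi_pos], by linarith [Real.pi_pos]⟩
    have n₁ : 1 + Complex.exp (2 * ξ) / (a : ℂ) ≠ 0 := by
      rw [hfac]; exact mul_ne_zero (Complex.ofReal_ne_zero.2 hcos.ne') (Complex.exp_ne_zero _)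
    have n₂ : 1 + Complex.exp (2 * ζ) / (a : ℂ) ≠ 0 := by
      intro h0
      have := factor_im a (Complex.exp (2 * ζ))
      rw [h0] at this
      exact (div_pos (exp_two_mul_im_pos hgt hlt) ha).ne this
    have hc := crossIm_logFactor_nonneg ha hξs h n₁ n₂
    rw [crossIm_eq, hval] at hc
    have hre : 0 < ζ.re - ξ.re := by
      have := (Real.log_lt_iff_lt_exp ha).2 hx
      simp [hξ]; linarith
    have him : ζ.im - ξ.im = 0 := by simp [hξ]
    rw [him, mul_zero, sub_zero] at hc
    linarith [nonneg_of_mul_nonneg_left hc hre]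
end

noncomputable section

/-! ### Even products and their logarithms -/

section Products

variable {ι : Type*} {a : ι → ℝ}

/-- The product `∏ (1 + z ^ 2 / a ν)`. -/
def evenProd (a : ι → ℝ) (z : ℂ) : ℂ := ∏' ν, (1 + z ^ 2 / (a ν : ℂ))

/-- The sum of the logarithms of the factors `1 + z ^ 2 / a ν`, where `z = exp ζ`. -/
def logProd (a : ι → ℝ) (ζ : ℂ) : ℂ := ∑' ν, logFactor (a ν) ζ

theorem summable_div_ofReal (hsa : Summable fun ν => (a ν)⁻¹) (w : ℂ) :
    Summable fun ν => w / (a ν : ℂ) := by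
  have : Summable fun ν => (((a ν)⁻¹ : ℝ) : ℂ) := Complex.summable_ofReal.2 hsa
  simpa [div_eq_mul_inv] using this.mul_left w

theorem summable_logFactor (hsa : Summable fun ν => (a ν)⁻¹) (ζ : ℂ) :
    Summable fun ν => logFactor (a ν) ζ :=
  Complex.summable_log_one_add_of_summable (summable_div_ofReal hsa _)

theorem differentiable_evenProd (ha : ∀ ν, 0 < a ν) (hsa : Summable fun ν => (a ν)⁻¹) :
    Differentiable ℂ (evenProd a) := by
  intro z
  have hu : Summable fun ν => (‖z‖ + 1) ^ 2 * (a ν)⁻¹ := hsa.mul_left _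
  have h := Summable.hasProdLocallyUniformlyOn_one_add (f := fun ν (z : ℂ) => z ^ 2 / (a ν : ℂ))
    (K := Metric.ball (0 : ℂ) (‖z‖ + 1)) Metric.isOpen_ball hu
    (Filter.Eventually.of_forall fun ν w hw => by
      have hw' : ‖w‖ ≤ ‖z‖ + 1 := by simpa using (Metric.mem_ball.1 hw).le
      rw [norm_div, norm_pow, Complex.norm_real, Real.norm_of_nonneg (ha ν).le, div_eq_mul_inv]
      have := inv_nonneg.2 (ha ν).le
      gcongr)
    (fun ν => by fun_prop)
  have hd := h.differentiableOn (Filter.Eventually.of_forall fun s => by fun_prop)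
    Metric.isOpen_ball
  exact hd.differentiableAt (Metric.isOpen_ball.mem_nhds (by simp))

theorem evenProd_neg (a : ι → ℝ) (z : ℂ) : evenProd a (-z) = evenProd a z := by
  simp [evenProd]

theorem evenProd_zero (a : ι → ℝ) : evenProd a 0 = 1 := by
  simp [evenProd]

theorem multipliable_factor (hsa : Summable fun ν => (a ν)⁻¹) (w : ℂ) :
    Multipliable fun ν => 1 + w / (a ν : ℂ) :=
  multipliable_one_add_of_summable (summable_div_ofReal hsa w).norm

theorem evenProd_conj (hsa : Summable fun ν => (a ν)⁻¹) (z : ℂ) :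
    evenProd a (conj z) = conj (evenProd a z) := by
  rw [evenProd, evenProd, (multipliable_factor hsa (z ^ 2)).map_tprod (starRingEnd ℂ)
    Complex.continuous_conj]
  simp

theorem exp_logProd (hsa : Summable fun ν => (a ν)⁻¹) {ζ : ℂ}
    (h : ∀ ν, 1 + Complex.exp (2 * ζ) / (a ν : ℂ) ≠ 0) :
    Complex.exp (logProd a ζ) = evenProd a (Complex.exp ζ) := by
  have := Complex.cexp_tsum_eq_tprod h (summable_logFactor hsa ζ)
  rw [logProd, evenProd, ← Complex.exp_nat_mul]
  exact this

theorem factor_ne_zero_of_evenProd {ζ : ℂ} (h : evenProd a (Complex.exp ζ) ≠ 0) (ν : ι) :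
    1 + Complex.exp (2 * ζ) / (a ν : ℂ) ≠ 0 := by
  intro h0
  refine h (tprod_of_exists_eq_zero ⟨ν, ?_⟩)
  rw [← h0, ← Complex.exp_nat_mul]; norm_cast

theorem factor_ne_zero {c : ℝ} (hc : 0 < c) {ζ : ℂ} (h : ζ ∈ logStrip)
    (h1 : ζ.im < Real.pi / 2) : 1 + Complex.exp (2 * ζ) / (c : ℂ) ≠ 0 := by
  intro h0
  rcases h.1.eq_or_lt with he | hgt
  · have := factor_re c (Complex.exp (2 * ζ))
    rw [h0, exp_two_mul_of_im_eq_zero he.symm, Complex.ofReal_re] at this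
    have h2 : 0 < 1 + Real.exp (2 * ζ.re) / c := by positivity
    exact h2.ne this
  · have := factor_im c (Complex.exp (2 * ζ))
    rw [h0] at this
    exact (div_pos (exp_two_mul_im_pos hgt h1) hc).ne this

theorem evenProd_ne_zero (ha : ∀ ν, 0 < a ν) (hsa : Summable fun ν => (a ν)⁻¹) {ζ : ℂ}
    (h : ζ ∈ logStrip) (h1 : ζ.im < Real.pi / 2) : evenProd a (Complex.exp ζ) ≠ 0 := by
  rw [← exp_logProd hsa fun ν => factor_ne_zero (ha ν) h h1]
  exact Complex.exp_ne_zero _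

theorem logProd_im (hsa : Summable fun ν => (a ν)⁻¹) (ζ : ℂ) :
    (logProd a ζ).im = ∑' ν, (logFactor (a ν) ζ).im :=
  Complex.im_tsum (summable_logFactor hsa ζ)

theorem logProd_re (hsa : Summable fun ν => (a ν)⁻¹) (ζ : ℂ) :
    (logProd a ζ).re = ∑' ν, (logFactor (a ν) ζ).re :=
  Complex.re_tsum (summable_logFactor hsa ζ)

theorem summable_logFactor_im (hsa : Summable fun ν => (a ν)⁻¹) (ζ : ℂ) :
    Summable fun ν => (logFactor (a ν) ζ).im :=
  (Complex.hasSum_im (summable_logFactor hsa ζ).hasSum).summable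

theorem logProd_im_nonneg (ha : ∀ ν, 0 < a ν) (hsa : Summable fun ν => (a ν)⁻¹) {ζ : ℂ}
    (h : ζ ∈ logStrip) : 0 ≤ (logProd a ζ).im := by
  rw [logProd_im hsa]
  exact tsum_nonneg fun ν => logFactor_im_nonneg (ha ν) h

theorem logFactor_im_le_logProd_im (ha : ∀ ν, 0 < a ν) (hsa : Summable fun ν => (a ν)⁻¹) {ζ : ℂ}
    (h : ζ ∈ logStrip) (ν : ι) : (logFactor (a ν) ζ).im ≤ (logProd a ζ).im := by
  rw [logProd_im hsa]
  exact (summable_logFactor_im hsa ζ).le_tsum ν fun i _ => logFactor_im_nonneg (ha i) h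

theorem logProd_re_nonneg (ha : ∀ ν, 0 < a ν) (hsa : Summable fun ν => (a ν)⁻¹) {ζ : ℂ}
    (h0 : 0 ≤ ζ.im) (h1 : ζ.im ≤ Real.pi / 4) : 0 ≤ (logProd a ζ).re := by
  rw [logProd_re hsa]
  exact tsum_nonneg fun ν => logFactor_re_nonneg (ha ν) h0 h1

theorem logProd_im_le (ha : ∀ ν, 0 < a ν) (hsa : Summable fun ν => (a ν)⁻¹) (ζ : ℂ) :
    (logProd a ζ).im ≤ 2 * Real.pi * (∑' ν, (a ν)⁻¹) * Real.exp (2 * ζ.re) := by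
  rw [logProd_im hsa]
  calc _ ≤ ∑' ν, 2 * Real.pi * Real.exp (2 * ζ.re) * (a ν)⁻¹ :=
        (summable_logFactor_im hsa ζ).tsum_le_tsum
          (fun ν => (le_abs_self _).trans (abs_logFactor_im_le (ha ν) ζ)) (hsa.mul_left _)
    _ = _ := by rw [tsum_mul_left]; ring

/-- Dominated convergence of the series of arguments. Continuity is asserted only within a set free
of zeros of the factors, since each argument jumps at its zero on the upper edge. -/
theorem continuousWithinAt_logProd_im (ha : ∀ ν, 0 < a ν) (hsa : Summable fun ν => (a ν)⁻¹)
    {s : Set ℂ} (hs : s ⊆ logStrip) {ζ : ℂ} (hζ : ζ ∈ s)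
    (h : ∀ ξ ∈ s, ∀ ν, 1 + Complex.exp (2 * ξ) / (a ν : ℂ) ≠ 0) :
    ContinuousWithinAt (fun ξ => (logProd a ξ).im) s ζ := by
  -- Bounding `Re ξ` makes the majorant `2π e^{2 Re ξ} / a ν` uniform.
  set t := s ∩ {ξ | ξ.re < ζ.re + 1} with ht
  have hopen : {ξ : ℂ | ξ.re < ζ.re + 1} ∈ nhds ζ :=
    (isOpen_lt Complex.continuous_re continuous_const).mem_nhds
      (show ζ.re < ζ.re + 1 by linarith)
  have hc : ContinuousOn (fun ξ => ∑' ν, (logFactor (a ν) ξ).im) t := by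
    refine continuousOn_tsum (u := fun ν => 2 * Real.pi * Real.exp (2 * (ζ.re + 1)) * (a ν)⁻¹)
      (fun ν ξ hξ => ?_) (hsa.mul_left _) ?_
    · exact (Complex.continuous_im.continuousAt.comp_continuousWithinAt
        (continuousWithinAt_logFactor (ha ν) (h ξ hξ.1 ν))).mono
          (Set.inter_subset_left.trans hs)
    · intro ν ξ hξ
      refine (abs_logFactor_im_le (ha ν) ξ).trans ?_
      have h1 : ξ.re < ζ.re + 1 := hξ.2
      have := inv_nonneg.2 (ha ν).le
      have := Real.pi_pos
      gcongr
  have := hc ζ ⟨hζ, mem_of_mem_nhds hopen⟩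
  rw [ht, continuousWithinAt_inter hopen] at this
  exact this.congr (fun ξ _ => logProd_im hsa ξ) (logProd_im hsa ζ)

theorem hasSum_crossIm_logProd (hsa : Summable fun ν => (a ν)⁻¹) (ζ₁ ζ₂ : ℂ) :
    HasSum (fun ν => crossIm (logFactor (a ν)) ζ₁ ζ₂) (crossIm (logProd a) ζ₁ ζ₂) :=
  Complex.hasSum_im ((((summable_logFactor hsa ζ₂).hasSum).sub
    ((summable_logFactor hsa ζ₁).hasSum)).mul_right _)

theorem crossIm_logProd_nonneg (ha : ∀ ν, 0 < a ν) (hsa : Summable fun ν => (a ν)⁻¹) {ζ₁ ζ₂ : ℂ}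
    (h₁ : ζ₁ ∈ logStrip) (h₂ : ζ₂ ∈ logStrip) (n₁ : evenProd a (Complex.exp ζ₁) ≠ 0)
    (n₂ : evenProd a (Complex.exp ζ₂) ≠ 0) : 0 ≤ crossIm (logProd a) ζ₁ ζ₂ :=
  (hasSum_crossIm_logProd hsa ζ₁ ζ₂).nonneg fun ν => crossIm_logFactor_nonneg (ha ν) h₁ h₂
    (factor_ne_zero_of_evenProd n₁ ν) (factor_ne_zero_of_evenProd n₂ ν)

theorem crossIm_logProd_pos [Nonempty ι] (ha : ∀ ν, 0 < a ν) (hsa : Summable fun ν => (a ν)⁻¹)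
    {ζ₁ ζ₂ : ℂ} (h₁ : ζ₁ ∈ logStrip) (h₂ : ζ₂ ∈ logStrip)
    (n₁ : evenProd a (Complex.exp ζ₁) ≠ 0) (n₂ : evenProd a (Complex.exp ζ₂) ≠ 0)
    (hne : ζ₁ ≠ ζ₂) (hedge : NotSameEdge ζ₁ ζ₂) : 0 < crossIm (logProd a) ζ₁ ζ₂ := by
  obtain ⟨ν⟩ := ‹Nonempty ι›
  rw [← (hasSum_crossIm_logProd hsa ζ₁ ζ₂).tsum_eq]
  exact (hasSum_crossIm_logProd hsa ζ₁ ζ₂).summable.tsum_pos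
    (fun ν => crossIm_logFactor_nonneg (ha ν) h₁ h₂
      (factor_ne_zero_of_evenProd n₁ ν) (factor_ne_zero_of_evenProd n₂ ν)) ν
    (crossIm_logFactor_pos (ha ν) h₁ h₂
      (factor_ne_zero_of_evenProd n₁ ν) (factor_ne_zero_of_evenProd n₂ ν) hne hedge)

end Products

end

/-! ### Abstract model of a quotient with monotone phase -/

noncomputable section

/-- The points of the closed strip at which neither `num (exp ζ)` nor `den (exp ζ)` vanishes. -/
def regStrip (num den : ℂ → ℂ) : Set ℂ :=
  {ζ | ζ ∈ logStrip ∧ num (Complex.exp ζ) ≠ 0 ∧ den (Complex.exp ζ) ≠ 0}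

/-- A quotient `num / den` with a logarithm `f` in the coordinate `z = exp ζ` of the closed first
quadrant, such that the cross terms of `f` are positive. -/
structure PhaseModel (p : ℕ) (num den f : ℂ → ℂ) : Prop where
  num_diff : Differentiable ℂ num
  den_diff : Differentiable ℂ den
  num_zero : num 0 = 0
  den_zero : den 0 ≠ 0
  num_neg : ∀ z, num (-z) = -num z
  den_neg : ∀ z, den (-z) = den z
  num_conj : ∀ z, num (conj z) = conj (num z)
  den_conj : ∀ z, den (conj z) = conj (den z)
  num_ne : ∀ ζ ∈ logStrip, ζ.im < Real.pi / 2 → num (Complex.exp ζ) ≠ 0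
  den_ne : ∀ ζ ∈ logStrip, 0 < ζ.im → den (Complex.exp ζ) ≠ 0
  exp_eq : ∀ ζ ∈ regStrip num den,
    Complex.exp (f ζ) = num (Complex.exp ζ) / den (Complex.exp ζ)
  cont : ContinuousOn (fun ζ => (f ζ).im) (regStrip num den)
  cross_nonneg : ∀ ζ₁ ∈ regStrip num den, ∀ ζ₂ ∈ regStrip num den, 0 ≤ crossIm f ζ₁ ζ₂
  cross_pos : ∀ ζ₁ ∈ regStrip num den, ∀ ζ₂ ∈ regStrip num den, ζ₁ ≠ ζ₂ →
    NotSameEdge ζ₁ ζ₂ → 0 < crossIm f ζ₁ ζ₂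
  im_ge : ∀ ζ ∈ regStrip num den, p * ζ.im ≤ (f ζ).im
  im_lim : ∀ ε : ℝ, 0 < ε → ∃ x₀ : ℝ, ∀ x ≤ x₀, |(f (x : ℂ)).im| < ε
  -- The inner hypothesis is what holds at a point of the level curve: below the upper edge, `|num /
  -- den| ≤ c`. The field makes the phase reach `π / 2` on that curve, so that the first level is
  -- occupied.
  large : ∀ c : ℝ, ∃ x : ℝ, ∀ ζ ∈ regStrip num den, ζ.re = x →
    (ζ.im < Real.pi / 2 → ‖num (Complex.exp ζ)‖ ≤ c * ‖den (Complex.exp ζ)‖) →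
    Real.pi / 2 ≤ (f ζ).im

/-- Reflection of the strip in its middle line. -/
def stripReflect (ζ : ℂ) : ℂ := conj ζ + (Real.pi / 2 : ℝ) * Complex.I

theorem stripReflect_re (ζ : ℂ) : (stripReflect ζ).re = ζ.re := by simp [stripReflect]

theorem stripReflect_im (ζ : ℂ) : (stripReflect ζ).im = Real.pi / 2 - ζ.im := by
  simp [stripReflect]; ring

theorem stripReflect_mem {ζ : ℂ} (h : ζ ∈ logStrip) : stripReflect ζ ∈ logStrip := by
  constructor
  · rw [stripReflect_im]; linarith [h.2]
  · rw [stripReflect_im]; linarith [h.1]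

theorem stripReflect_injective : Function.Injective stripReflect := by
  intro z w h
  apply Complex.ext
  · rw [← stripReflect_re, h, stripReflect_re]
  · have := congrArg Complex.im h
    rw [stripReflect_im, stripReflect_im] at this; linarith

theorem notSameEdge_stripReflect {ζ₁ ζ₂ : ℂ} (h : NotSameEdge ζ₁ ζ₂) :
    NotSameEdge (stripReflect ζ₁) (stripReflect ζ₂) := by
  obtain ⟨h1, h2⟩ := h
  constructor
  · rintro ⟨a, b⟩; rw [stripReflect_im] at a b; exact h2 ⟨by linarith, by linarith⟩
  · rintro ⟨a, b⟩; rw [stripReflect_im] at a b; exact h1 ⟨by linarith, by linarith⟩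

theorem exp_stripReflect (ζ : ℂ) :
    Complex.exp (stripReflect ζ) = Complex.I * conj (Complex.exp ζ) := by
  rw [stripReflect, Complex.exp_add, Complex.exp_conj]
  push_cast
  rw [Complex.exp_pi_div_two_mul_I, mul_comm]

theorem continuous_stripReflect : Continuous stripReflect := by
  unfold stripReflect; fun_prop

theorem crossIm_exp_nonneg {A : ℝ} (hA : 0 ≤ A) {ζ₁ ζ₂ : ℂ} (h₁ : ζ₁ ∈ logStrip)
    (h₂ : ζ₂ ∈ logStrip) :
    0 ≤ crossIm (fun ζ => A * Complex.exp (2 * ζ)) ζ₁ ζ₂ ∧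
      (0 < A → ζ₁ ≠ ζ₂ → NotSameEdge ζ₁ ζ₂ →
        0 < crossIm (fun ζ => A * Complex.exp (2 * ζ)) ζ₁ ζ₂) := by
  have hpos : 0 < A → ζ₁ ≠ ζ₂ → NotSameEdge ζ₁ ζ₂ →
        0 < crossIm (fun ζ => A * Complex.exp (2 * ζ)) ζ₁ ζ₂ := by
    intro hA hne hedge
    refine crossIm_pos_of_deriv (g' := fun ζ => A * (2 * Complex.exp (2 * ζ))) h₁ h₂ hne hedge
      (Continuous.continuousWithinAt (by fun_prop)) (Continuous.continuousWithinAt (by fun_prop)) ?_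
    intro ζ h0 h1
    constructor
    · have h := (((hasDerivAt_id ζ).const_mul 2).cexp).const_mul (A : ℂ)
      simpa [mul_comm] using h
    · have := exp_two_mul_im_pos h0 h1
      rw [Complex.im_ofReal_mul]
      have e : (2 * Complex.exp (2 * ζ)).im = 2 * (Complex.exp (2 * ζ)).im := by
        simp [Complex.mul_im]
      rw [e]; positivity
  refine ⟨?_, hpos⟩
  rcases hA.eq_or_lt with h | hA
  · simp [← h, crossIm]
  by_cases hne : ζ₁ = ζ₂
  · simp [hne, crossIm]
  by_cases hedge : NotSameEdge ζ₁ ζ₂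
  · exact (hpos hA hne hedge).le
  rw [NotSameEdge, ← not_or, not_not] at hedge
  rw [crossIm_eq]
  rcases hedge with ⟨e1, e2⟩ | ⟨e1, e2⟩
  · rw [exp_two_mul_of_im_eq_zero e1, exp_two_mul_of_im_eq_zero e2]
    simp only [Complex.im_ofReal_mul, Complex.ofReal_im, e1, e2]; simp
  · rw [exp_two_mul_of_im_eq_pi_div_two e1, exp_two_mul_of_im_eq_pi_div_two e2]
    simp only [Complex.im_ofReal_mul, Complex.neg_im, Complex.ofReal_im, e1, e2]; simp

/-! ### The given function fits the model -/

section Model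

variable {ι κ : Type*} (p : ℕ) (A : ℝ) (a : ι → ℝ) (b : κ → ℝ)

/-- The numerator of `oddPF`. -/
def pfNum (z : ℂ) : ℂ := z ^ p * Complex.exp ((A : ℂ) * z ^ 2) * evenProd a z

/-- The denominator of `oddPF`. -/
def pfDen (z : ℂ) : ℂ := evenProd b (Complex.I * z)

/-- The logarithm of `oddPF` in the coordinate `z = exp ζ` of the first quadrant. -/
def pfLog (ζ : ℂ) : ℂ :=
  p * ζ + A * Complex.exp (2 * ζ) + logProd a ζ - conj (logProd b (stripReflect ζ))

theorem oddPF_eq (z : ℂ) : oddPF p A a b z = pfNum p A a z / pfDen b z := by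
  have : ∀ μ, 1 - z ^ 2 / (b μ : ℂ) = 1 + (Complex.I * z) ^ 2 / (b μ : ℂ) := by
    intro μ; rw [mul_pow, Complex.I_sq]; ring
  simp only [oddPF, pfNum, pfDen, evenProd, this]

variable {p A a b}

theorem pfDen_exp (hsb : Summable fun μ => (b μ)⁻¹) (ζ : ℂ) :
    pfDen b (Complex.exp ζ) = conj (evenProd b (Complex.exp (stripReflect ζ))) := by
  rw [exp_stripReflect, ← evenProd_conj hsb, pfDen, map_mul, Complex.conj_conj, Complex.conj_I,
    neg_mul, evenProd_neg]

theorem pfNum_exp_ne_zero {ζ : ℂ} :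
    pfNum p A a (Complex.exp ζ) ≠ 0 ↔ evenProd a (Complex.exp ζ) ≠ 0 := by
  simp [pfNum, Complex.exp_ne_zero]

theorem pfDen_exp_ne_zero (hsb : Summable fun μ => (b μ)⁻¹) {ζ : ℂ} :
    pfDen b (Complex.exp ζ) ≠ 0 ↔ evenProd b (Complex.exp (stripReflect ζ)) ≠ 0 := by
  rw [pfDen_exp hsb]; simp

/-- The term `p ζ` drops out because its slope is real. For the poles, `-conj` keeps imaginary parts
and negates real parts, while `stripReflect` keeps `Δx` and negates `Δy`; the two changes cancel. -/
theorem crossIm_pfLog (ζ₁ ζ₂ : ℂ) :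
    crossIm (pfLog p A a b) ζ₁ ζ₂ = crossIm (fun ζ => A * Complex.exp (2 * ζ)) ζ₁ ζ₂ +
      crossIm (logProd a) ζ₁ ζ₂ + crossIm (logProd b) (stripReflect ζ₁) (stripReflect ζ₂) := by
  simp only [crossIm_eq, stripReflect_re, stripReflect_im]
  simp [pfLog]
  ring

theorem pfLog_im (ζ : ℂ) : (pfLog p A a b ζ).im = p * ζ.im + A * (Complex.exp (2 * ζ)).im +
    (logProd a ζ).im + (logProd b (stripReflect ζ)).im := by
  simp [pfLog]

/-- The term `p ζ` contributes at least the height `y`, so a further `π / 2 - y` suffices. A pole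
factor supplies it for large `x`. Without poles, the level curve lies above `π / 4` for large `x`,
and then a zero factor contributes another `y`, or the exponential contributes enough by itself. -/
theorem pfLog_phase_large (hp : 1 ≤ p) (hA : 0 ≤ A) (ha : ∀ ν, 0 < a ν)
    (hsa : Summable fun ν => (a ν)⁻¹) (hb : ∀ μ, 0 < b μ) (hsb : Summable fun μ => (b μ)⁻¹)
    (hne : 0 < A ∨ Nonempty ι ∨ Nonempty κ) (c : ℝ) :
    ∃ x : ℝ, ∀ ζ ∈ regStrip (pfNum p A a) (pfDen b), ζ.re = x →
    (ζ.im < Real.pi / 2 → ‖pfNum p A a (Complex.exp ζ)‖ ≤ c * ‖pfDen b (Complex.exp ζ)‖) →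
    Real.pi / 2 ≤ (pfLog p A a b ζ).im := by
  have hpi := Real.pi_pos
  have hp' : (1 : ℝ) ≤ p := by exact_mod_cast hp
  have exp_gt : ∀ c : ℝ, ∃ x : ℝ, 0 ≤ x ∧ c < Real.exp (2 * x) := fun c =>
    ⟨|c|, abs_nonneg c, by linarith [Real.add_one_le_exp (2 * |c|), le_abs_self c, abs_nonneg c]⟩
  have hlow : ∀ ζ ∈ regStrip (pfNum p A a) (pfDen b), ζ.im ≤ p * ζ.im ∧
      0 ≤ A * (Complex.exp (2 * ζ)).im ∧ 0 ≤ (logProd a ζ).im ∧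
        0 ≤ (logProd b (stripReflect ζ)).im := fun ζ hζ =>
    ⟨le_mul_of_one_le_left hζ.1.1 hp', mul_nonneg hA (exp_two_mul_im_nonneg hζ.1),
      logProd_im_nonneg ha hsa hζ.1, logProd_im_nonneg hb hsb (stripReflect_mem hζ.1)⟩
  by_cases hκ : Nonempty κ
  · obtain ⟨μ⟩ := hκ
    obtain ⟨x, -, hx⟩ := exp_gt (b μ)
    refine ⟨x, fun ζ hζ hre _ => ?_⟩
    obtain ⟨h1, h2, h3, -⟩ := hlow ζ hζ
    have hs := stripReflect_mem hζ.1
    have h4 := le_logFactor_im (hb μ) hs (by rwa [stripReflect_re, hre])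
    have h5 := logFactor_im_le_logProd_im hb hsb hs μ
    rw [stripReflect_im] at h4
    rw [pfLog_im]; linarith
  have hκ' : IsEmpty κ := not_nonempty_iff.1 hκ
  have hden : ∀ z, pfDen b z = 1 := fun z => by simp [pfDen, evenProd]
  -- Up to height `π / 4` and for `x ≥ 0`, the numerator has modulus at least `e^x` and the
  -- denominator is 1.
  have hmid : ∀ ζ ∈ regStrip (pfNum p A a) (pfDen b), c < Real.exp (2 * (ζ.re / 2)) → 0 ≤ ζ.re →
      (ζ.im < Real.pi / 2 → ‖pfNum p A a (Complex.exp ζ)‖ ≤ c * ‖pfDen b (Complex.exp ζ)‖) →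
      Real.pi / 4 < ζ.im := by
    intro ζ hζ hc hx h
    by_contra! hle
    have h1 := h (by linarith)
    rw [hden, norm_one, mul_one, pfNum,
      ← exp_logProd hsa fun ν => factor_ne_zero (ha ν) hζ.1 (by linarith), ← Complex.exp_nat_mul,
      ← Complex.exp_nat_mul, ← Complex.exp_add, ← Complex.exp_add, Complex.norm_exp] at h1
    refine absurd (hc.trans_le (le_trans ?_ h1)) (lt_irrefl _)
    rw [Real.exp_le_exp]
    have h2 := logProd_re_nonneg ha hsa hζ.1.1 hle
    have h3 : 0 ≤ (Complex.exp (2 * ζ)).re := by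
      rw [Complex.exp_re]
      refine mul_nonneg (Real.exp_pos _).le (Real.cos_nonneg_of_neg_pi_div_two_le_of_le ?_ ?_)
      · have := hζ.1.1; simp; linarith
      · simp; linarith
    have h4 : ζ.re ≤ p * ζ.re := le_mul_of_one_le_left hx hp'
    have h5 := mul_nonneg hA h3
    have h6 : ((p : ℂ) * ζ).re = p * ζ.re := by simp
    rw [Complex.add_re, Complex.add_re, Complex.re_ofReal_mul, h6]
    push_cast
    linarith
  by_cases hι : Nonempty ι
  · obtain ⟨ν⟩ := hι
    obtain ⟨x, hx0, hx⟩ := exp_gt (max c (a ν))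
    -- The abscissa is doubled because the modulus is bounded below only by `e^x`, whereas `x` was
    -- chosen for `e^{2x}`.
    refine ⟨2 * x, fun ζ hζ hre h => ?_⟩
    have hx1 := (le_max_left _ _).trans_lt hx
    have hx2 := (le_max_right _ _).trans_lt hx
    obtain ⟨h1, h2, -, h3⟩ := hlow ζ hζ
    have h4 := hmid ζ hζ (by rw [hre]; ring_nf at hx1 ⊢; exact hx1) (by linarith) h
    have h5 := le_logFactor_im (ha ν) hζ.1 (hx2.trans_le (Real.exp_le_exp.2 (by linarith)))
    have h6 := logFactor_im_le_logProd_im ha hsa hζ.1 ν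
    rw [pfLog_im]; linarith
  have hA' : 0 < A := by
    rcases hne with h | h | h
    · exact h
    · exact absurd h hι
    · exact absurd h hκ
  obtain ⟨x, hx0, hx⟩ := exp_gt (max c A⁻¹)
  refine ⟨2 * x, fun ζ hζ hre h => ?_⟩
  have hx1 := (le_max_left _ _).trans_lt hx
  have hx2 := (le_max_right _ _).trans_lt hx
  obtain ⟨h1, -, h2, h3⟩ := hlow ζ hζ
  have h4 := hmid ζ hζ (by rw [hre]; ring_nf at hx1 ⊢; exact hx1) (by linarith) h
  have h5 : 1 ≤ A * Real.exp (2 * ζ.re) := by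
    have : A⁻¹ ≤ Real.exp (2 * ζ.re) := hx2.le.trans (Real.exp_le_exp.2 (by linarith))
    calc 1 = A * A⁻¹ := (mul_inv_cancel₀ hA'.ne').symm
      _ ≤ _ := by gcongr
  -- Jordan's inequality at `π - 2y`, together with `2 / π ≥ 1 / 2`.
  have h6 : Real.pi / 2 - ζ.im ≤ Real.sin (2 * ζ.im) := by
    have h7 := hζ.1.2
    have := Real.mul_le_sin (x := Real.pi - 2 * ζ.im) (by linarith) (by linarith)
    rw [Real.sin_pi_sub] at this
    refine le_trans ?_ this
    have h8 : 1 / 2 ≤ 2 / Real.pi := by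
      rw [div_le_div_iff₀ two_pos hpi]; linarith [Real.pi_le_four]
    nlinarith
  have h7 : Real.pi / 2 - ζ.im ≤ A * (Complex.exp (2 * ζ)).im := by
    have e : (Complex.exp (2 * ζ)).im = Real.exp (2 * ζ.re) * Real.sin (2 * ζ.im) := by
      rw [Complex.exp_im]; simp
    rw [e, ← mul_assoc]
    refine h6.trans (le_mul_of_one_le_left ?_ h5)
    linarith [hζ.1.2]
  rw [pfLog_im]; linarith

theorem pf_phaseModel (j : ℕ) (hp : p = 2 * j + 1) (hA : 0 ≤ A) (ha : ∀ ν, 0 < a ν)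
    (hsa : Summable fun ν => (a ν)⁻¹) (hb : ∀ μ, 0 < b μ) (hsb : Summable fun μ => (b μ)⁻¹)
    (hne : 0 < A ∨ Nonempty ι ∨ Nonempty κ) :
    PhaseModel p (pfNum p A a) (pfDen b) (pfLog p A a b) where
  num_diff := by
    have := differentiable_evenProd ha hsa
    unfold pfNum; fun_prop
  den_diff := by
    have := differentiable_evenProd hb hsb
    unfold pfDen; fun_prop
  num_zero := by simp [pfNum, hp]
  den_zero := by simp [pfDen, evenProd_zero]
  num_neg z := by
    have : Odd p := ⟨j, hp⟩
    simp [pfNum, evenProd_neg, this.neg_pow]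
  den_neg z := by simp [pfDen, evenProd_neg]
  num_conj z := by
    simp only [pfNum, evenProd_conj hsa, map_mul, map_pow, ← Complex.exp_conj, Complex.conj_ofReal]
  den_conj z := by
    rw [pfDen, pfDen, ← evenProd_conj hsb, map_mul, Complex.conj_I, neg_mul, evenProd_neg]
  num_ne ζ hζ h := pfNum_exp_ne_zero.2 (evenProd_ne_zero ha hsa hζ h)
  den_ne ζ hζ h := (pfDen_exp_ne_zero hsb).2 (evenProd_ne_zero hb hsb (stripReflect_mem hζ)
    (by rw [stripReflect_im]; linarith))
  exp_eq ζ hζ := by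
    have h1 := factor_ne_zero_of_evenProd (pfNum_exp_ne_zero.1 hζ.2.1)
    have h2 := factor_ne_zero_of_evenProd ((pfDen_exp_ne_zero hsb).1 hζ.2.2)
    rw [pfLog, Complex.exp_sub, Complex.exp_add, Complex.exp_add, exp_logProd hsa h1,
      Complex.exp_conj, exp_logProd hsb h2, ← pfDen_exp hsb, pfNum, Complex.exp_nat_mul,
      ← Complex.exp_nat_mul _ 2]
    norm_cast
  cont := by
    intro ζ hζ
    have h1 : ContinuousWithinAt (fun ξ => (logProd a ξ).im) (regStrip (pfNum p A a) (pfDen b)) ζ :=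
      continuousWithinAt_logProd_im ha hsa (fun ξ hξ => hξ.1) hζ
        fun ξ hξ => factor_ne_zero_of_evenProd (pfNum_exp_ne_zero.1 hξ.2.1)
    have h2 : ContinuousWithinAt (fun ξ => (logProd b ξ).im)
        (stripReflect '' regStrip (pfNum p A a) (pfDen b)) (stripReflect ζ) := by
      refine continuousWithinAt_logProd_im hb hsb ?_ ⟨ζ, hζ, rfl⟩ ?_
      · rintro _ ⟨ξ, hξ, rfl⟩; exact stripReflect_mem hξ.1
      · rintro _ ⟨ξ, hξ, rfl⟩
        exact factor_ne_zero_of_evenProd ((pfDen_exp_ne_zero hsb).1 hξ.2.2)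
    have h3 := h2.comp continuous_stripReflect.continuousWithinAt (Set.mapsTo_image _ _)
    have h4 : Continuous fun ξ : ℂ => p * ξ.im + A * (Complex.exp (2 * ξ)).im := by
      have := Complex.continuous_im; fun_prop
    simp only [pfLog_im]
    exact (h4.continuousWithinAt.add h1).add h3
  cross_nonneg ζ₁ h₁ ζ₂ h₂ := by
    rw [crossIm_pfLog]
    exact add_nonneg (add_nonneg (crossIm_exp_nonneg hA h₁.1 h₂.1).1
      (crossIm_logProd_nonneg ha hsa h₁.1 h₂.1 (pfNum_exp_ne_zero.1 h₁.2.1)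
        (pfNum_exp_ne_zero.1 h₂.2.1)))
      (crossIm_logProd_nonneg hb hsb (stripReflect_mem h₁.1) (stripReflect_mem h₂.1)
        ((pfDen_exp_ne_zero hsb).1 h₁.2.2) ((pfDen_exp_ne_zero hsb).1 h₂.2.2))
  cross_pos ζ₁ h₁ ζ₂ h₂ hn hedge := by
    have e1 := (crossIm_exp_nonneg hA h₁.1 h₂.1).1
    have e2 := crossIm_logProd_nonneg ha hsa h₁.1 h₂.1 (pfNum_exp_ne_zero.1 h₁.2.1)
        (pfNum_exp_ne_zero.1 h₂.2.1)
    have e3 := crossIm_logProd_nonneg hb hsb (stripReflect_mem h₁.1) (stripReflect_mem h₂.1)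
        ((pfDen_exp_ne_zero hsb).1 h₁.2.2) ((pfDen_exp_ne_zero hsb).1 h₂.2.2)
    rw [crossIm_pfLog]
    rcases hne with h | h | h
    · have := (crossIm_exp_nonneg hA h₁.1 h₂.1).2 h hn hedge
      linarith
    · have := crossIm_logProd_pos ha hsa h₁.1 h₂.1 (pfNum_exp_ne_zero.1 h₁.2.1)
        (pfNum_exp_ne_zero.1 h₂.2.1) hn hedge
      linarith
    · have := crossIm_logProd_pos hb hsb (stripReflect_mem h₁.1) (stripReflect_mem h₂.1)
        ((pfDen_exp_ne_zero hsb).1 h₁.2.2) ((pfDen_exp_ne_zero hsb).1 h₂.2.2)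
        (stripReflect_injective.ne hn) (notSameEdge_stripReflect hedge)
      linarith
  im_ge ζ hζ := by
    have h2 := mul_nonneg hA (exp_two_mul_im_nonneg hζ.1)
    have h3 := logProd_im_nonneg ha hsa hζ.1
    have h4 := logProd_im_nonneg hb hsb (stripReflect_mem hζ.1)
    rw [pfLog_im]; linarith
  im_lim ε hε := by
    set C := 2 * Real.pi * (∑' ν, (a ν)⁻¹) + 2 * Real.pi * (∑' μ, (b μ)⁻¹) with hC
    have hlim : Filter.Tendsto (fun x : ℝ => C * Real.exp (2 * x)) Filter.atBot (nhds (C * 0)) :=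
      (Real.tendsto_exp_atBot.comp (Filter.tendsto_id.const_mul_atBot two_pos)).const_mul C
    rw [mul_zero] at hlim
    obtain ⟨x₀, hx₀⟩ := Filter.eventually_atBot.1 (hlim.eventually (gt_mem_nhds hε))
    refine ⟨x₀, fun x hx => lt_of_le_of_lt ?_ (hx₀ x hx)⟩
    have hmem : (x : ℂ) ∈ logStrip := ⟨by simp, by simp; positivity⟩
    have h1 := logProd_im_le ha hsa (x : ℂ)
    have h2 := logProd_im_le hb hsb (stripReflect x)
    have h3 := logProd_im_nonneg ha hsa hmem
    have h4 := logProd_im_nonneg hb hsb (stripReflect_mem hmem)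
    rw [stripReflect_re] at h2
    rw [Complex.ofReal_re] at h1 h2
    have h5 : (pfLog p A a b x).im = (logProd a x).im + (logProd b (stripReflect x)).im := by
      have h6 : (Complex.exp (2 * (x : ℂ))).im = 0 := by
        rw [exp_two_mul_of_im_eq_zero (Complex.ofReal_im x), Complex.ofReal_im]
      rw [pfLog_im, h6]
      simp
    rw [h5, abs_of_nonneg (add_nonneg h3 h4), hC]
    linarith
  large := pfLog_phase_large (by omega) hA ha hsa hb hsb hne

end Model
end

/-! ### The level curve and the phase along it -/

noncomputable section

/-- The point `x + i y`. -/
def planePt (x y : ℝ) : ℂ := x + y * Complex.I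

@[simp] theorem planePt_re (x y : ℝ) : (planePt x y).re = x := by simp [planePt]

@[simp] theorem planePt_im (x y : ℝ) : (planePt x y).im = y := by simp [planePt]

theorem planePt_zero (x : ℝ) : planePt x 0 = x := by simp [planePt]

theorem continuous_planePt : Continuous fun q : ℝ × ℝ => planePt q.1 q.2 := by
  unfold planePt; fun_prop

/-- Positive, zero or negative according to whether `|num / den|` exceeds, equals or is less
than `c` at the point `exp (x + i y)`. -/
def levelGap (num den : ℂ → ℂ) (c x y : ℝ) : ℝ :=
  ‖num (Complex.exp (planePt x y))‖ - c * ‖den (Complex.exp (planePt x y))‖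

/-- The curve `y = Y x` which follows the level line `|num / den| = c` inside the strip and the
boundary of the strip elsewhere. -/
structure IsLevelPath (num den : ℂ → ℂ) (c : ℝ) (Y : ℝ → ℝ) : Prop where
  cont : Continuous Y
  nonneg : ∀ x, 0 ≤ Y x
  le : ∀ x, Y x ≤ Real.pi / 2
  gap_nonpos : ∀ x, Y x < Real.pi / 2 → levelGap num den c x (Y x) ≤ 0
  gap_nonneg : ∀ x, 0 < Y x → 0 ≤ levelGap num den c x (Y x)

namespace PhaseModel

variable {p : ℕ} {num den f : ℂ → ℂ} (M : PhaseModel p num den f) {c : ℝ}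

include M

theorem continuous_levelGap : Continuous fun q : ℝ × ℝ => levelGap num den c q.1 q.2 := by
  have h1 := M.num_diff.continuous
  have h2 := M.den_diff.continuous
  have h3 := continuous_planePt
  unfold levelGap; fun_prop

theorem continuous_levelGap_left (y : ℝ) : Continuous fun x => levelGap num den c x y :=
  M.continuous_levelGap.comp (by fun_prop : Continuous fun x : ℝ => (x, y))

theorem levelGap_eq {x y : ℝ} (h : planePt x y ∈ regStrip num den) :
    levelGap num den c x y =
      ‖den (Complex.exp (planePt x y))‖ * (Real.exp (f (planePt x y)).re - c) := by
  have h1 := congrArg norm (M.exp_eq _ h)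
  have h2 : ‖den (Complex.exp (planePt x y))‖ ≠ 0 := norm_ne_zero_iff.2 h.2.2
  rw [Complex.norm_exp, norm_div] at h1
  rw [h1, levelGap]; field_simp

theorem levelGap_nonpos_iff (hc : 0 < c) {x y : ℝ} (h : planePt x y ∈ regStrip num den) :
    levelGap num den c x y ≤ 0 ↔ (f (planePt x y)).re ≤ Real.log c := by
  have h2 : 0 < ‖den (Complex.exp (planePt x y))‖ := norm_pos_iff.2 h.2.2
  rw [M.levelGap_eq h, Real.le_log_iff_exp_le hc, mul_nonpos_iff_pos_imp_nonpos]
  constructor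
  · intro h'; linarith [h'.1 h2]
  · intro h'; exact ⟨fun _ => by linarith, fun h3 => by linarith⟩

theorem levelGap_nonneg_iff (hc : 0 < c) {x y : ℝ} (h : planePt x y ∈ regStrip num den) :
    0 ≤ levelGap num den c x y ↔ Real.log c ≤ (f (planePt x y)).re := by
  have h2 : 0 < ‖den (Complex.exp (planePt x y))‖ := norm_pos_iff.2 h.2.2
  rw [M.levelGap_eq h, Real.log_le_iff_le_exp hc, mul_nonneg_iff_of_pos_left h2, sub_nonneg]

/-- On a vertical segment the cross term is `-Δu Δy`, so the modulus strictly decreases. Poles can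
only be at the bottom, where the gap would be positive, and zeros only at the top, where it is
negative. -/
theorem levelGap_neg_of_nonpos (hc : 0 < c) {x y₁ y₂ : ℝ} (h0 : 0 ≤ y₁) (h12 : y₁ < y₂)
    (h2 : y₂ ≤ Real.pi / 2) (h : levelGap num den c x y₁ ≤ 0) : levelGap num den c x y₂ < 0 := by
  have m₁ : planePt x y₁ ∈ logStrip := ⟨by simpa, by simp; linarith⟩
  have m₂ : planePt x y₂ ∈ logStrip := ⟨by simp; linarith, by simpa⟩
  have hn₁ := M.num_ne _ m₁ (by simp; linarith)
  have hd₁ : den (Complex.exp (planePt x y₁)) ≠ 0 := by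
    intro h0
    rw [levelGap, h0, norm_zero, mul_zero, sub_zero] at h
    exact hn₁ (norm_le_zero_iff.1 h)
  have hd₂ := M.den_ne _ m₂ (by simp; linarith)
  by_cases hn₂ : num (Complex.exp (planePt x y₂)) = 0
  · rw [levelGap, hn₂, norm_zero, zero_sub, neg_lt_zero]
    exact mul_pos hc (norm_pos_iff.2 hd₂)
  have r₁ : planePt x y₁ ∈ regStrip num den := ⟨m₁, hn₁, hd₁⟩
  have r₂ : planePt x y₂ ∈ regStrip num den := ⟨m₂, hn₂, hd₂⟩
  have hcr := M.cross_pos _ r₁ _ r₂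
    (fun h => h12.ne (by simpa using congrArg Complex.im h))
    ⟨fun h => by simp at h; linarith [h.1, h.2], fun h => by simp at h; linarith [h.1, h.2]⟩
  rw [crossIm_eq] at hcr
  simp only [planePt_re, sub_self, mul_zero, zero_sub, planePt_im] at hcr
  have h3 := (M.levelGap_nonpos_iff hc r₁).1 h
  rw [← not_le, M.levelGap_nonneg_iff hc r₂, not_le]
  nlinarith

/-- The ordinate comes from the intermediate value theorem, or from an edge when the level is not
crossed. Continuity holds because a strict sign of the gap at a fixed height persists for nearby
abscissas, while monotonicity in the height turns that sign into a bound on `Y`. -/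
theorem exists_levelPath (hc : 0 < c) : ∃ Y, IsLevelPath num den c Y := by
  have hpi := Real.pi_pos
  have hpt : ∀ x, ∃ y, 0 ≤ y ∧ y ≤ Real.pi / 2 ∧
      (y < Real.pi / 2 → levelGap num den c x y ≤ 0) ∧
      (0 < y → 0 ≤ levelGap num den c x y) := by
    intro x
    rcases le_total (levelGap num den c x 0) 0 with h | h
    · exact ⟨0, le_rfl, by positivity, fun _ => h, fun h => absurd h (lt_irrefl _)⟩
    rcases le_total 0 (levelGap num den c x (Real.pi / 2)) with h' | h'
    · exact ⟨Real.pi / 2, by positivity, le_rfl, fun h => absurd h (lt_irrefl _), fun _ => h'⟩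
    have hcont : Continuous fun y => levelGap num den c x y :=
      M.continuous_levelGap.comp (by fun_prop : Continuous fun y : ℝ => (x, y))
    obtain ⟨y, hy, hy0⟩ := intermediate_value_Icc' (by positivity : 0 ≤ Real.pi / 2)
      hcont.continuousOn ⟨h', h⟩
    exact ⟨y, hy.1, hy.2, fun _ => le_of_eq hy0, fun _ => le_of_eq hy0.symm⟩
  choose Y h0 h1 hle hge using hpt
  refine ⟨Y, ?_, h0, h1, hle, hge⟩
  rw [continuous_iff_continuousAt]
  intro x₀
  refine tendsto_order.2 ⟨fun y hy => ?_, fun y hy => ?_⟩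
  · rcases lt_or_ge y 0 with hy0 | hy0
    · exact Filter.Eventually.of_forall fun x => hy0.trans_le (h0 x)
    have hpos : 0 < levelGap num den c x₀ y := by
      by_contra! h
      have h2 := M.levelGap_neg_of_nonpos hc hy0 hy (h1 x₀) h
      linarith [hge x₀ (hy0.trans_lt hy)]
    filter_upwards [(M.continuous_levelGap_left y).continuousAt.eventually (lt_mem_nhds hpos)]
      with x hx
    by_contra! h
    have h3 := hle x (by linarith [h1 x₀])
    rcases h.eq_or_lt with he | hlt
    · rw [he] at h3; linarith
    · linarith [M.levelGap_neg_of_nonpos hc (h0 x) hlt (by linarith [h1 x₀]) h3]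
  · rcases lt_or_ge (Real.pi / 2) y with hy0 | hy0
    · exact Filter.Eventually.of_forall fun x => (h1 x).trans_lt hy0
    have hneg : levelGap num den c x₀ y < 0 :=
      M.levelGap_neg_of_nonpos hc (h0 x₀) hy hy0 (hle x₀ (by linarith))
    filter_upwards [(M.continuous_levelGap_left y).continuousAt.eventually (gt_mem_nhds hneg)]
      with x hx
    by_contra! h
    have hy1 : 0 < y := (h0 x₀).trans_lt hy
    have h3 := hge x (hy1.trans_le h)
    rcases h.eq_or_lt with he | hlt
    · rw [← he] at h3; linarith
    · linarith [M.levelGap_neg_of_nonpos hc hy1.le hlt (h1 x) hx.le]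

end PhaseModel

/-- The phase of `num / den` along the curve `y = Y x`. -/
def pathPhase (f : ℂ → ℂ) (Y : ℝ → ℝ) (x : ℝ) : ℝ := (f (planePt x (Y x))).im

namespace IsLevelPath

variable {p : ℕ} {num den f : ℂ → ℂ} {c : ℝ} {Y : ℝ → ℝ}
  (P : IsLevelPath num den c Y) (M : PhaseModel p num den f) (hc : 0 < c)

include P

theorem mem_logStrip (x : ℝ) : planePt x (Y x) ∈ logStrip :=
  ⟨by simpa using P.nonneg x, by simpa using P.le x⟩

include M hc

/-- The curve is on the real edge only where the modulus is at most `c`, which excludes poles, and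
on the imaginary edge only where it is at least `c`, which excludes zeros. -/
theorem mem_regStrip (x : ℝ) : planePt x (Y x) ∈ regStrip num den := by
  have m := P.mem_logStrip x
  have hd : den (Complex.exp (planePt x (Y x))) ≠ 0 := by
    rcases (P.nonneg x).eq_or_lt with h | h
    · intro h0
      have hlt : Y x < Real.pi / 2 := by rw [← h]; exact Real.pi_div_two_pos
      have h1 := P.gap_nonpos x hlt
      rw [levelGap, h0, norm_zero, mul_zero, sub_zero] at h1
      exact M.num_ne _ m (by simpa using hlt) (norm_le_zero_iff.1 h1)
    · exact M.den_ne _ m (by simpa using h)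
  refine ⟨m, ?_, hd⟩
  rcases (P.le x).eq_or_lt with h | h
  · intro h0
    have h1 := P.gap_nonneg x (by rw [h]; exact Real.pi_div_two_pos)
    rw [levelGap, h0, norm_zero, zero_sub] at h1
    linarith [mul_pos hc (norm_pos_iff.2 hd)]
  · exact M.num_ne _ m (by simpa using h)

theorem eq_zero_of_gap {x : ℝ} (h : levelGap num den c x 0 ≤ 0) : Y x = 0 := by
  by_contra hne
  have hpos := lt_of_le_of_ne (P.nonneg x) (Ne.symm hne)
  linarith [M.levelGap_neg_of_nonpos hc le_rfl hpos (P.le x) h, P.gap_nonneg x hpos]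

theorem eq_pi_div_two_of_gap {x : ℝ} (h : 0 ≤ levelGap num den c x (Real.pi / 2)) :
    Y x = Real.pi / 2 := by
  by_contra hne
  have hlt := lt_of_le_of_ne (P.le x) hne
  linarith [M.levelGap_neg_of_nonpos hc (P.nonneg x) hlt le_rfl (P.gap_nonpos x hlt)]

theorem eq_of_gap_eq_zero {x y : ℝ} (h0 : 0 ≤ y) (h1 : y ≤ Real.pi / 2)
    (h : levelGap num den c x y = 0) : y = Y x := by
  rcases lt_trichotomy y (Y x) with hlt | he | hgt
  · linarith [M.levelGap_neg_of_nonpos hc h0 hlt (P.le x) h.le, P.gap_nonneg x (h0.trans_lt hlt)]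
  · exact he
  · linarith [M.levelGap_neg_of_nonpos hc (P.nonneg x) hgt h1
      (P.gap_nonpos x (hgt.trans_le h1))]

theorem continuous_pathPhase : Continuous (pathPhase f Y) := by
  rw [← continuousOn_univ]
  have h : Continuous fun x => planePt x (Y x) :=
    continuous_planePt.comp (continuous_id.prodMk P.cont)
  exact M.cont.comp h.continuousOn fun x _ => P.mem_regStrip M hc x

/-- If the curve rises, its first point is not on the upper edge, so `u ≤ log c` there, and its last
point is not on the lower edge, so `u ≥ log c` there. A falling curve is symmetric. -/
theorem cross_le {x₁ x₂ : ℝ} : 0 ≤ ((f (planePt x₂ (Y x₂))).re - (f (planePt x₁ (Y x₁))).re) *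
    (Y x₂ - Y x₁) := by
  have r₁ := P.mem_regStrip M hc x₁
  have r₂ := P.mem_regStrip M hc x₂
  rcases lt_trichotomy (Y x₁) (Y x₂) with h | h | h
  · have h1 := (M.levelGap_nonpos_iff hc r₁).1 (P.gap_nonpos x₁ (h.trans_le (P.le _)))
    have h2 := (M.levelGap_nonneg_iff hc r₂).1 (P.gap_nonneg x₂ ((P.nonneg _).trans_lt h))
    exact mul_nonneg (by linarith) (by linarith)
  · simp [h]
  · have h1 := (M.levelGap_nonpos_iff hc r₂).1 (P.gap_nonpos x₂ (h.trans_le (P.le _)))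
    have h2 := (M.levelGap_nonneg_iff hc r₁).1 (P.gap_nonneg x₁ ((P.nonneg _).trans_lt h))
    exact mul_nonneg_of_nonpos_of_nonpos (by linarith) (by linarith)

theorem monotone_pathPhase : Monotone (pathPhase f Y) := by
  intro x₁ x₂ h
  rcases h.eq_or_lt with rfl | h
  · rfl
  have h1 := M.cross_nonneg _ (P.mem_regStrip M hc x₁) _ (P.mem_regStrip M hc x₂)
  have h2 := P.cross_le M hc (x₁ := x₁) (x₂ := x₂)
  rw [crossIm_eq] at h1
  simp only [planePt_re, planePt_im] at h1
  have h3 : 0 ≤ (pathPhase f Y x₂ - pathPhase f Y x₁) * (x₂ - x₁) := by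
    unfold pathPhase; linarith
  linarith [nonneg_of_mul_nonneg_left h3 (sub_pos.2 h)]

theorem same_edge_of_pathPhase_eq {x₁ x₂ : ℝ} (h : x₁ < x₂)
    (he : pathPhase f Y x₁ = pathPhase f Y x₂) :
    (Y x₁ = 0 ∧ Y x₂ = 0) ∨ (Y x₁ = Real.pi / 2 ∧ Y x₂ = Real.pi / 2) := by
  by_contra hedge
  rw [not_or] at hedge
  have h1 := M.cross_pos _ (P.mem_regStrip M hc x₁) _ (P.mem_regStrip M hc x₂)
    (fun h' => h.ne (by simpa using congrArg Complex.re h')) (by simpa [NotSameEdge] using hedge)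
  have h2 := P.cross_le M hc (x₁ := x₁) (x₂ := x₂)
  rw [crossIm_eq] at h1
  simp only [planePt_re, planePt_im] at h1
  unfold pathPhase at he
  rw [he, sub_self, zero_mul] at h1
  linarith

end IsLevelPath

/-! ### Phases on the edges and plateaus -/

namespace PhaseModel

variable {p : ℕ} {num den f : ℂ → ℂ} (M : PhaseModel p num den f)

include M

/-- The quotient is real on the real axis. -/
theorem sin_im_eq_zero {ζ : ℂ} (h : ζ ∈ regStrip num den) (h0 : ζ.im = 0) :
    Real.sin (f ζ).im = 0 := by
  have hz : conj (Complex.exp ζ) = Complex.exp ζ := by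
    rw [← Complex.exp_conj, Complex.conj_eq_iff_im.2 h0]
  have h1 : conj (Complex.exp (f ζ)) = Complex.exp (f ζ) := by
    rw [M.exp_eq ζ h, map_div₀, ← M.num_conj, ← M.den_conj, hz]
  have h2 := Complex.conj_eq_iff_im.1 h1
  rw [Complex.exp_im] at h2
  exact (mul_eq_zero.1 h2).resolve_left (Real.exp_ne_zero _)

/-- On the imaginary axis `conj z = -z`, so the quotient is purely imaginary. -/
theorem cos_im_eq_zero {ζ : ℂ} (h : ζ ∈ regStrip num den) (h0 : ζ.im = Real.pi / 2) :
    Real.cos (f ζ).im = 0 := by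
  have hz : conj (Complex.exp ζ) = -Complex.exp ζ := by
    apply Complex.ext
    · simp [Complex.exp_re, h0]
    · simp
  have h1 : conj (Complex.exp (f ζ)) = -Complex.exp (f ζ) := by
    rw [M.exp_eq ζ h, map_div₀, ← M.num_conj, ← M.den_conj, hz, M.num_neg, M.den_neg, neg_div]
  have h2 := congrArg Complex.re h1
  rw [Complex.conj_re, Complex.neg_re, Complex.exp_re] at h2
  have h3 : Real.exp (f ζ).re * Real.cos (f ζ).im = 0 := by linarith
  exact (mul_eq_zero.1 h3).resolve_left (Real.exp_ne_zero _)

end PhaseModel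

namespace IsLevelPath

variable {p : ℕ} {num den f : ℂ → ℂ} {c : ℝ} {Y : ℝ → ℝ}
  (P : IsLevelPath num den c Y) (M : PhaseModel p num den f) (hc : 0 < c)

include P M hc

theorem sin_pathPhase {x : ℝ} (h : Y x = 0) : Real.sin (pathPhase f Y x) = 0 :=
  M.sin_im_eq_zero (P.mem_regStrip M hc x) (by simpa using h)

theorem cos_pathPhase {x : ℝ} (h : Y x = Real.pi / 2) : Real.cos (pathPhase f Y x) = 0 :=
  M.cos_im_eq_zero (P.mem_regStrip M hc x) (by simpa using h)

/-- Near `z = 0` the modulus is below `c`, so the curve runs on the real edge, where the phase is a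
multiple of `π`; being small there, it vanishes. -/
theorem exists_phase_eq_zero : ∃ x₀, ∀ x ≤ x₀, Y x = 0 ∧ pathPhase f Y x = 0 := by
  obtain ⟨x₁, hx₁⟩ := M.im_lim Real.pi Real.pi_pos
  have hg : Continuous fun z => ‖num z‖ - c * ‖den z‖ := by
    have h1 := M.num_diff.continuous
    have h2 := M.den_diff.continuous
    fun_prop
  have h0 : ‖num 0‖ - c * ‖den 0‖ < 0 := by
    rw [M.num_zero, norm_zero, zero_sub, neg_lt_zero]
    exact mul_pos hc (norm_pos_iff.2 M.den_zero)
  have hlim : Filter.Tendsto (fun x : ℝ => Complex.exp (planePt x 0)) Filter.atBot (nhds 0) := by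
    have h2 := (Complex.continuous_ofReal.tendsto 0).comp Real.tendsto_exp_atBot
    simpa [planePt, Function.comp_def] using h2
  obtain ⟨x₂, hx₂⟩ := Filter.eventually_atBot.1
    ((hg.continuousAt.tendsto.comp hlim).eventually (gt_mem_nhds h0))
  refine ⟨min x₁ x₂, fun x hx => ?_⟩
  have hY : Y x = 0 := P.eq_zero_of_gap M hc (hx₂ x (hx.trans (min_le_right _ _))).le
  refine ⟨hY, ?_⟩
  have h1 := hx₁ x (hx.trans (min_le_left _ _))
  rw [← planePt_zero, ← hY] at h1
  have h2 := P.sin_pathPhase M hc hY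
  exact (Real.sin_eq_zero_iff_of_lt_of_lt (abs_lt.1 h1).1 (abs_lt.1 h1).2).1 h2

theorem exists_pi_div_two_le : ∃ x, Real.pi / 2 ≤ pathPhase f Y x := by
  obtain ⟨x, hx⟩ := M.large c
  refine ⟨x, hx _ (P.mem_regStrip M hc x) (by simp) fun h => ?_⟩
  have := P.gap_nonpos x (by simpa using h)
  rw [levelGap] at this; linarith

/-- Off the level the curve stays on one edge nearby. There the phase ranges over a discrete set,
and it is continuous. -/
theorem phase_locally_const {x : ℝ} (h : levelGap num den c x (Y x) ≠ 0) :
    ∀ᶠ x' in nhds x, pathPhase f Y x' = pathPhase f Y x := by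
  have hsin : ∀ g : ℝ → ℝ, ∀ x, ContinuousAt g x → (∀ᶠ x' in nhds x, Real.sin (g x') = 0) →
      ∀ᶠ x' in nhds x, g x' = g x := by
    intro g x hg hs
    have h1 : ∀ᶠ x' in nhds x, |g x' - g x| < Real.pi := by
      have := hg.eventually (Metric.ball_mem_nhds (g x) Real.pi_pos)
      filter_upwards [this] with x' hx'
      simpa [Real.dist_eq] using hx'
    filter_upwards [h1, hs] with x' hx' hs'
    have h2 : Real.sin (g x' - g x) = 0 := by
      rw [Real.sin_sub, hs', hs.self_of_nhds]; ring
    have := (Real.sin_eq_zero_iff_of_lt_of_lt (abs_lt.1 hx').1 (abs_lt.1 hx').2).1 h2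
    linarith
  have hcont := P.continuous_pathPhase M hc
  rcases (P.nonneg x).eq_or_lt with h0 | h0
  · have hlt : levelGap num den c x 0 < 0 := by
      have := P.gap_nonpos x (by rw [← h0]; exact Real.pi_div_two_pos)
      rw [← h0] at this h
      exact lt_of_le_of_ne this h
    refine hsin _ x hcont.continuousAt ?_
    filter_upwards [(M.continuous_levelGap_left 0).continuousAt.eventually (gt_mem_nhds hlt)]
      with x' hx' using P.sin_pathPhase M hc (P.eq_zero_of_gap M hc hx'.le)
  rcases (P.le x).eq_or_lt with h1 | h1
  · have hlt : 0 < levelGap num den c x (Real.pi / 2) := by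
      have := P.gap_nonneg x h0
      rw [h1] at this h
      exact lt_of_le_of_ne this h.symm
    have h2 := hsin (fun x => pathPhase f Y x + Real.pi / 2) x (by fun_prop) (by
      filter_upwards [(M.continuous_levelGap_left (Real.pi / 2)).continuousAt.eventually
        (lt_mem_nhds hlt)] with x' hx'
      rw [Real.sin_add_pi_div_two]
      exact P.cos_pathPhase M hc (P.eq_pi_div_two_of_gap M hc hx'.le))
    filter_upwards [h2] with x' hx' using by simpa using hx'
  · exact absurd (le_antisymm (P.gap_nonpos x h1) (P.gap_nonneg x h0)) h

theorem exists_first {v : ℝ} (hv : 0 < v) (hx : ∃ x, v ≤ pathPhase f Y x) :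
    ∃ x, pathPhase f Y x = v ∧ levelGap num den c x (Y x) = 0 ∧
      ∀ x' < x, pathPhase f Y x' < v := by
  obtain ⟨x₁, hx₁⟩ := hx
  obtain ⟨x₀, hx₀⟩ := P.exists_phase_eq_zero M hc
  have hcont := P.continuous_pathPhase M hc
  have hmono := P.monotone_pathPhase M hc
  have hclosed : IsClosed {x | v ≤ pathPhase f Y x} := isClosed_le continuous_const hcont
  have hbdd : BddBelow {x | v ≤ pathPhase f Y x} := by
    refine ⟨x₀, fun x hx => ?_⟩
    by_contra! h
    have h1 := (hx₀ x h.le).2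
    have h2 : v ≤ pathPhase f Y x := hx
    linarith
  set s := sInf {x | v ≤ pathPhase f Y x} with hs
  have hmem : v ≤ pathPhase f Y s := hclosed.csInf_mem ⟨x₁, hx₁⟩ hbdd
  have hlt : ∀ x' < s, pathPhase f Y x' < v := by
    intro x' hx'
    by_contra! h
    exact absurd (csInf_le hbdd h) (not_le.2 hx')
  have hle : pathPhase f Y s ≤ v := by
    refine le_of_tendsto (hcont.continuousWithinAt (s := Set.Iio s) (x := s)) ?_
    filter_upwards [self_mem_nhdsWithin] with x' hx' using (hlt x' hx').le
  refine ⟨s, le_antisymm hle hmem, ?_, hlt⟩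
  -- Off the level the phase would already equal `v` slightly to the left of `s`.
  by_contra hgap
  have h1 := (P.phase_locally_const M hc hgap).filter_mono (nhdsWithin_le_nhds (s := Set.Iio s))
  obtain ⟨x', h2, h3⟩ := (h1.and self_mem_nhdsWithin).exists
  linarith [hlt x' h3]

theorem exists_last {v : ℝ} (hv : 0 ≤ v) (hx : ∃ x, v < pathPhase f Y x) :
    ∃ x, pathPhase f Y x = v ∧ levelGap num den c x (Y x) = 0 ∧
      ∀ x' > x, v < pathPhase f Y x' := by
  obtain ⟨x₁, hx₁⟩ := hx
  obtain ⟨x₀, hx₀⟩ := P.exists_phase_eq_zero M hc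
  have hcont := P.continuous_pathPhase M hc
  have hmono := P.monotone_pathPhase M hc
  have hclosed : IsClosed {x | pathPhase f Y x ≤ v} := isClosed_le hcont continuous_const
  have hbdd : BddAbove {x | pathPhase f Y x ≤ v} := by
    refine ⟨x₁, fun x hx => ?_⟩
    by_contra! h
    have h2 : pathPhase f Y x ≤ v := hx
    linarith [hmono h.le]
  set s := sSup {x | pathPhase f Y x ≤ v} with hs
  have hmem : pathPhase f Y s ≤ v :=
    hclosed.csSup_mem ⟨x₀, by simpa [(hx₀ x₀ le_rfl).2] using hv⟩ hbdd
  have hlt : ∀ x' > s, v < pathPhase f Y x' := by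
    intro x' hx'
    by_contra! h
    exact absurd (le_csSup hbdd h) (not_le.2 hx')
  have hle : v ≤ pathPhase f Y s := by
    refine ge_of_tendsto (hcont.continuousWithinAt (s := Set.Ioi s) (x := s)) ?_
    filter_upwards [self_mem_nhdsWithin] with x' hx' using (hlt x' hx').le
  refine ⟨s, le_antisymm hmem hle, ?_, hlt⟩
  by_contra hgap
  have h1 := (P.phase_locally_const M hc hgap).filter_mono (nhdsWithin_le_nhds (s := Set.Ioi s))
  obtain ⟨x', h2, h3⟩ := (h1.and self_mem_nhdsWithin).exists
  linarith [hlt x' h3]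

end IsLevelPath
end

/-! ### Local order of an `α`-point -/

noncomputable section

open Filter Topology

/-- Some direction turns `c u^k` into `-i |c|`. The bound `k φ ≤ 2π` keeps that direction in the
closed upper half plane as soon as `k ≥ 2`. -/
theorem exists_im_mul_exp_neg {c : ℂ} (hc : c ≠ 0) {k : ℕ} (hk : 1 ≤ k) :
    ∃ φ : ℝ, 0 ≤ φ ∧ k * φ ≤ 2 * Real.pi ∧
      (c * Complex.exp (φ * Complex.I) ^ k).im < 0 := by
  have hpi := Real.pi_pos
  have hk' : (0 : ℝ) < k := by exact_mod_cast hk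
  have key : ∀ τ : ℝ, (∃ m : ℤ, τ = -(Real.pi / 2) - c.arg + m * (2 * Real.pi)) →
      (c * Complex.exp ((τ / k : ℝ) * Complex.I) ^ k).im < 0 := by
    rintro τ ⟨m, hm⟩
    have h1 : Complex.exp ((τ / k : ℝ) * Complex.I) ^ k = Complex.exp (τ * Complex.I) := by
      rw [← Complex.exp_nat_mul, ← mul_assoc]
      congr 2
      push_cast
      rw [mul_div_cancel₀]
      exact_mod_cast hk'.ne'
    have h2 : c * Complex.exp (τ * Complex.I) = ‖c‖ * (-Complex.I) := by
      nth_rewrite 1 [← Complex.norm_mul_exp_arg_mul_I c]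
      rw [mul_assoc, ← Complex.exp_add]
      congr 1
      have : (c.arg : ℂ) * Complex.I + τ * Complex.I
          = -(Real.pi / 2) * Complex.I + m * (2 * Real.pi * Complex.I) := by
        rw [hm]; push_cast; ring
      rw [this, Complex.exp_add, Complex.exp_int_mul_two_pi_mul_I, mul_one, neg_mul,
        Complex.exp_neg, Complex.exp_pi_div_two_mul_I, Complex.inv_I]
    rw [h1, h2]
    simpa using hc
  have hb := c.arg_le_pi
  have ha := c.neg_pi_lt_arg
  rcases le_or_gt 0 (-(Real.pi / 2) - c.arg) with h | h
  · refine ⟨(-(Real.pi / 2) - c.arg) / k, by positivity, ?_, key _ ⟨0, by simp⟩⟩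
    rw [mul_div_cancel₀ _ hk'.ne']; linarith
  · refine ⟨(-(Real.pi / 2) - c.arg + 2 * Real.pi) / k, ?_, ?_, key _ ⟨1, by simp⟩⟩
    · apply div_nonneg _ hk'.le; linarith
    · rw [mul_div_cancel₀ _ hk'.ne']; linarith

/-- `s = 1` on the real edge and `s = -1` on the imaginary edge of the strip. -/
def IsEdge (y s : ℝ) : Prop := (y = 0 ∧ s = 1) ∨ (y = Real.pi / 2 ∧ s = -1)

namespace PhaseModel

variable {p : ℕ} {num den f : ℂ → ℂ} (M : PhaseModel p num den f)

include M

theorem continuousWithinAt_log_quot {ζ₀ : ℂ} (h₀ : ζ₀ ∈ regStrip num den) :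
    ContinuousWithinAt f (regStrip num den) ζ₀ := by
  have hn := M.num_diff.continuous
  have hd := M.den_diff.continuous
  have hre : ContinuousWithinAt (fun ζ => (f ζ).re) (regStrip num den) ζ₀ := by
    have hq : ∀ ζ ∈ regStrip num den,
        (f ζ).re = Real.log (‖num (Complex.exp ζ)‖ / ‖den (Complex.exp ζ)‖) := by
      intro ζ hζ
      rw [← norm_div, ← M.exp_eq ζ hζ, Complex.norm_exp, Real.log_exp]
    refine ContinuousWithinAt.congr ?_ hq (hq ζ₀ h₀)
    refine ContinuousWithinAt.log ?_ (div_ne_zero (norm_ne_zero_iff.2 h₀.2.1)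
      (norm_ne_zero_iff.2 h₀.2.2))
    exact ContinuousWithinAt.div (Continuous.continuousWithinAt (by fun_prop))
      (Continuous.continuousWithinAt (by fun_prop)) (norm_ne_zero_iff.2 h₀.2.2)
  have h := (Complex.continuous_ofReal.continuousAt.comp_continuousWithinAt hre).add
    ((Complex.continuous_ofReal.continuousAt.comp_continuousWithinAt
      (M.cont ζ₀ h₀)).mul_const Complex.I)
  refine h.congr (fun ζ _ => ?_) ?_ <;> simp [Function.comp_def]

/-- Near `ζ₀` continuity identifies `f - f ζ₀` with the principal logarithm of `1 + (ζ - ζ₀) ^ n h`.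
This gives the leading term of `f` from inside the strip even at edge points, where `f` is not known
to be holomorphic. -/
theorem tendsto_log_quot {ζ₀ : ℂ} (h₀ : ζ₀ ∈ regStrip num den) {n : ℕ} (hn : 1 ≤ n) {h : ℂ → ℂ}
    (hh : ContinuousAt h ζ₀) (hh0 : h ζ₀ ≠ 0)
    (heq : ∀ᶠ ζ in 𝓝 ζ₀, num (Complex.exp ζ) / den (Complex.exp ζ)
      = Complex.exp (f ζ₀) * (1 + (ζ - ζ₀) ^ n * h ζ)) :
    Tendsto (fun ζ => (f ζ - f ζ₀) / (ζ - ζ₀) ^ n) (𝓝[regStrip num den \ {ζ₀}] ζ₀)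
      (𝓝 (h ζ₀)) := by
  have hw : Tendsto (fun ζ => (ζ - ζ₀) ^ n * h ζ) (𝓝[regStrip num den \ {ζ₀}] ζ₀) (𝓝[≠] 0) := by
    refine tendsto_nhdsWithin_iff.2 ⟨?_, ?_⟩
    · have : ContinuousAt (fun ζ => (ζ - ζ₀) ^ n * h ζ) ζ₀ := by fun_prop
      have h1 := this.tendsto
      simp only [sub_self, zero_pow (by omega : n ≠ 0), zero_mul] at h1
      exact h1.mono_left nhdsWithin_le_nhds
    · filter_upwards [self_mem_nhdsWithin, nhdsWithin_le_nhds (hh.eventually_ne hh0)] with ζ h1 h2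
      exact mul_ne_zero (pow_ne_zero _ (sub_ne_zero.2 h1.2)) h2
  have hslope := (Complex.hasDerivAt_log (z := 1) (by simp)).tendsto_slope_zero
  simp only [inv_one, Complex.log_one, sub_zero, smul_eq_mul] at hslope
  have hl := (hslope.comp hw).mul (hh.tendsto.mono_left nhdsWithin_le_nhds)
  rw [one_mul] at hl
  refine hl.congr' ?_
  have hsub : regStrip num den \ {ζ₀} ⊆ regStrip num den := Set.sdiff_subset
  have hf := ((M.continuousWithinAt_log_quot h₀).mono hsub).eventually
    (Metric.ball_mem_nhds (f ζ₀) Real.pi_pos)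
  filter_upwards [self_mem_nhdsWithin, hf, nhdsWithin_le_nhds heq,
    nhdsWithin_le_nhds (hh.eventually_ne hh0)] with ζ h1 h2 h3 h4
  have h5 : ζ - ζ₀ ≠ 0 := sub_ne_zero.2 h1.2
  have h6 : Complex.exp (f ζ - f ζ₀) = 1 + (ζ - ζ₀) ^ n * h ζ := by
    rw [Complex.exp_sub, M.exp_eq ζ h1.1, h3]
    field_simp [Complex.exp_ne_zero]
  have h7 : |(f ζ - f ζ₀).im| < Real.pi :=
    (Complex.abs_im_le_norm _).trans_lt (by simpa [dist_eq_norm] using h2)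
  have h8 : Complex.log (1 + (ζ - ζ₀) ^ n * h ζ) = f ζ - f ζ₀ := by
    rw [← h6, Complex.log_exp (abs_lt.1 h7).1 (abs_lt.1 h7).2.le]
  simp only [Function.comp, h8]
  have h9 : (ζ - ζ₀) ^ n ≠ 0 := pow_ne_zero _ h5
  field_simp

theorem eventually_mem_regStrip {ζ₀ : ℂ} (h₀ : ζ₀ ∈ regStrip num den) :
    ∀ᶠ ζ in 𝓝 ζ₀, ζ ∈ logStrip → ζ ∈ regStrip num den := by
  have hn : Continuous fun ζ => num (Complex.exp ζ) := M.num_diff.continuous.comp Complex.continuous_exp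
  have hd : Continuous fun ζ => den (Complex.exp ζ) := M.den_diff.continuous.comp Complex.continuous_exp
  filter_upwards [hn.continuousAt.eventually_ne h₀.2.1, hd.continuousAt.eventually_ne h₀.2.2]
    with ζ h1 h2 h3 using ⟨h3, h1, h2⟩

theorem tendsto_direction {ζ₀ u : ℂ} (h₀ : ζ₀ ∈ regStrip num den) (hu : u ≠ 0)
    (hadm : ∀ᶠ t : ℝ in 𝓝[>] 0, ζ₀ + t * u ∈ logStrip) :
    Tendsto (fun t : ℝ => ζ₀ + t * u) (𝓝[>] 0) (𝓝[regStrip num den \ {ζ₀}] ζ₀) := by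
  have hlim : Tendsto (fun t : ℝ => ζ₀ + t * u) (𝓝[>] 0) (𝓝 ζ₀) := by
    have : Continuous fun t : ℝ => ζ₀ + t * u := by fun_prop
    have h := this.tendsto 0
    simp only [Complex.ofReal_zero, zero_mul, add_zero] at h
    exact h.mono_left nhdsWithin_le_nhds
  refine tendsto_nhdsWithin_iff.2 ⟨hlim, ?_⟩
  filter_upwards [hadm, hlim.eventually (M.eventually_mem_regStrip h₀), self_mem_nhdsWithin]
    with t h1 h2 h3
  refine ⟨h2 h1, ?_⟩
  have : (t : ℂ) ≠ 0 := Complex.ofReal_ne_zero.2 (ne_of_gt h3)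
  simp [hu, this]

/-- On the ray `ζ₀ + t u` the cross term is asymptotic to `t^(n+2) Im (c u^(n+1) conj u)`, and `u
conj u = 1`. -/
theorem im_direction_nonneg {ζ₀ u c : ℂ} (h₀ : ζ₀ ∈ regStrip num den) (hu : ‖u‖ = 1) {n : ℕ}
    (hlim : Tendsto (fun ζ => (f ζ - f ζ₀) / (ζ - ζ₀) ^ (n + 1))
      (𝓝[regStrip num den \ {ζ₀}] ζ₀) (𝓝 c))
    (hadm : ∀ᶠ t : ℝ in 𝓝[>] 0, ζ₀ + t * u ∈ logStrip) : 0 ≤ (c * u ^ n).im := by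
  have hu0 : u ≠ 0 := fun h => by simp [h] at hu
  have ht := M.tendsto_direction h₀ hu0 hadm
  have h1 := ((hlim.comp ht).mul_const (u ^ n))
  have h2 := (Complex.continuous_im.tendsto _).comp h1
  refine ge_of_tendsto h2 ?_
  filter_upwards [ht.eventually self_mem_nhdsWithin, self_mem_nhdsWithin] with t h3 h4
  have ht0 : 0 < t := h4
  have htc : (t : ℂ) ≠ 0 := Complex.ofReal_ne_zero.2 ht0.ne'
  have h5 := M.cross_nonneg _ h₀ _ h3.1
  rw [crossIm] at h5
  simp only [Function.comp, add_sub_cancel_left, map_mul, Complex.conj_ofReal] at h5 ⊢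
  have huu : u * conj u = 1 := by
    rw [Complex.mul_conj, Complex.normSq_eq_norm_sq, hu]; simp
  have h6 : (f (ζ₀ + t * u) - f ζ₀) / (t * u) ^ (n + 1) * u ^ n
      = (((t ^ (n + 2))⁻¹ : ℝ) : ℂ) * ((f (ζ₀ + t * u) - f ζ₀) * (t * conj u)) := by
    have : conj u = u⁻¹ := eq_inv_of_mul_eq_one_right huu
    rw [this]
    push_cast
    field_simp
    ring
  rw [h6, Complex.im_ofReal_mul]
  exact mul_nonneg (by positivity) h5

omit M in
theorem _root_.alphaMult_eq_of_comp_exp {F : ℂ → ℂ} {ζ₀ α : ℂ} :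
    analyticOrderAt (fun ζ => F (Complex.exp ζ) - α) ζ₀ = alphaMult F α (Complex.exp ζ₀) := by
  have h : analyticOrderAt ((fun z => F z - α) ∘ Complex.exp) ζ₀
      = analyticOrderAt (fun z => F z - α) (Complex.exp ζ₀) :=
    analyticOrderAt_comp_of_deriv_ne_zero (by fun_prop)
      (by rw [Complex.deriv_exp]; exact Complex.exp_ne_zero _)
  exact h

theorem analyticAt_quot {z : ℂ} (h : den z ≠ 0) : AnalyticAt ℂ (fun z => num z / den z) z :=
  (M.num_diff.analyticAt z).div (M.den_diff.analyticAt z) h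

/-- The order of an `α`-point in the closed first quadrant, with the leading coefficient of the
logarithm. -/
theorem exists_order {ζ₀ : ℂ} (h₀ : ζ₀ ∈ regStrip num den) :
    ∃ (n : ℕ) (h : ℂ → ℂ), ContinuousAt h ζ₀ ∧ h ζ₀ ≠ 0 ∧
      alphaMult (fun z => num z / den z) (num (Complex.exp ζ₀) / den (Complex.exp ζ₀))
        (Complex.exp ζ₀) = (n + 1 : ℕ) ∧
      (∀ᶠ ζ in 𝓝 ζ₀, num (Complex.exp ζ) / den (Complex.exp ζ)
        = Complex.exp (f ζ₀) * (1 + (ζ - ζ₀) ^ (n + 1) * h ζ)) ∧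
      Tendsto (fun ζ => (f ζ - f ζ₀) / (ζ - ζ₀) ^ (n + 1)) (𝓝[regStrip num den \ {ζ₀}] ζ₀)
        (𝓝 (h ζ₀)) := by
  have hF := M.analyticAt_quot h₀.2.2
  set α := num (Complex.exp ζ₀) / den (Complex.exp ζ₀) with hα
  have hα' : Complex.exp (f ζ₀) = α := M.exp_eq _ h₀
  have hα0 : α ≠ 0 := by rw [← hα']; exact Complex.exp_ne_zero _
  have hcomp : AnalyticAt ℂ (fun ζ => num (Complex.exp ζ) / den (Complex.exp ζ) - α) ζ₀ :=
    (hF.comp (g := fun z => num z / den z) (by fun_prop)).sub analyticAt_const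
  have hord := alphaMult_eq_of_comp_exp (F := fun z => num z / den z) (ζ₀ := ζ₀) (α := α)
  -- Infinite order would make the quotient locally constant, but its modulus strictly changes on a
  -- vertical segment directed into the strip.
  have hntop : analyticOrderAt (fun ζ => num (Complex.exp ζ) / den (Complex.exp ζ) - α) ζ₀ ≠ ⊤ := by
    intro htop
    rw [analyticOrderAt_eq_top] at htop
    obtain ⟨u, hu0, hu⟩ : ∃ u : ℝ, u ≠ 0 ∧
        ∀ᶠ t : ℝ in 𝓝[>] 0, ζ₀ + t * (u * Complex.I) ∈ logStrip := by
      have hpi := Real.pi_pos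
      have hmem : Set.Ioo 0 (Real.pi / 4) ∈ 𝓝[>] (0 : ℝ) :=
        Ioo_mem_nhdsGT (by positivity)
      rcases le_total ζ₀.im (Real.pi / 4) with h | h
      · refine ⟨1, one_ne_zero, ?_⟩
        filter_upwards [hmem] with t ht
        have := h₀.1.1
        constructor <;> simp <;> linarith [ht.1, ht.2]
      · refine ⟨-1, by norm_num, ?_⟩
        filter_upwards [hmem] with t ht
        have := h₀.1.2
        constructor <;> simp <;> linarith [ht.1, ht.2]
    have ht := M.tendsto_direction h₀ (mul_ne_zero (Complex.ofReal_ne_zero.2 hu0) Complex.I_ne_zero) hu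
    have hev := (ht.eventually self_mem_nhdsWithin).and
      ((ht.eventually (nhdsWithin_le_nhds htop)).and self_mem_nhdsWithin)
    obtain ⟨t, h1, h2, h3⟩ := hev.exists
    have ht0 : 0 < t := h3
    have h4 := congrArg norm (M.exp_eq _ h1.1)
    have h5 := congrArg norm hα'
    rw [sub_eq_zero.1 h2, ← h5, Complex.norm_exp, Complex.norm_exp, Real.exp_eq_exp] at h4
    have h6 := M.cross_pos _ h₀ _ h1.1 (Ne.symm h1.2) (by
      have : t * u ≠ 0 := mul_ne_zero ht0.ne' hu0
      constructor
      · rintro ⟨e1, e2⟩; simp [e1] at e2; exact this (mul_eq_zero.2 e2)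
      · rintro ⟨e1, e2⟩; simp [e1] at e2; exact this (mul_eq_zero.2 e2))
    rw [crossIm_eq, h4] at h6
    simp at h6
  have hne0 : analyticOrderAt (fun ζ => num (Complex.exp ζ) / den (Complex.exp ζ) - α) ζ₀ ≠ 0 :=
    analyticOrderAt_ne_zero.2 ⟨hcomp, by simp [hα]⟩
  obtain ⟨m, hm⟩ := ENat.ne_top_iff_exists.1 hntop
  obtain ⟨n, rfl⟩ : ∃ n, m = n + 1 := Nat.exists_eq_succ_of_ne_zero (by
    rintro rfl; exact hne0 (by rw [← hm]; rfl))
  obtain ⟨g, hg, hg0, hgeq⟩ := (hcomp.analyticOrderAt_eq_natCast).1 hm.symm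
  have hcont : ContinuousAt (fun ζ => g ζ / α) ζ₀ := hg.continuousAt.div_const α
  have heq : ∀ᶠ ζ in 𝓝 ζ₀, num (Complex.exp ζ) / den (Complex.exp ζ)
        = Complex.exp (f ζ₀) * (1 + (ζ - ζ₀) ^ (n + 1) * (g ζ / α)) := by
    filter_upwards [hgeq] with ζ hζ
    rw [hα', ← sub_add_cancel (num (Complex.exp ζ) / den (Complex.exp ζ)) α, hζ, smul_eq_mul]
    field_simp
    ring
  exact ⟨n, fun ζ => g ζ / α, hcont, div_ne_zero hg0 hα0, by rw [← hord, ← hm], heq,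
    M.tendsto_log_quot h₀ (by omega) hcont (div_ne_zero hg0 hα0) heq⟩

/-- At an interior point all directions are admissible, and for `n ≥ 1` some direction makes `Im (c
u^n)` negative. -/
theorem alphaMult_interior {ζ₀ : ℂ} (h₀ : ζ₀ ∈ regStrip num den) (h1 : 0 < ζ₀.im)
    (h2 : ζ₀.im < Real.pi / 2) :
    alphaMult (fun z => num z / den z) (num (Complex.exp ζ₀) / den (Complex.exp ζ₀))
        (Complex.exp ζ₀) = 1 := by
  obtain ⟨n, h, hc, hne, hord, -, hlim⟩ := M.exists_order h₀
  rcases Nat.eq_zero_or_pos n with rfl | hn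
  · simpa using hord
  obtain ⟨φ, -, -, hφ⟩ := exists_im_mul_exp_neg hne hn
  have hu : ‖Complex.exp (φ * Complex.I)‖ = 1 := Complex.norm_exp_ofReal_mul_I φ
  refine absurd (M.im_direction_nonneg h₀ hu hlim ?_) (not_le.2 hφ)
  have hcont : Continuous fun t : ℝ => (ζ₀ + t * Complex.exp (φ * Complex.I)).im := by
    have := Complex.continuous_im; fun_prop
  have hmem : ∀ᶠ t : ℝ in 𝓝 0, (ζ₀ + t * Complex.exp (φ * Complex.I)).im ∈ Set.Ioo 0 (Real.pi / 2) :=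
    hcont.continuousAt.eventually (Ioo_mem_nhds (by simpa) (by simpa))
  filter_upwards [nhdsWithin_le_nhds hmem] with t ht using ⟨ht.1.le, ht.2.le⟩

theorem im_edge_direction_nonneg {ζ₀ u c : ℂ} {s : ℝ} (hs : IsEdge ζ₀.im s)
    (h₀ : ζ₀ ∈ regStrip num den) (hu : ‖u‖ = 1) (hus : 0 ≤ s * u.im) {n : ℕ}
    (hlim : Tendsto (fun ζ => (f ζ - f ζ₀) / (ζ - ζ₀) ^ (n + 1))
      (𝓝[regStrip num den \ {ζ₀}] ζ₀) (𝓝 c)) : 0 ≤ (c * u ^ n).im := by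
  refine M.im_direction_nonneg h₀ hu hlim ?_
  have hpi := Real.pi_pos
  have hcont : Continuous fun t : ℝ => (ζ₀ + t * u).im := by
    have := Complex.continuous_im; fun_prop
  rcases hs with ⟨h1, rfl⟩ | ⟨h1, rfl⟩
  · have hmem : ∀ᶠ t : ℝ in 𝓝 0, (ζ₀ + t * u).im < Real.pi / 2 :=
      hcont.continuousAt.eventually (gt_mem_nhds (by simp [h1]; positivity))
    filter_upwards [nhdsWithin_le_nhds hmem, self_mem_nhdsWithin] with t ht h2
    refine ⟨?_, ht.le⟩
    have h3 : 0 < t := h2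
    simp [h1]
    exact mul_nonneg h3.le (by linarith)
  · have hmem : ∀ᶠ t : ℝ in 𝓝 0, 0 < (ζ₀ + t * u).im :=
      hcont.continuousAt.eventually (lt_mem_nhds (by simp [h1]; positivity))
    filter_upwards [nhdsWithin_le_nhds hmem, self_mem_nhdsWithin] with t ht h2
    refine ⟨ht.le, ?_⟩
    have h3 : 0 < t := h2
    simp [h1]
    exact mul_nonpos_of_nonneg_of_nonpos h3.le (by linarith)

theorem sin_im_sub_eq_zero {ζ₁ ζ₂ : ℂ} {y s : ℝ} (hs : IsEdge y s) (h₁ : ζ₁ ∈ regStrip num den)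
    (h₂ : ζ₂ ∈ regStrip num den) (e₁ : ζ₁.im = y) (e₂ : ζ₂.im = y) :
    Real.sin (f ζ₁ - f ζ₂).im = 0 := by
  rw [Complex.sub_im, Real.sin_sub]
  rcases hs with ⟨rfl, -⟩ | ⟨rfl, -⟩
  · rw [M.sin_im_eq_zero h₁ e₁, M.sin_im_eq_zero h₂ e₂]; ring
  · rw [M.cos_im_eq_zero h₁ e₁, M.cos_im_eq_zero h₂ e₂]; ring

theorem mul_levelGap_pos_iff {c : ℝ} (hc : 0 < c) {x y s : ℝ} (hs : s = 1 ∨ s = -1)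
    (h : planePt x y ∈ regStrip num den) :
    (0 < s * levelGap num den c x y ↔ 0 < s * ((f (planePt x y)).re - Real.log c)) ∧
    (s * levelGap num den c x y < 0 ↔ s * ((f (planePt x y)).re - Real.log c) < 0) := by
  have h1 := M.levelGap_nonpos_iff hc h
  have h2 := M.levelGap_nonneg_iff hc h
  rw [← not_iff_not, not_le, not_le] at h1 h2
  rcases hs with rfl | rfl
  · simp [h1, h2]
  · simp [h1, h2]

/-- `s * levelGap` is positive where the level curve leaves this edge and negative where it follows
it. At a simple point the leading coefficient is real, so the sign changes. At a double point the
admissible half circle forces a real coefficient of the sign of `s`, so the curve leaves the edge on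
both sides. Higher orders violate the half circle condition. -/
theorem alphaMult_edge {c : ℝ} (hc : 0 < c) {x₀ y s : ℝ} (hs : IsEdge y s)
    (h₀ : planePt x₀ y ∈ regStrip num den) (hgap : levelGap num den c x₀ y = 0) {m : ℕ∞}
    (hm : m = alphaMult (fun z => num z / den z)
      (num (Complex.exp (planePt x₀ y)) / den (Complex.exp (planePt x₀ y)))
        (Complex.exp (planePt x₀ y))) :
    (m = 1 ∧ (((∀ᶠ x in 𝓝[>] x₀, 0 < s * levelGap num den c x y) ∧
        (∀ᶠ x in 𝓝[<] x₀, s * levelGap num den c x y < 0)) ∨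
      ((∀ᶠ x in 𝓝[>] x₀, s * levelGap num den c x y < 0) ∧
        (∀ᶠ x in 𝓝[<] x₀, 0 < s * levelGap num den c x y)))) ∨
    (m = 2 ∧ ∀ᶠ x in 𝓝[≠] x₀, 0 < s * levelGap num den c x y) := by
  have hpi := Real.pi_pos
  have hss : s = 1 ∨ s = -1 := hs.imp And.right And.right
  obtain ⟨n, h, hcont, hne, hord, heq, hlim⟩ := M.exists_order h₀
  rw [hord] at hm
  have hs' : IsEdge (planePt x₀ y).im s := by simpa using hs
  have hdir := fun u hu hus => M.im_edge_direction_nonneg (u := u) hs' h₀ hu hus hlim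
  have hlog : (f (planePt x₀ y)).re = Real.log c :=
    le_antisymm ((M.levelGap_nonpos_iff hc h₀).1 hgap.le) ((M.levelGap_nonneg_iff hc h₀).1 hgap.ge)
  have hpt : Continuous fun x : ℝ => planePt x y :=
    continuous_planePt.comp (by fun_prop : Continuous fun x : ℝ => (x, y))
  have hstrip : ∀ x, planePt x y ∈ logStrip := by
    intro x
    have := h₀.1
    simpa [logStrip] using this
  have hreg : ∀ᶠ x in 𝓝 x₀, planePt x y ∈ regStrip num den :=
    (hpt.tendsto x₀).eventually ((M.eventually_mem_regStrip h₀).mono fun ζ h => h) |>.mono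
      fun x h => h (hstrip x)
  have hto : Tendsto (fun x => planePt x y) (𝓝[≠] x₀)
      (𝓝[regStrip num den \ {planePt x₀ y}] (planePt x₀ y)) := by
    refine tendsto_nhdsWithin_iff.2 ⟨(hpt.tendsto x₀).mono_left nhdsWithin_le_nhds, ?_⟩
    filter_upwards [nhdsWithin_le_nhds hreg, self_mem_nhdsWithin] with x h1 h2
    refine ⟨h1, fun h3 => h2 ?_⟩
    simpa using congrArg Complex.re h3
  have hlimre : Tendsto (fun x => s * ((f (planePt x y)).re - Real.log c) / (x - x₀) ^ (n + 1))
      (𝓝[≠] x₀) (𝓝 (s * (h (planePt x₀ y)).re)) := by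
    have h1 := (((Complex.continuous_re.tendsto _).comp (hlim.comp hto)).const_mul s)
    refine h1.congr fun x => ?_
    have h2 : planePt x y - planePt x₀ y = ((x - x₀ : ℝ) : ℂ) := by simp [planePt]
    simp only [Function.comp, h2, ← Complex.ofReal_pow, Complex.div_ofReal_re, Complex.sub_re, hlog]
    ring
  have hne1 : 𝓝[>] x₀ ≤ 𝓝[≠] x₀ := nhdsWithin_mono _ fun x hx => ne_of_gt hx
  have hne2 : 𝓝[<] x₀ ≤ 𝓝[≠] x₀ := nhdsWithin_mono _ fun x hx => ne_of_lt hx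
  have hsign := fun x hx => M.mul_levelGap_pos_iff hc (x := x) (y := y) hss hx
  rcases n with _ | _ | n
  · left
    refine ⟨by simpa using hm, ?_⟩
    -- Along the edge the phase changes by multiples of `π`, so the quotient divided by its value at
    -- the base point is real.
    have him : (h (planePt x₀ y)).im = 0 := by
      have h1 : Tendsto (fun x => (h (planePt x y)).im) (𝓝[≠] x₀) (𝓝 (h (planePt x₀ y)).im) :=
        ((Complex.continuous_im.tendsto _).comp (hcont.tendsto.comp (hpt.tendsto x₀))).mono_left
          nhdsWithin_le_nhds
      refine tendsto_nhds_unique h1 (tendsto_const_nhds.congr' ?_)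
      filter_upwards [nhdsWithin_le_nhds hreg, self_mem_nhdsWithin,
        nhdsWithin_le_nhds ((hpt.tendsto x₀).eventually heq)] with x h2 h3 h4
      have h5 : Complex.exp (f (planePt x y) - f (planePt x₀ y))
          = 1 + ((x - x₀ : ℝ) : ℂ) * h (planePt x y) := by
        have h6 : planePt x y - planePt x₀ y = ((x - x₀ : ℝ) : ℂ) := by simp [planePt]
        rw [Complex.exp_sub, M.exp_eq _ h2, h4, h6]
        field_simp [Complex.exp_ne_zero]
        ring
      have h6 := congrArg Complex.im h5
      rw [Complex.exp_im, M.sin_im_sub_eq_zero hs h2 h₀ (by simp) (by simp), mul_zero,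
        Complex.add_im, Complex.one_im, zero_add, Complex.im_ofReal_mul] at h6
      exact ((mul_eq_zero.1 h6.symm).resolve_left (sub_ne_zero.2 h3)).symm
    have hre : (h (planePt x₀ y)).re ≠ 0 := fun h0 => hne (Complex.ext h0 him)
    rcases lt_or_gt_of_ne (mul_ne_zero (by rcases hss with rfl | rfl <;> norm_num) hre :
      s * (h (planePt x₀ y)).re ≠ 0) with hk | hk
    · right
      have hev := hlimre.eventually (gt_mem_nhds hk)
      constructor
      · filter_upwards [hne1 hev, self_mem_nhdsWithin,
          nhdsWithin_le_nhds hreg] with x h1 h2 h3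
        have h4 : 0 < x - x₀ := sub_pos.2 h2
        rw [zero_add, pow_one, div_neg_iff] at h1
        rw [(hsign x h3).2]
        rcases h1 with h1 | h1
        · linarith [h1.2]
        · exact h1.1
      · filter_upwards [hne2 hev, self_mem_nhdsWithin,
          nhdsWithin_le_nhds hreg] with x h1 h2 h3
        have h4 : x - x₀ < 0 := sub_neg.2 h2
        rw [zero_add, pow_one, div_neg_iff] at h1
        rw [(hsign x h3).1]
        rcases h1 with h1 | h1
        · exact h1.1
        · linarith [h1.2]
    · left
      have hev := hlimre.eventually (lt_mem_nhds hk)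
      constructor
      · filter_upwards [hne1 hev, self_mem_nhdsWithin,
          nhdsWithin_le_nhds hreg] with x h1 h2 h3
        have h4 : 0 < x - x₀ := sub_pos.2 h2
        rw [zero_add, pow_one, div_pos_iff] at h1
        rw [(hsign x h3).1]
        rcases h1 with h1 | h1
        · exact h1.1
        · linarith [h1.2]
      · filter_upwards [hne2 hev, self_mem_nhdsWithin,
          nhdsWithin_le_nhds hreg] with x h1 h2 h3
        have h4 : x - x₀ < 0 := sub_neg.2 h2
        rw [zero_add, pow_one, div_pos_iff] at h1
        rw [(hsign x h3).2]
        rcases h1 with h1 | h1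
        · linarith [h1.2]
        · exact h1.1
  · right
    refine ⟨by rw [hm]; norm_num, ?_⟩
    -- The directions `±1` along the edge give a real coefficient; the inward normal `s i` gives its
    -- sign.
    have h1 := hdir 1 (by simp) (by simp)
    have h2 := hdir (-1) (by simp) (by simp)
    have h3 := hdir (s * Complex.I) (by rcases hss with rfl | rfl <;> simp)
      (by simp; exact mul_self_nonneg s)
    simp at h1 h2 h3
    have him : (h (planePt x₀ y)).im = 0 := le_antisymm h2 h1
    have hre : (h (planePt x₀ y)).re ≠ 0 := fun h0 => hne (Complex.ext h0 him)
    have hk : 0 < s * (h (planePt x₀ y)).re := by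
      refine lt_of_le_of_ne (by linarith) (Ne.symm (mul_ne_zero ?_ hre))
      rcases hss with rfl | rfl <;> norm_num
    filter_upwards [hlimre.eventually (lt_mem_nhds hk), self_mem_nhdsWithin,
      nhdsWithin_le_nhds hreg] with x h4 h5 h6
    rw [(hsign x h6).1]
    have h7 : 0 < (x - x₀) ^ (0 + 1 + 1) := by
      rw [zero_add]; exact (sq_pos_of_ne_zero (sub_ne_zero.2 h5))
    exact (div_pos_iff_of_pos_right h7).1 h4
  · exfalso
    -- The exponent is at least 2, so the bad direction lies in the upper half plane; for the upper
    -- edge it is conjugated.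
    have hsmall : ∀ φ : ℝ, 0 ≤ φ → (n + 1 + 1 : ℕ) * φ ≤ 2 * Real.pi → φ ≤ Real.pi := by
      intro φ h0 h1
      push_cast at h1
      have := mul_nonneg (Nat.cast_nonneg (α := ℝ) n) h0
      nlinarith
    rcases hss with rfl | rfl
    · obtain ⟨φ, h0, h1, h2⟩ := exists_im_mul_exp_neg hne (k := n + 1 + 1) (by omega)
      refine absurd (hdir _ (Complex.norm_exp_ofReal_mul_I φ) ?_) (not_le.2 h2)
      rw [one_mul, Complex.exp_ofReal_mul_I_im]
      exact Real.sin_nonneg_of_nonneg_of_le_pi h0 (hsmall φ h0 h1)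
    · obtain ⟨φ, h0, h1, h2⟩ := exists_im_mul_exp_neg (c := -conj (h (planePt x₀ y)))
        (by simpa using hne) (k := n + 1 + 1) (by omega)
      have h3 := hdir (conj (Complex.exp (φ * Complex.I)))
        (by rw [RCLike.norm_conj]; exact Complex.norm_exp_ofReal_mul_I φ) (by
          rw [Complex.conj_im, Complex.exp_ofReal_mul_I_im]
          have := Real.sin_nonneg_of_nonneg_of_le_pi h0 (hsmall φ h0 h1)
          linarith)
      have h4 : h (planePt x₀ y) * conj (Complex.exp (φ * Complex.I)) ^ (n + 1 + 1)
          = -conj (-conj (h (planePt x₀ y)) * Complex.exp (φ * Complex.I) ^ (n + 1 + 1)) := by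
        simp
      rw [h4, Complex.neg_im, Complex.conj_im, neg_neg] at h3
      linarith

end PhaseModel
end

/-! ### Reflections in the axes -/

noncomputable section

open Filter Topology

/-- The reflection `x + i y ↦ ε x + i δ y`. -/
def signFlip (ε δ : ℝ) (z : ℂ) : ℂ := ⟨ε * z.re, δ * z.im⟩

/-- A sign `1` or `-1`. -/
def IsUnitSign (ε : ℝ) : Prop := ε = 1 ∨ ε = -1

theorem IsUnitSign.mul_self {ε : ℝ} (h : IsUnitSign ε) : ε * ε = 1 := by
  rcases h with rfl | rfl <;> norm_num

theorem IsUnitSign.ne_zero {ε : ℝ} (h : IsUnitSign ε) : ε ≠ 0 := by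
  rcases h with rfl | rfl <;> norm_num

theorem isUnitSign_one : IsUnitSign 1 := Or.inl rfl

theorem isUnitSign_neg_one : IsUnitSign (-1) := Or.inr rfl

@[simp] theorem signFlip_re (ε δ : ℝ) (z : ℂ) : (signFlip ε δ z).re = ε * z.re := rfl

@[simp] theorem signFlip_im (ε δ : ℝ) (z : ℂ) : (signFlip ε δ z).im = δ * z.im := rfl

theorem signFlip_one_one (z : ℂ) : signFlip 1 1 z = z := by
  apply Complex.ext <;> simp

theorem signFlip_neg_neg (z : ℂ) : signFlip (-1) (-1) z = -z := by
  apply Complex.ext <;> simp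

theorem signFlip_one_neg (z : ℂ) : signFlip 1 (-1) z = conj z := by
  apply Complex.ext <;> simp

theorem signFlip_neg_one (z : ℂ) : signFlip (-1) 1 z = -conj z := by
  apply Complex.ext <;> simp

theorem norm_signFlip {ε δ : ℝ} (hε : IsUnitSign ε) (hδ : IsUnitSign δ) (z : ℂ) :
    ‖signFlip ε δ z‖ = ‖z‖ := by
  rcases hε with rfl | rfl <;> rcases hδ with rfl | rfl <;>
    simp [signFlip_one_one, signFlip_one_neg, signFlip_neg_one, signFlip_neg_neg]

theorem exists_eq_signFlip (w : ℂ) : ∃ ε δ, IsUnitSign ε ∧ IsUnitSign δ ∧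
    w = signFlip ε δ ⟨|w.re|, |w.im|⟩ := by
  have key : ∀ r : ℝ, ∃ ε, IsUnitSign ε ∧ r = ε * |r| := by
    intro r
    rcases le_total 0 r with h | h
    · exact ⟨1, isUnitSign_one, by rw [abs_of_nonneg h, one_mul]⟩
    · exact ⟨-1, isUnitSign_neg_one, by rw [abs_of_nonpos h]; ring⟩
  obtain ⟨ε, hε, h1⟩ := key w.re
  obtain ⟨δ, hδ, h2⟩ := key w.im
  exact ⟨ε, δ, hε, hδ, Complex.ext h1 h2⟩

theorem analyticAt_conj_conj {f : ℂ → ℂ} {z : ℂ} (h : AnalyticAt ℂ f z) :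
    AnalyticAt ℂ (fun w => conj (f (conj w))) (conj z) := by
  rw [Complex.analyticAt_iff_eventually_differentiableAt] at h ⊢
  have h1 : Tendsto (fun w : ℂ => conj w) (𝓝 (conj z)) (𝓝 z) := by
    have := Complex.continuous_conj.tendsto (conj z)
    rwa [Complex.conj_conj] at this
  filter_upwards [h1.eventually h] with w hw
  have h2 := hw.conj_conj
  rw [Complex.conj_conj] at h2
  exact h2

/-- Conjugating a factorization `(z - z₀) ^ n g` yields one at the conjugate point. The reverse
inequality follows by applying this twice. -/
theorem analyticOrderAt_conj_conj_le (f : ℂ → ℂ) (z : ℂ) :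
    analyticOrderAt f z ≤ analyticOrderAt (fun w => conj (f (conj w))) (conj z) := by
  have hto : Tendsto (fun w : ℂ => conj w) (𝓝 (conj z)) (𝓝 z) := by
    have := Complex.continuous_conj.tendsto (conj z)
    rwa [Complex.conj_conj] at this
  by_cases hf : AnalyticAt ℂ f z
  · refine ENat.forall_natCast_le_iff_le.1 fun n hn => ?_
    rw [natCast_le_analyticOrderAt hf] at hn
    rw [natCast_le_analyticOrderAt (analyticAt_conj_conj hf)]
    obtain ⟨g, hg, hgeq⟩ := hn
    refine ⟨_, analyticAt_conj_conj hg, ?_⟩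
    filter_upwards [hto.eventually hgeq] with w hw
    rw [hw]; simp
  · rw [analyticOrderAt_of_not_analyticAt hf]; exact zero_le

theorem analyticOrderAt_conj_conj (f : ℂ → ℂ) (z : ℂ) :
    analyticOrderAt (fun w => conj (f (conj w))) (conj z) = analyticOrderAt f z := by
  refine le_antisymm ?_ (analyticOrderAt_conj_conj_le f z)
  simpa using analyticOrderAt_conj_conj_le (fun w => conj (f (conj w))) (conj z)

theorem alphaMult_conj {F : ℂ → ℂ} (hF : ∀ z, F (conj z) = conj (F z)) (α w : ℂ) :
    alphaMult F (conj α) (conj w) = alphaMult F α w := by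
  rw [alphaMult, alphaMult, ← analyticOrderAt_conj_conj]
  simp [hF]

theorem alphaMult_neg {F : ℂ → ℂ} (hF : ∀ z, F (-z) = -F z) (α w : ℂ) :
    alphaMult F (-α) (-w) = alphaMult F α w := by
  have h : analyticOrderAt ((fun z => F z - α) ∘ fun z => -z) (-w)
      = analyticOrderAt (fun z => F z - α) (- -w) :=
    analyticOrderAt_comp_of_deriv_ne_zero (by fun_prop) (by simp)
  rw [alphaMult, alphaMult, ← neg_neg w, ← h, neg_neg, ← analyticOrderAt_neg]
  congr 1
  funext z
  simp [hF]; ring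

theorem map_signFlip {F : ℂ → ℂ} (hn : ∀ z, F (-z) = -F z) (hc : ∀ z, F (conj z) = conj (F z))
    {ε δ : ℝ} (hε : IsUnitSign ε) (hδ : IsUnitSign δ) (z : ℂ) :
    F (signFlip ε δ z) = signFlip ε δ (F z) := by
  rcases hε with rfl | rfl <;> rcases hδ with rfl | rfl <;>
    simp [signFlip_one_one, signFlip_one_neg, signFlip_neg_one, signFlip_neg_neg, hn, hc]

theorem alphaMult_signFlip {F : ℂ → ℂ} (hn : ∀ z, F (-z) = -F z) (hc : ∀ z, F (conj z) = conj (F z))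
    {ε δ : ℝ} (hε : IsUnitSign ε) (hδ : IsUnitSign δ) (α z : ℂ) :
    alphaMult F (signFlip ε δ α) (signFlip ε δ z) = alphaMult F α z := by
  rcases hε with rfl | rfl <;> rcases hδ with rfl | rfl <;>
    simp [signFlip_one_one, signFlip_one_neg, signFlip_neg_one, signFlip_neg_neg, alphaMult_neg hn,
      alphaMult_conj hc]

/-- The point of the closed first quadrant over `x` on the curve `y = Y x`. -/
def pathPt (Y : ℝ → ℝ) (x : ℝ) : ℂ := Complex.exp (planePt x (Y x))

theorem pathPt_re (Y : ℝ → ℝ) (x : ℝ) : (pathPt Y x).re = Real.exp x * Real.cos (Y x) := by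
  simp [pathPt, Complex.exp_re]

theorem pathPt_im (Y : ℝ → ℝ) (x : ℝ) : (pathPt Y x).im = Real.exp x * Real.sin (Y x) := by
  simp [pathPt, Complex.exp_im]

theorem norm_pathPt (Y : ℝ → ℝ) (x : ℝ) : ‖pathPt Y x‖ = Real.exp x := by
  simp [pathPt, Complex.norm_exp]

namespace PhaseModel

variable {p : ℕ} {num den f : ℂ → ℂ} (M : PhaseModel p num den f)

include M

theorem quot_neg (z : ℂ) : num (-z) / den (-z) = -(num z / den z) := by
  rw [M.num_neg, M.den_neg, neg_div]

theorem quot_conj (z : ℂ) : num (conj z) / den (conj z) = conj (num z / den z) := by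
  rw [M.num_conj, M.den_conj, map_div₀]

end PhaseModel

/-- The abscissas of the points with `|num / den| = c` and phase `v`. -/
def levelSet (num den f : ℂ → ℂ) (c : ℝ) (Y : ℝ → ℝ) (v : ℝ) : Set ℝ :=
  {x | pathPhase f Y x = v ∧ levelGap num den c x (Y x) = 0}

namespace IsLevelPath

variable {p : ℕ} {num den f : ℂ → ℂ} {α : ℂ} {Y : ℝ → ℝ}
  (P : IsLevelPath num den ‖α‖ Y) (M : PhaseModel p num den f) (hα : α ≠ 0)

include P M hα

theorem quot_pathPt {x : ℝ} (h : levelGap num den ‖α‖ x (Y x) = 0) :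
    num (pathPt Y x) / den (pathPt Y x) =
      ⟨‖α‖ * Real.cos (pathPhase f Y x), ‖α‖ * Real.sin (pathPhase f Y x)⟩ := by
  have hc : 0 < ‖α‖ := norm_pos_iff.2 hα
  have hr := P.mem_regStrip M hc x
  have h1 := le_antisymm ((M.levelGap_nonpos_iff hc hr).1 h.le) ((M.levelGap_nonneg_iff hc hr).1 h.ge)
  rw [pathPt, ← M.exp_eq _ hr]
  apply Complex.ext
  · rw [Complex.exp_re, h1, Real.exp_log hc]; rfl
  · rw [Complex.exp_im, h1, Real.exp_log hc]; rfl

/-- Every `α`-point is a reflection of a point on the curve `y = Y x`. -/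
theorem exists_flip_of_alpha_point {w : ℂ} (hw : num w / den w = α) :
    levelGap num den ‖α‖ (Real.log ‖w‖) (Y (Real.log ‖w‖)) = 0 ∧
    ∃ ε δ, IsUnitSign ε ∧ IsUnitSign δ ∧ w = signFlip ε δ (pathPt Y (Real.log ‖w‖)) ∧
      α.re = ε * (‖α‖ * Real.cos (pathPhase f Y (Real.log ‖w‖))) ∧
      α.im = δ * (‖α‖ * Real.sin (pathPhase f Y (Real.log ‖w‖))) := by
  have hc : 0 < ‖α‖ := norm_pos_iff.2 hα
  have hw0 : w ≠ 0 := by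
    rintro rfl
    rw [M.num_zero, zero_div] at hw
    exact hα hw.symm
  have hwn : 0 < ‖w‖ := norm_pos_iff.2 hw0
  obtain ⟨ε, δ, hε, hδ, hfl⟩ := exists_eq_signFlip w
  set q : ℂ := ⟨|w.re|, |w.im|⟩ with hq
  set x := Real.log ‖w‖ with hx
  have hqn : ‖q‖ = ‖w‖ := by rw [hfl, norm_signFlip hε hδ]
  have hqexp : q = Complex.exp (planePt x q.arg) := by
    nth_rewrite 1 [← Complex.norm_mul_exp_arg_mul_I q]
    rw [planePt, Complex.exp_add, ← Complex.ofReal_exp, hx, Real.exp_log hwn, hqn]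
  have ha0 : 0 ≤ q.arg := Complex.arg_nonneg_iff.2 (abs_nonneg _)
  have ha1 : q.arg ≤ Real.pi / 2 :=
    (le_abs_self _).trans (Complex.abs_arg_le_pi_div_two_iff.2 (abs_nonneg _))
  have hFq : num w / den w = signFlip ε δ (num q / den q) := by
    rw [hfl]
    exact map_signFlip (F := fun z => num z / den z) M.quot_neg M.quot_conj hε hδ q
  have hnq : ‖num q / den q‖ = ‖α‖ := by
    rw [← hw, hFq, norm_signFlip hε hδ]
  have hdq : den q ≠ 0 := by
    intro h0
    rw [h0, div_zero, norm_zero] at hnq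
    exact hc.ne hnq
  have hgap : levelGap num den ‖α‖ x q.arg = 0 := by
    rw [levelGap, ← hqexp, ← hnq, norm_div, div_mul_cancel₀ _ (norm_ne_zero_iff.2 hdq), sub_self]
  have hY := P.eq_of_gap_eq_zero M hc ha0 ha1 hgap
  rw [hY] at hgap hqexp
  have hqp : q = pathPt Y x := hqexp
  have h1 := P.quot_pathPt M hα hgap
  rw [← hqp] at h1
  rw [h1, hw] at hFq
  exact ⟨hgap, ε, δ, hε, hδ, by rw [← hqp]; exact hfl, congrArg Complex.re hFq,
    congrArg Complex.im hFq⟩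

/-- Reflections of points on the curve are `α`-points once the signs match. -/
theorem alpha_point_of_flip {x : ℝ} (h : levelGap num den ‖α‖ x (Y x) = 0) {ε δ : ℝ}
    (hε : IsUnitSign ε) (hδ : IsUnitSign δ)
    (hre : α.re = ε * (‖α‖ * Real.cos (pathPhase f Y x)))
    (him : α.im = δ * (‖α‖ * Real.sin (pathPhase f Y x))) :
    num (signFlip ε δ (pathPt Y x)) / den (signFlip ε δ (pathPt Y x)) = α ∧
      Real.log ‖signFlip ε δ (pathPt Y x)‖ = x := by
  constructor
  · have h1 := map_signFlip (F := fun z => num z / den z) M.quot_neg M.quot_conj hε hδ (pathPt Y x)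
    simp only [P.quot_pathPt M hα h] at h1
    rw [h1]
    exact Complex.ext hre.symm him.symm
  · rw [norm_signFlip hε hδ, norm_pathPt, Real.log_exp]

/-- The multiplicity of an `α`-point is that of its reflection on the curve. -/
theorem alphaMult_eq_pathPt {w : ℂ} (hw : num w / den w = α) :
    alphaMult (fun z => num z / den z) α w =
      alphaMult (fun z => num z / den z)
        (num (pathPt Y (Real.log ‖w‖)) / den (pathPt Y (Real.log ‖w‖)))
        (pathPt Y (Real.log ‖w‖)) := by
  obtain ⟨hgap, ε, δ, hε, hδ, h1, h2, h3⟩ := P.exists_flip_of_alpha_point M hα hw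
  set x := Real.log ‖w‖
  have h4 : α = signFlip ε δ (num (pathPt Y x) / den (pathPt Y x)) := by
    rw [P.quot_pathPt M hα hgap]
    exact Complex.ext h2 h3
  have h5 := alphaMult_signFlip (F := fun z => num z / den z) M.quot_neg M.quot_conj hε hδ
    (num (pathPt Y x) / den (pathPt Y x)) (pathPt Y x)
  rwa [← h1, ← h4] at h5

end IsLevelPath
end

/-! ### Points of one phase on the level curve -/

noncomputable section

open Filter Topology

/-- The phase `v` is that of the values on the edge `y` of the strip. -/
def EdgeLevel (y s v : ℝ) : Prop :=
  (y = 0 ∧ s = 1 ∧ Real.sin v = 0) ∨ (y = Real.pi / 2 ∧ s = -1 ∧ Real.cos v = 0)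

theorem EdgeLevel.isEdge {y s v : ℝ} (h : EdgeLevel y s v) : IsEdge y s := by
  rcases h with ⟨h1, h2, -⟩ | ⟨h1, h2, -⟩
  · exact Or.inl ⟨h1, h2⟩
  · exact Or.inr ⟨h1, h2⟩

/-- The multiplicity with which `num / den` takes its value at the point over `x`. -/
def pathMult (num den : ℂ → ℂ) (Y : ℝ → ℝ) (x : ℝ) : ℕ∞ :=
  alphaMult (fun z => num z / den z) (num (pathPt Y x) / den (pathPt Y x)) (pathPt Y x)

namespace IsLevelPath

variable {p : ℕ} {num den f : ℂ → ℂ} {c : ℝ} {Y : ℝ → ℝ}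
  (P : IsLevelPath num den c Y) (M : PhaseModel p num den f) (hc : 0 < c)

include P M hc

theorem pathMult_interior {x : ℝ} (h0 : 0 < Y x) (h1 : Y x < Real.pi / 2) :
    pathMult num den Y x = 1 :=
  M.alphaMult_interior (P.mem_regStrip M hc x) (by simpa) (by simpa)

theorem eq_of_phase_eq_of_interior {x x' : ℝ} (h0 : 0 < Y x) (h1 : Y x < Real.pi / 2)
    (h : pathPhase f Y x' = pathPhase f Y x) : x' = x := by
  rcases lt_trichotomy x' x with hlt | he | hgt
  · rcases P.same_edge_of_pathPhase_eq M hc hlt h with h2 | h2 <;> linarith [h2.2]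
  · exact he
  · rcases P.same_edge_of_pathPhase_eq M hc hgt h.symm with h2 | h2 <;> linarith [h2.1]

variable {y s v : ℝ} (hE : EdgeLevel y s v)

include hE

/-- On the opposite edge sine and cosine of `v` would both vanish. -/
theorem edge_or_interior {x : ℝ} (h : pathPhase f Y x = v) :
    Y x = y ∨ (0 < Y x ∧ Y x < Real.pi / 2) := by
  rcases (P.nonneg x).eq_or_lt with h0 | h0
  · left
    rcases hE with ⟨rfl, -, -⟩ | ⟨rfl, -, hcos⟩
    · exact h0.symm
    · have h1 := P.sin_pathPhase M hc h0.symm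
      rw [h] at h1
      have := Real.sin_sq_add_cos_sq v
      rw [h1, hcos] at this; norm_num at this
  rcases (P.le x).eq_or_lt with h1 | h1
  · left
    rcases hE with ⟨rfl, -, hsin⟩ | ⟨rfl, -, -⟩
    · have h2 := P.cos_pathPhase M hc h1
      rw [h] at h2
      have := Real.sin_sq_add_cos_sq v
      rw [h2, hsin] at this; norm_num at this
    · exact h1
  · exact Or.inr ⟨h0, h1⟩

theorem sin_phase_sub {x : ℝ} (h : Y x = y) : Real.sin (pathPhase f Y x - v) = 0 := by
  rw [Real.sin_sub]
  rcases hE with ⟨rfl, -, hv⟩ | ⟨rfl, -, hv⟩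
  · rw [hv, P.sin_pathPhase M hc h]; ring
  · rw [hv, P.cos_pathPhase M hc h]; ring

omit M hc in
-- At a real edge point of the curve the modulus is at most `c`, at an imaginary one at least `c`;
-- the sign `s` merges both cases.
theorem ne_edge_of_gap_pos {x : ℝ} (h : 0 < s * levelGap num den c x y) : Y x ≠ y := by
  have hpi := Real.pi_pos
  rcases hE with ⟨rfl, rfl, -⟩ | ⟨rfl, rfl, -⟩
  · intro h0
    have := P.gap_nonpos x (by rw [h0]; positivity)
    rw [h0] at this; linarith
  · intro h0
    have := P.gap_nonneg x (by rw [h0]; positivity)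
    rw [h0] at this; linarith

theorem eq_edge_of_gap_neg {x : ℝ} (h : s * levelGap num den c x y < 0) : Y x = y := by
  rcases hE with ⟨rfl, rfl, -⟩ | ⟨rfl, rfl, -⟩
  · exact P.eq_zero_of_gap M hc (by linarith)
  · exact P.eq_pi_div_two_of_gap M hc (by linarith)

theorem eq_edge_of_phase_eq {x x' : ℝ} (hne : x ≠ x') (h : pathPhase f Y x = v)
    (h' : pathPhase f Y x' = v) : Y x' = y := by
  rcases P.edge_or_interior M hc hE h' with h1 | ⟨h1, h2⟩
  · exact h1
  · exact absurd (P.eq_of_phase_eq_of_interior M hc h1 h2 (h.trans h'.symm)) hne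

theorem phase_const_of_gap_neg {x : ℝ} (hx : pathPhase f Y x = v) {l : Filter ℝ} (hl : l ≤ 𝓝 x)
    (h : ∀ᶠ t in l, s * levelGap num den c t y < 0) : ∀ᶠ t in l, pathPhase f Y t = v := by
  have h1 : ∀ᶠ t in l, |pathPhase f Y t - v| < Real.pi := by
    have := (P.continuous_pathPhase M hc).continuousAt.eventually
      (Metric.ball_mem_nhds (pathPhase f Y x) Real.pi_pos)
    filter_upwards [hl this] with t ht
    simpa [Real.dist_eq, hx] using ht
  filter_upwards [h, h1] with t h2 h3
  have h4 := P.sin_phase_sub M hc hE (P.eq_edge_of_gap_neg M hc hE h2)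
  have := (Real.sin_eq_zero_iff_of_lt_of_lt (abs_lt.1 h3).1 (abs_lt.1 h3).2).1 h4
  linarith

/-- If the phase took the value `v` again further right, monotonicity would keep it equal to `v` in
between. The curve would then lie on the edge there, although it leaves the edge just after `x`. -/
theorem phase_lt_right_of_gap_pos {x : ℝ} (hx : pathPhase f Y x = v)
    (h : ∀ᶠ t in 𝓝[>] x, 0 < s * levelGap num den c t y) : ∀ x' > x, v < pathPhase f Y x' := by
  have hmono := P.monotone_pathPhase M hc
  intro x' hx'
  have h1 : v ≤ pathPhase f Y x' := by rw [← hx]; exact hmono hx'.le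
  refine lt_of_le_of_ne h1 fun he => ?_
  obtain ⟨t, ht1, ht2⟩ := (h.and (Ioo_mem_nhdsGT hx')).exists
  refine P.ne_edge_of_gap_pos hE ht1 (P.eq_edge_of_phase_eq M hc hE ht2.1.ne hx ?_)
  exact le_antisymm (by rw [he]; exact hmono ht2.2.le) (by rw [← hx]; exact hmono ht2.1.le)

theorem phase_lt_left_of_gap_pos {x : ℝ} (hx : pathPhase f Y x = v)
    (h : ∀ᶠ t in 𝓝[<] x, 0 < s * levelGap num den c t y) : ∀ x' < x, pathPhase f Y x' < v := by
  have hmono := P.monotone_pathPhase M hc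
  intro x' hx'
  have h1 : pathPhase f Y x' ≤ v := by rw [← hx]; exact hmono hx'.le
  refine lt_of_le_of_ne h1 fun he => ?_
  obtain ⟨t, ht1, ht2⟩ := (h.and (Ioo_mem_nhdsLT hx')).exists
  refine P.ne_edge_of_gap_pos hE ht1 (P.eq_edge_of_phase_eq M hc hE ht2.2.ne' hx ?_)
  exact le_antisymm (by rw [← hx]; exact hmono ht2.2.le) (by rw [← he]; exact hmono ht2.1.le)

/-- A point of the level set on the edge is isolated and double, or it is simple and is the first
or the last point of a segment of constant phase. -/
theorem edge_point_cases {x : ℝ} (hx : x ∈ levelSet num den f c Y v) (hY : Y x = y) :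
    (pathMult num den Y x = 2 ∧ ∀ x', pathPhase f Y x' = v → x' = x) ∨
    (pathMult num den Y x = 1 ∧ (∃ x' > x, pathPhase f Y x' = v) ∧
      ∀ x' < x, pathPhase f Y x' < v) ∨
    (pathMult num den Y x = 1 ∧ (∃ x' < x, pathPhase f Y x' = v) ∧
      ∀ x' > x, v < pathPhase f Y x') := by
  have hr := P.mem_regStrip M hc x
  have hg := hx.2
  have hmult : pathMult num den Y x = alphaMult (fun z => num z / den z)
      (num (Complex.exp (planePt x y)) / den (Complex.exp (planePt x y)))
        (Complex.exp (planePt x y)) := by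
    rw [← hY]; rfl
  rw [hY] at hr hg
  rcases M.alphaMult_edge hc hE.isEdge hr hg hmult with ⟨h1, ⟨h2, h3⟩ | ⟨h2, h3⟩⟩ | ⟨h1, h2⟩
  · right; right
    have h4 := P.phase_const_of_gap_neg M hc hE hx.1 nhdsWithin_le_nhds h3
    obtain ⟨x', h5, h6⟩ := (h4.and self_mem_nhdsWithin).exists
    exact ⟨h1, ⟨x', h6, h5⟩, P.phase_lt_right_of_gap_pos M hc hE hx.1 h2⟩
  · right; left
    have h4 := P.phase_const_of_gap_neg M hc hE hx.1 nhdsWithin_le_nhds h2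
    obtain ⟨x', h5, h6⟩ := (h4.and self_mem_nhdsWithin).exists
    exact ⟨h1, ⟨x', h6, h5⟩, P.phase_lt_left_of_gap_pos M hc hE hx.1 h3⟩
  · left
    refine ⟨h1, fun x' hx' => ?_⟩
    have hr := P.phase_lt_right_of_gap_pos M hc hE hx.1
      (h2.filter_mono (nhdsWithin_mono _ fun t ht => ne_of_gt ht))
    have hl := P.phase_lt_left_of_gap_pos M hc hE hx.1
      (h2.filter_mono (nhdsWithin_mono _ fun t ht => ne_of_lt ht))
    rcases lt_trichotomy x' x with h | h | h
    · exact absurd hx' (hl x' h).ne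
    · exact h
    · exact absurd hx' (hr x' h).ne'

/-- The alternatives are: phase never reached; one interior crossing; tangency to the edge; a
plateau that never ends; a plateau with two ends. Only the first and the fourth have deficient
multiplicity, and in both the phase never exceeds `v`. -/
theorem levelSet_shape (hv : 0 < v) :
    (levelSet num den f c Y v = ∅ ∧ ∀ x, pathPhase f Y x < v) ∨
    (∃ x, levelSet num den f c Y v = {x} ∧ 0 < Y x ∧ Y x < Real.pi / 2 ∧
      pathMult num den Y x = 1) ∨
    (∃ x, levelSet num den f c Y v = {x} ∧ Y x = y ∧ pathMult num den Y x = 2) ∨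
    (∃ x, levelSet num den f c Y v = {x} ∧ Y x = y ∧ pathMult num den Y x = 1 ∧
      ∀ x', pathPhase f Y x' ≤ v) ∨
    (∃ x₁ x₂, x₁ < x₂ ∧ levelSet num den f c Y v = {x₁, x₂} ∧ Y x₁ = y ∧ Y x₂ = y ∧
      pathMult num den Y x₁ = 1 ∧ pathMult num den Y x₂ = 1) := by
  by_cases hatt : ∃ x, v ≤ pathPhase f Y x
  swap
  · push Not at hatt
    exact Or.inl ⟨Set.eq_empty_of_forall_notMem fun x hx => (hatt x).ne hx.1, hatt⟩
  right
  obtain ⟨x₁, h1, h2, hfirst⟩ := P.exists_first M hc hv hatt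
  have hmem₁ : x₁ ∈ levelSet num den f c Y v := ⟨h1, h2⟩
  rcases P.edge_or_interior M hc hE h1 with hY | ⟨h3, h4⟩
  swap
  · left
    refine ⟨x₁, Set.eq_singleton_iff_unique_mem.2 ⟨hmem₁, fun x hx => ?_⟩, h3, h4,
      P.pathMult_interior M hc h3 h4⟩
    exact P.eq_of_phase_eq_of_interior M hc h3 h4 (hx.1.trans h1.symm)
  right
  rcases P.edge_point_cases M hc hE hmem₁ hY with ⟨h3, h4⟩ | ⟨h3, ⟨x', h4, h5⟩, -⟩ |
    ⟨-, ⟨x', h4, h5⟩, -⟩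
  · left
    exact ⟨x₁, Set.eq_singleton_iff_unique_mem.2 ⟨hmem₁, fun x hx => h4 x hx.1⟩, hY, h3⟩
  swap
  · exact absurd h5 (hfirst x' h4).ne
  right
  have hY' : ∀ x ∈ levelSet num den f c Y v, Y x = y := by
    intro x hx
    by_cases he : x₁ = x
    · rw [← he]; exact hY
    · exact P.eq_edge_of_phase_eq M hc hE he h1 hx.1
  have hcase : ∀ x ∈ levelSet num den f c Y v, x = x₁ ∨
      (pathMult num den Y x = 1 ∧ ∀ x' > x, v < pathPhase f Y x') := by
    intro x hx
    rcases P.edge_point_cases M hc hE hx (hY' x hx) with ⟨-, h6⟩ | ⟨-, -, h6⟩ | ⟨h6, -, h7⟩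
    · exact Or.inl (h6 x₁ h1).symm
    · left
      rcases lt_trichotomy x x₁ with h | h | h
      · exact absurd hx.1 (hfirst x h).ne
      · exact h
      · exact absurd h1 (h6 x₁ h).ne
    · exact Or.inr ⟨h6, h7⟩
  by_cases hex : ∃ x, v < pathPhase f Y x
  · right
    obtain ⟨x₂, g1, g2, hlast⟩ := P.exists_last M hc hv.le hex
    have hmem₂ : x₂ ∈ levelSet num den f c Y v := ⟨g1, g2⟩
    have hlt : x₁ < x₂ := by
      by_contra! h
      exact (hlast x' (h.trans_lt h4)).ne h5.symm
    refine ⟨x₁, x₂, hlt, ?_, hY, hY' _ hmem₂, h3, ?_⟩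
    · refine Set.Subset.antisymm (fun x hx => ?_) ?_
      · rcases hcase x hx with h | ⟨-, h⟩
        · exact Or.inl h
        · right
          rcases lt_trichotomy x x₂ with h' | h' | h'
          · exact absurd g1 (h x₂ h').ne'
          · exact h'
          · exact absurd hx.1 (hlast x h').ne'
      · rintro x (rfl | rfl)
        · exact hmem₁
        · exact hmem₂
    · exact ((hcase x₂ hmem₂).resolve_left hlt.ne').1
  · left
    push Not at hex
    refine ⟨x₁, Set.eq_singleton_iff_unique_mem.2 ⟨hmem₁, fun x hx => ?_⟩, hY, h3, hex⟩
    refine (hcase x hx).resolve_right fun h => ?_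
    exact absurd (h.2 (x + 1) (by linarith)) (not_lt.2 (hex _))

omit hE in
-- The phase is `0` on a whole left half line, so the plateau has no left end. Its right end exists
-- because the phase reaches `π / 2`.
theorem levelSet_zero_shape : ∃ x, levelSet num den f c Y 0 = {x} ∧ Y x = 0 ∧
    pathMult num den Y x = 1 := by
  have hE : EdgeLevel 0 1 0 := Or.inl ⟨rfl, rfl, Real.sin_zero⟩
  obtain ⟨x₂, g1, g2, hlast⟩ := P.exists_last M hc le_rfl
    (by obtain ⟨x, hx⟩ := P.exists_pi_div_two_le M hc
        exact ⟨x, Real.pi_div_two_pos.trans_le hx⟩)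
  obtain ⟨x₀, hx₀⟩ := P.exists_phase_eq_zero M hc
  have hcase : ∀ x ∈ levelSet num den f c Y 0, Y x = 0 ∧ pathMult num den Y x = 1 ∧
      ∀ x' > x, 0 < pathPhase f Y x' := by
    intro x hx
    set t := min x₀ (x - 1) with ht
    have htx : t < x := (min_le_right _ _).trans_lt (by linarith)
    have h0 := (hx₀ t (min_le_left _ _)).2
    have hY : Y x = 0 := P.eq_edge_of_phase_eq M hc hE htx.ne h0 hx.1
    rcases P.edge_point_cases M hc hE hx hY with ⟨-, h6⟩ | ⟨-, -, h6⟩ | ⟨h6, -, h7⟩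
    · exact absurd (h6 t h0) htx.ne
    · exact absurd h0 (h6 t htx).ne
    · exact ⟨hY, h6, h7⟩
  have hmem : x₂ ∈ levelSet num den f c Y 0 := ⟨g1, g2⟩
  refine ⟨x₂, Set.eq_singleton_iff_unique_mem.2 ⟨hmem, fun x hx => ?_⟩, (hcase x₂ hmem).1,
    (hcase x₂ hmem).2.1⟩
  rcases lt_trichotomy x x₂ with h' | h' | h'
  · exact absurd g1 ((hcase x hx).2.2 x₂ h').ne'
  · exact h'
  · exact absurd hx.1 (hlast x h').ne'

end IsLevelPath
end

/-! ### Enumerating and counting with multiplicity -/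

noncomputable section

section Enumeration

/-- The indices `1, 2, …` up to `ω`. -/
def seqIndex (ω : ℕ∞) : Set ℕ := {n | 1 ≤ n ∧ (n : ℕ∞) ≤ ω}

/-- A set with finite sublevel sets of `N` can be listed in the order of non-decreasing `N`. -/
theorem exists_monotone_enumeration {β : Type*} (X : Set β) (N : β → ℝ)
    (hfin : ∀ R, {x | x ∈ X ∧ N x ≤ R}.Finite) (hne : X.Nonempty) :
    ∃ (ω : ℕ∞) (e : ℕ → β), Set.BijOn e (seqIndex ω) X ∧
      ∀ m ∈ seqIndex ω, ∀ n ∈ seqIndex ω, m ≤ n → N (e m) ≤ N (e n) := by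
  classical
  let : LinearOrder β := IsWellOrder.linearOrder WellOrderingRel
  -- An arbitrary well-order breaks ties of `N`, so that the number of predecessors is injective on
  -- `X`.
  set key : β → ℝ ×ₗ β := fun x => toLex (N x, x) with hkey
  have hkeyN : ∀ x y, key x < key y → N x ≤ N y := by
    intro x y h
    rcases Prod.Lex.lt_iff.1 h with h | h
    · exact le_of_lt h
    · exact le_of_eq h.1
  have hNkey : ∀ x y, N x < N y → key x < key y := fun x y h => Prod.Lex.lt_iff.2 (Or.inl h)
  have hinj : Function.Injective key := fun x y h => congrArg (fun q => (ofLex q).2) h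
  set rk : β → ℕ := fun x => {y | y ∈ X ∧ key y < key x}.ncard with hrk
  have hrkfin : ∀ x, {y | y ∈ X ∧ key y < key x}.Finite := fun x =>
    (hfin (N x)).subset fun y hy => ⟨hy.1, hkeyN _ _ hy.2⟩
  have hrklt : ∀ x ∈ X, ∀ y, key x < key y → rk x < rk y := by
    intro x hx y hxy
    refine Set.ncard_lt_ncard ?_ (hrkfin y)
    refine (Set.ssubset_iff_of_subset (fun z hz => ?_)).2 ⟨x, ⟨hx, hxy⟩, ?_⟩
    · exact ⟨hz.1, hz.2.trans hxy⟩
    exact fun h => lt_irrefl _ h.2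
  have hrkinj : Set.InjOn rk X := by
    intro x hx y hy h
    rcases lt_trichotomy (key x) (key y) with h1 | h1 | h1
    · exact absurd h (hrklt x hx y h1).ne
    · exact hinj h1
    · exact absurd h (hrklt y hy x h1).ne'
  have hrkN : ∀ x ∈ X, ∀ y ∈ X, rk x ≤ rk y → N x ≤ N y := by
    intro x _ y hy h
    by_contra! hlt
    exact absurd (hrklt y hy x (hNkey _ _ hlt)) (not_lt.2 h)
  set S : Set ℕ := rk '' X with hS
  obtain ⟨x₀, hx₀⟩ := hne
  have : Nonempty β := ⟨x₀⟩
  set g : ℕ → β := Function.invFunOn rk X with hg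
  have hgX : ∀ r ∈ S, g r ∈ X := fun r hr => Function.invFunOn_mem hr
  have hgr : ∀ r ∈ S, rk (g r) = r := fun r hr => Function.invFunOn_eq hr
  have hgrk : ∀ x ∈ X, g (rk x) = x := fun x hx =>
    hrkinj (hgX _ ⟨x, hx, rfl⟩) hx (hgr _ ⟨x, hx, rfl⟩)
  have hcardS : ∀ hf : (Set.ofPred (· ∈ S)).Finite, S.encard = hf.toFinset.card := by
    intro hf
    rw [← hf.encard_eq_coe_toFinset_card, Set.ofPred_mem_eq]
  have hcard : ∀ n, n + 1 ∈ seqIndex S.encard → ∀ hf : (Set.ofPred (· ∈ S)).Finite,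
      n < hf.toFinset.card := by
    intro n hn hf
    have h2 := hn.2
    rw [hcardS hf] at h2
    have : n + 1 ≤ hf.toFinset.card := by exact_mod_cast h2
    omega
  have hsucc : ∀ n ∈ seqIndex S.encard, ∃ k, n = k + 1 := fun n hn =>
    ⟨n - 1, by have := hn.1; omega⟩
  have hmem : ∀ n, n + 1 ∈ seqIndex S.encard → Nat.nth (· ∈ S) n ∈ S := fun n hn =>
    Nat.nth_mem n (hcard n hn)
  -- `Nat.nth` counts from `0`, the listing from `1`.
  refine ⟨S.encard, fun n => g (Nat.nth (· ∈ S) (n - 1)), ⟨?_, ?_, ?_⟩, ?_⟩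
  · intro n hn
    obtain ⟨k, rfl⟩ := hsucc n hn
    exact hgX _ (hmem k hn)
  · intro n hn n' hn' h
    obtain ⟨k, rfl⟩ := hsucc n hn
    obtain ⟨k', rfl⟩ := hsucc n' hn'
    simp only [Nat.add_sub_cancel] at h
    have h1 := congrArg rk h
    rw [hgr _ (hmem k hn), hgr _ (hmem k' hn')] at h1
    rcases lt_trichotomy k k' with h2 | rfl | h2
    · exact absurd h1 (Nat.nth_lt_nth' h2 (hcard k' hn')).ne
    · rfl
    · exact absurd h1 (Nat.nth_lt_nth' h2 (hcard k hn)).ne'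
  · intro x hx
    obtain ⟨n, hn, hnth⟩ := Nat.exists_lt_card_nth_eq (p := (· ∈ S)) (x := rk x) ⟨x, hx, rfl⟩
    refine ⟨n + 1, ⟨by omega, ?_⟩, ?_⟩
    · by_cases hf : S.Finite
      · have h1 : n < hf.toFinset.card := hn hf
        have h3 : S.encard = hf.toFinset.card := hf.encard_eq_coe_toFinset_card
        rw [h3]; exact_mod_cast h1
      · have : S.encard = ⊤ := Set.encard_eq_top_iff.2 hf
        rw [this]; exact le_top
    · simp only [Nat.add_sub_cancel]
      rw [hnth, hgrk x hx]
  · intro m hm n hn hmn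
    obtain ⟨k, rfl⟩ := hsucc m hm
    obtain ⟨k', rfl⟩ := hsucc n hn
    simp only [Nat.add_sub_cancel]
    refine hrkN _ (hgX _ (hmem k hm)) _ (hgX _ (hmem k' hn)) ?_
    rw [hgr _ (hmem k hm), hgr _ (hmem k' hn)]
    exact Nat.nth_le_nth' (by omega) (hcard k' hn)

end Enumeration

/-- The set `T` of `α`-points has total multiplicity `k`, and is one of the shapes that occur in
one level. -/
def MassEq (F : ℂ → ℂ) (α : ℂ) (T : Set ℂ) (k : ℕ) : Prop :=
  (T = ∅ ∧ k = 0) ∨ (∃ w, T = {w} ∧ alphaMult F α w = k ∧ 1 ≤ k) ∨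
    (∃ w₁ w₂, w₁ ≠ w₂ ∧ T = {w₁, w₂} ∧ alphaMult F α w₁ = 1 ∧ alphaMult F α w₂ = 1 ∧ k = 2)

/-- A partition of the `α`-points into levels, ordered by absolute value, of which the `k`-th has
total multiplicity `m k` unless it is the last one. -/
structure LevelSystem (F : ℂ → ℂ) (α : ℂ) (lev : ℂ → ℕ) (m : ℕ → ℕ) : Prop where
  mono : ∀ w w', F w = α → F w' = α → ‖w‖ ≤ ‖w'‖ → lev w ≤ lev w'
  mass : ∀ k, ∃ i ≤ m k, MassEq F α {w | F w = α ∧ lev w = k} i ∧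
    ((∃ w, F w = α ∧ k < lev w) → i = m k)
  bdd : ∀ R : ℝ, ∃ B, ∀ w, F w = α → ‖w‖ ≤ R → lev w ≤ B
  nonempty : ∃ w, F w = α

theorem MassEq.finite {F : ℂ → ℂ} {α : ℂ} {T : Set ℂ} {k : ℕ} (h : MassEq F α T k) : T.Finite := by
  rcases h with ⟨rfl, -⟩ | ⟨w, rfl, -⟩ | ⟨w₁, w₂, -, rfl, -⟩
  · exact Set.finite_empty
  · exact Set.finite_singleton w
  · exact Set.toFinite _

theorem MassEq.mult {F : ℂ → ℂ} {α : ℂ} {T : Set ℂ} {k : ℕ} (h : MassEq F α T k) {w : ℂ}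
    (hw : w ∈ T) : ∃ i : ℕ, 1 ≤ i ∧ alphaMult F α w = i := by
  rcases h with ⟨rfl, -⟩ | ⟨w', rfl, h1, h2⟩ | ⟨w₁, w₂, -, rfl, h1, h2, -⟩
  · exact absurd hw (Set.notMem_empty w)
  · rw [Set.mem_singleton_iff.1 hw]; exact ⟨k, h2, h1⟩
  · rcases hw with rfl | rfl
    · exact ⟨1, le_rfl, by simpa using h1⟩
    · exact ⟨1, le_rfl, by simpa using h2⟩

namespace IsAlphaSeq

variable {F : ℂ → ℂ} {α : ℂ} {ω : ℕ∞} {z : ℕ → ℂ} (hz : IsAlphaSeq F α ω z)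

include hz

theorem norm_mono {m n : ℕ} (hm : 1 ≤ m) (hmn : m ≤ n) (hn : (n : ℕ∞) ≤ ω) : ‖z m‖ ≤ ‖z n‖ := by
  induction n, hmn using Nat.le_induction with
  | base => exact le_rfl
  | succ n hmn ih =>
    have h1 : ((n : ℕ) : ℕ∞) ≤ ω := le_trans (by exact_mod_cast Nat.le_succ n) hn
    exact (ih h1).trans (hz.norm_le n (hm.trans hmn) hn)

theorem encard_of_massEq {T : Set ℂ} {k : ℕ} (h : MassEq F α T k) (hT : ∀ w ∈ T, F w = α) :
    {n | n ∈ seqIndex ω ∧ z n ∈ T}.encard = k := by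
  rcases h with ⟨rfl, rfl⟩ | ⟨w, rfl, h1, -⟩ | ⟨w₁, w₂, hne, rfl, h1, h2, rfl⟩
  · simp
  · rw [← h1, ← hz.card_eq w (hT w rfl)]
    congr 1
    ext n
    simp [seqIndex, and_assoc]
  · have e : {n | n ∈ seqIndex ω ∧ z n ∈ ({w₁, w₂} : Set ℂ)}
        = {n : ℕ | 1 ≤ n ∧ (n : ℕ∞) ≤ ω ∧ z n = w₁} ∪ {n : ℕ | 1 ≤ n ∧ (n : ℕ∞) ≤ ω ∧ z n = w₂} := by
      ext n
      simp [seqIndex]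
      tauto
    rw [e, Set.encard_union_eq, hz.card_eq w₁ (hT _ (by simp)), hz.card_eq w₂ (hT _ (by simp)),
      h1, h2]
    · norm_num
    · refine Set.disjoint_left.2 fun n hn hn' => hne ?_
      rw [← hn.2.2, ← hn'.2.2]

/-- Terms with different indices differ when they are simple. -/
theorem ne_of_mult_one {m n : ℕ} (hm : m ∈ seqIndex ω) (hn : n ∈ seqIndex ω) (hmn : m ≠ n)
    (h1 : alphaMult F α (z m) = 1) : z m ≠ z n := by
  intro he
  have h2 := hz.card_eq (z m) (hz.isAlphaPoint m hm.1 hm.2)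
  rw [h1, Set.encard_eq_one] at h2
  obtain ⟨i, hi⟩ := h2
  have e1 : m ∈ ({i} : Set ℕ) := by rw [← hi]; exact ⟨hm.1, hm.2, rfl⟩
  have e2 : n ∈ ({i} : Set ℕ) := by rw [← hi]; exact ⟨hn.1, hn.2, he.symm⟩
  exact hmn (e1.trans e2.symm)

end IsAlphaSeq

namespace LevelSystem

variable {F : ℂ → ℂ} {α : ℂ} {lev : ℂ → ℕ} {m : ℕ → ℕ} (S : LevelSystem F α lev m)

include S

theorem mult {w : ℂ} (hw : F w = α) : ∃ i : ℕ, 1 ≤ i ∧ alphaMult F α w = i := by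
  obtain ⟨i, -, h, -⟩ := S.mass (lev w)
  exact h.mult ⟨hw, rfl⟩

theorem finite_ball (R : ℝ) : {w | F w = α ∧ ‖w‖ ≤ R}.Finite := by
  obtain ⟨B, hB⟩ := S.bdd R
  refine ((Set.finite_Iic B).biUnion fun k _ => ?_ :
    (⋃ k ∈ Set.Iic B, {w | F w = α ∧ lev w = k}).Finite).subset ?_
  · obtain ⟨i, -, h, -⟩ := S.mass k
    exact h.finite
  · intro w hw
    exact Set.mem_biUnion (hB w hw.1 hw.2 : lev w ∈ Set.Iic B) ⟨hw.1, rfl⟩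

theorem exists_isAlphaSeq : ∃ (ω : ℕ∞) (z : ℕ → ℂ), IsAlphaSeq F α ω z := by
  choose! mu hmu1 hmu using fun w (hw : F w = α) => S.mult hw
  -- A point of multiplicity `mu w` is entered as that many labelled copies.
  set X : Set (ℂ × ℕ) := {q | F q.1 = α ∧ q.2 < mu q.1} with hX
  obtain ⟨w₀, hw₀⟩ := S.nonempty
  obtain ⟨ω, e, hbij, hmono⟩ := exists_monotone_enumeration X (fun q => ‖q.1‖) (fun R => by
    refine ((S.finite_ball R).biUnion (t := fun w => (fun i => (w, i)) '' Set.Iio (mu w))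
      fun w _ => (Set.finite_Iio _).image _).subset ?_
    rintro ⟨w, i⟩ ⟨⟨h1, h2⟩, h3⟩
    exact Set.mem_biUnion (show w ∈ {w | F w = α ∧ ‖w‖ ≤ R} from ⟨h1, h3⟩) ⟨i, h2, rfl⟩)
    ⟨(w₀, 0), hw₀, hmu1 w₀ hw₀⟩
  refine ⟨ω, fun n => (e n).1, ⟨fun n h1 h2 => (hbij.mapsTo ⟨h1, h2⟩).1, fun w hw => ?_,
    fun n h1 h2 => ?_⟩⟩
  · have hinj : Set.InjOn (fun n => (e n).2) {n : ℕ | 1 ≤ n ∧ (n : ℕ∞) ≤ ω ∧ (e n).1 = w} := by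
      intro n hn n' hn' h
      exact hbij.injOn ⟨hn.1, hn.2.1⟩ ⟨hn'.1, hn'.2.1⟩ (Prod.ext (hn.2.2.trans hn'.2.2.symm) h)
    have himg : (fun n => (e n).2) '' {n : ℕ | 1 ≤ n ∧ (n : ℕ∞) ≤ ω ∧ (e n).1 = w}
        = Set.Iio (mu w) := by
      ext i
      constructor
      · rintro ⟨n, hn, rfl⟩
        have := (hbij.mapsTo (show n ∈ seqIndex ω from ⟨hn.1, hn.2.1⟩)).2
        rw [hn.2.2] at this
        exact this
      · intro hi
        obtain ⟨n, hn, he⟩ := hbij.surjOn (show (w, i) ∈ X from ⟨hw, hi⟩)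
        exact ⟨n, ⟨hn.1, hn.2, by rw [he]⟩, by simp only [he]⟩
    rw [← hinj.encard_image, himg, hmu w hw, ← Finset.coe_range,
      Set.encard_coe_eq_coe_finsetCard, Finset.card_range]
  · refine hmono n ⟨h1, le_trans (by exact_mod_cast Nat.le_succ n) h2⟩ (n + 1) ⟨by omega, h2⟩
      (by omega)

variable {ω : ℕ∞} {z : ℕ → ℂ} (hz : IsAlphaSeq F α ω z)

include hz

theorem one_le : 1 ≤ ω := by
  obtain ⟨w, hw⟩ := S.nonempty
  obtain ⟨i, hi, h⟩ := S.mult hw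
  have h1 := hz.card_eq w hw
  rw [h] at h1
  have h2 : {n : ℕ | 1 ≤ n ∧ (n : ℕ∞) ≤ ω ∧ z n = w}.Nonempty := by
    rw [← Set.encard_pos, h1]
    exact_mod_cast hi
  obtain ⟨n, hn1, hn2, -⟩ := h2
  exact le_trans (by exact_mod_cast hn1) hn2

theorem lev_mono {n n' : ℕ} (hn : 1 ≤ n) (hnn : n ≤ n') (hn' : (n' : ℕ∞) ≤ ω) :
    lev (z n) ≤ lev (z n') := by
  have h1 : (n : ℕ∞) ≤ ω := le_trans (by exact_mod_cast hnn) hn'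
  exact S.mono _ _ (hz.isAlphaPoint n hn h1) (hz.isAlphaPoint n' (hn.trans hnn) hn')
    (hz.norm_mono hn hnn hn')

/-- The partial sums of `m` bound the number of terms on lower levels, with equality once some point
lies at level `k` or higher: only the last occupied level may be incomplete. -/
theorem encard_lev_lt (k : ℕ) :
    {n | n ∈ seqIndex ω ∧ lev (z n) < k}.encard ≤ (∑ i ∈ Finset.range k, m i : ℕ) ∧
    ((∃ w, F w = α ∧ k ≤ lev w) →
      {n | n ∈ seqIndex ω ∧ lev (z n) < k}.encard = (∑ i ∈ Finset.range k, m i : ℕ)) := by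
  induction k with
  | zero => simp
  | succ k ih =>
    obtain ⟨i, hi, hmass, heq⟩ := S.mass k
    have hcard := hz.encard_of_massEq hmass fun w hw => hw.1
    have e : {n | n ∈ seqIndex ω ∧ lev (z n) < k + 1} = {n | n ∈ seqIndex ω ∧ lev (z n) < k} ∪
        {n | n ∈ seqIndex ω ∧ z n ∈ {w | F w = α ∧ lev w = k}} := by
      ext n
      constructor
      · rintro ⟨h1, h2⟩
        rcases Nat.lt_succ_iff_lt_or_eq.1 h2 with h | h
        · exact Or.inl ⟨h1, h⟩
        · exact Or.inr ⟨h1, hz.isAlphaPoint n h1.1 h1.2, h⟩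
      · rintro (⟨h1, h2⟩ | ⟨h1, -, h2⟩)
        · exact ⟨h1, h2.trans (Nat.lt_succ_self k)⟩
        · exact ⟨h1, by rw [h2]; exact Nat.lt_succ_self k⟩
    have hd : Disjoint {n | n ∈ seqIndex ω ∧ lev (z n) < k}
        {n | n ∈ seqIndex ω ∧ z n ∈ {w | F w = α ∧ lev w = k}} := by
      refine Set.disjoint_left.2 fun n hn hn' => ?_
      exact hn.2.ne hn'.2.2
    rw [e, Set.encard_union_eq hd, hcard, Finset.sum_range_succ, Nat.cast_add]
    refine ⟨add_le_add ih.1 (by exact_mod_cast hi), fun ⟨w, hw, hlev⟩ => ?_⟩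
    rw [ih.2 ⟨w, hw, by omega⟩, heq ⟨w, hw, by omega⟩]

/-- The level of the `n`-th term is determined by the multiplicities `m`. -/
theorem index_bounds {n : ℕ} (hn : n ∈ seqIndex ω) :
    ∑ i ∈ Finset.range (lev (z n)), m i < n ∧ n ≤ ∑ i ∈ Finset.range (lev (z n) + 1), m i := by
  have hF := hz.isAlphaPoint n hn.1 hn.2
  constructor
  · have h1 := (S.encard_lev_lt hz (lev (z n))).2 ⟨z n, hF, le_rfl⟩
    -- Levels do not decrease along the listing, so terms of lower level have index below `n`.
    have h2 : {n' | n' ∈ seqIndex ω ∧ lev (z n') < lev (z n)} ⊆ (Finset.Ico 1 n : Finset ℕ) := by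
      rintro n' ⟨h3, h4⟩
      rw [Finset.coe_Ico]
      refine ⟨h3.1, ?_⟩
      by_contra! h
      exact absurd (S.lev_mono hz hn.1 h h3.2) (not_le.2 h4)
    have h3 := Set.encard_le_encard h2
    rw [h1, Set.encard_coe_eq_coe_finsetCard, Nat.card_Ico] at h3
    have h4 : ∑ i ∈ Finset.range (lev (z n)), m i ≤ n - 1 := by exact_mod_cast h3
    have := hn.1
    omega
  · have h1 := (S.encard_lev_lt hz (lev (z n) + 1)).1
    have h2 : ((Finset.Icc 1 n : Finset ℕ) : Set ℕ) ⊆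
        {n' | n' ∈ seqIndex ω ∧ lev (z n') < lev (z n) + 1} := by
      intro n' hn'
      rw [Finset.coe_Icc] at hn'
      refine ⟨⟨hn'.1, le_trans (by exact_mod_cast hn'.2) hn.2⟩, ?_⟩
      exact Nat.lt_succ_of_le (S.lev_mono hz hn'.1 hn'.2 hn.2)
    have h3 := (Set.encard_le_encard h2).trans h1
    rw [Set.encard_coe_eq_coe_finsetCard, Nat.card_Icc] at h3
    have h4 : n + 1 - 1 ≤ ∑ i ∈ Finset.range (lev (z n) + 1), m i := by exact_mod_cast h3
    omega

end LevelSystem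
end

/-! ### From phases to levels of `α`-points -/

noncomputable section

/-- The `α`-points of `num / den` whose reflection on the curve has phase `v`. -/
def phaseFiber (num den f : ℂ → ℂ) (α : ℂ) (Y : ℝ → ℝ) (v : ℝ) : Set ℂ :=
  {w | num w / den w = α ∧ pathPhase f Y (Real.log ‖w‖) = v}

/-- The `α`-points of absolute value `exp x`. -/
def radiusFiber (num den : ℂ → ℂ) (α : ℂ) (x : ℝ) : Set ℂ :=
  {w | num w / den w = α ∧ Real.log ‖w‖ = x}

/-- Up to signs, `α` is the value of modulus `‖α‖` and argument `v`. -/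
def MatchesPhase (α : ℂ) (v : ℝ) : Prop :=
  |α.re| = |‖α‖ * Real.cos v| ∧ |α.im| = |‖α‖ * Real.sin v|

theorem exists_sign_of_abs_eq {a b : ℝ} (h : |a| = |b|) : ∃ ε, IsUnitSign ε ∧ a = ε * b := by
  rcases abs_eq_abs.1 h with h | h
  · exact ⟨1, isUnitSign_one, by rw [h, one_mul]⟩
  · exact ⟨-1, isUnitSign_neg_one, by rw [h]; ring⟩

namespace IsLevelPath

variable {p : ℕ} {num den f : ℂ → ℂ} {α : ℂ} {Y : ℝ → ℝ}
  (P : IsLevelPath num den ‖α‖ Y) (M : PhaseModel p num den f) (hα : α ≠ 0)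

include P M hα

theorem log_mem_levelSet {v : ℝ} {w : ℂ} (hw : w ∈ phaseFiber num den f α Y v) :
    Real.log ‖w‖ ∈ levelSet num den f ‖α‖ Y v :=
  ⟨hw.2, (P.exists_flip_of_alpha_point M hα hw.1).1⟩

theorem phaseFiber_eq {v x : ℝ} (h : levelSet num den f ‖α‖ Y v = {x}) :
    phaseFiber num den f α Y v = radiusFiber num den α x := by
  have hx : x ∈ levelSet num den f ‖α‖ Y v := by rw [h]; rfl
  ext w
  constructor
  · intro hw
    have := P.log_mem_levelSet M hα hw
    rw [h] at this
    exact ⟨hw.1, this⟩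
  · rintro ⟨h1, h2⟩
    exact ⟨h1, by rw [h2]; exact hx.1⟩

theorem phaseFiber_eq_union {v x₁ x₂ : ℝ} (h : levelSet num den f ‖α‖ Y v = {x₁, x₂}) :
    phaseFiber num den f α Y v = radiusFiber num den α x₁ ∪ radiusFiber num den α x₂ := by
  have hx₁ : x₁ ∈ levelSet num den f ‖α‖ Y v := by rw [h]; exact Or.inl rfl
  have hx₂ : x₂ ∈ levelSet num den f ‖α‖ Y v := by rw [h]; exact Or.inr rfl
  ext w
  constructor
  · intro hw
    have := P.log_mem_levelSet M hα hw
    rw [h] at this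
    rcases this with h1 | h1
    · exact Or.inl ⟨hw.1, h1⟩
    · exact Or.inr ⟨hw.1, h1⟩
  · rintro (⟨h1, h2⟩ | ⟨h1, h2⟩)
    · exact ⟨h1, by rw [h2]; exact hx₁.1⟩
    · exact ⟨h1, by rw [h2]; exact hx₂.1⟩

theorem mult_of_mem_radiusFiber {x : ℝ} {w : ℂ} (hw : w ∈ radiusFiber num den α x) :
    alphaMult (fun z => num z / den z) α w = pathMult num den Y x := by
  rw [P.alphaMult_eq_pathPt M hα hw.1, hw.2]; rfl

/-- The signs of the reflection are forced by those of `α`, except for a coordinate of `α` that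
vanishes; that freedom produces mirror pairs. -/
theorem radiusFiber_cases {v x : ℝ} (hx : x ∈ levelSet num den f ‖α‖ Y v) {ε₀ δ₀ : ℝ}
    (hre : α.re = ε₀ * (‖α‖ * Real.cos v)) (him : α.im = δ₀ * (‖α‖ * Real.sin v)) {w : ℂ}
    (hw : w ∈ radiusFiber num den α x) : ∃ ε δ, IsUnitSign ε ∧ IsUnitSign δ ∧
      w = signFlip ε δ (pathPt Y x) ∧ (Real.cos v = 0 ∨ ε = ε₀) ∧ (Real.sin v = 0 ∨ δ = δ₀) := by
  obtain ⟨-, ε, δ, hε, hδ, h1, h2, h3⟩ := P.exists_flip_of_alpha_point M hα hw.1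
  have hn : ‖α‖ ≠ 0 := norm_ne_zero_iff.2 hα
  rw [hw.2] at h1 h2 h3
  rw [hx.1] at h2 h3
  refine ⟨ε, δ, hε, hδ, h1, ?_, ?_⟩
  · by_cases hc : Real.cos v = 0
    · exact Or.inl hc
    · exact Or.inr (mul_right_cancel₀ (mul_ne_zero hn hc) (h2.symm.trans hre))
  · by_cases hc : Real.sin v = 0
    · exact Or.inl hc
    · exact Or.inr (mul_right_cancel₀ (mul_ne_zero hn hc) (h3.symm.trans him))

theorem signFlip_mem_radiusFiber {v x : ℝ} (hx : x ∈ levelSet num den f ‖α‖ Y v) {ε δ : ℝ}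
    (hε : IsUnitSign ε) (hδ : IsUnitSign δ)
    (hre : α.re = ε * (‖α‖ * Real.cos v)) (him : α.im = δ * (‖α‖ * Real.sin v)) :
    signFlip ε δ (pathPt Y x) ∈ radiusFiber num den α x := by
  rw [← hx.1] at hre him
  exact P.alpha_point_of_flip M hα hx.2 hε hδ hre him

/-- The `α`-points of one absolute value on a level whose phase is that of an edge. -/
theorem radiusFiber_edge {y s v x : ℝ} (hE : EdgeLevel y s v) (hm : MatchesPhase α v)
    (hx : x ∈ levelSet num den f ‖α‖ Y v) :
    ∃ w₁ w₂, radiusFiber num den α x = {w₁, w₂} ∧ (w₁ = w₂ ↔ Y x = y) := by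
  obtain ⟨ε₀, hε₀, hre⟩ := exists_sign_of_abs_eq hm.1
  obtain ⟨δ₀, hδ₀, him⟩ := exists_sign_of_abs_eq hm.2
  have hexp := Real.exp_ne_zero x
  have hY0 := P.nonneg x
  have hY1 := P.le x
  have hpi := Real.pi_pos
  rcases hE with ⟨rfl, -, hv⟩ | ⟨rfl, -, hv⟩
  · have hcos : Real.cos v ≠ 0 := by
      intro h0
      have := Real.sin_sq_add_cos_sq v
      rw [h0, hv] at this; norm_num at this
    have him' : ∀ δ, α.im = δ * (‖α‖ * Real.sin v) := fun δ => by
      rw [him, hv, mul_zero, mul_zero, mul_zero]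
    refine ⟨signFlip ε₀ 1 (pathPt Y x), signFlip ε₀ (-1) (pathPt Y x), ?_, ?_⟩
    · refine Set.Subset.antisymm (fun w hw => ?_) ?_
      · obtain ⟨ε, δ, -, hδ, h1, h2, -⟩ := P.radiusFiber_cases M hα hx hre him hw
        rw [h2.resolve_left hcos] at h1
        rcases hδ with rfl | rfl
        · exact Or.inl h1
        · exact Or.inr h1
      · rintro w (rfl | rfl)
        · exact P.signFlip_mem_radiusFiber M hα hx hε₀ isUnitSign_one hre (him' 1)
        · exact P.signFlip_mem_radiusFiber M hα hx hε₀ isUnitSign_neg_one hre (him' (-1))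
    · constructor
      · intro h
        have h1 := congrArg Complex.im h
        rw [signFlip_im, signFlip_im, pathPt_im] at h1
        have h2 : Real.exp x * Real.sin (Y x) = 0 := by linarith
        have h3 := (mul_eq_zero.1 h2).resolve_left hexp
        exact (Real.sin_eq_zero_iff_of_lt_of_lt (by linarith) (by linarith)).1 h3
      · intro h
        apply Complex.ext
        · simp
        · simp [pathPt_im, h]
  · have hsin : Real.sin v ≠ 0 := by
      intro h0
      have := Real.sin_sq_add_cos_sq v
      rw [h0, hv] at this; norm_num at this
    have hre' : ∀ ε, α.re = ε * (‖α‖ * Real.cos v) := fun ε => by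
      rw [hre, hv, mul_zero, mul_zero, mul_zero]
    refine ⟨signFlip 1 δ₀ (pathPt Y x), signFlip (-1) δ₀ (pathPt Y x), ?_, ?_⟩
    · refine Set.Subset.antisymm (fun w hw => ?_) ?_
      · obtain ⟨ε, δ, hε, -, h1, -, h2⟩ := P.radiusFiber_cases M hα hx hre him hw
        rw [h2.resolve_left hsin] at h1
        rcases hε with rfl | rfl
        · exact Or.inl h1
        · exact Or.inr h1
      · rintro w (rfl | rfl)
        · exact P.signFlip_mem_radiusFiber M hα hx isUnitSign_one hδ₀ (hre' 1) him
        · exact P.signFlip_mem_radiusFiber M hα hx isUnitSign_neg_one hδ₀ (hre' (-1)) him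
    · constructor
      · intro h
        have h1 := congrArg Complex.re h
        rw [signFlip_re, signFlip_re, pathPt_re] at h1
        have h2 : Real.exp x * Real.cos (Y x) = 0 := by linarith
        have h3 := (mul_eq_zero.1 h2).resolve_left hexp
        by_contra hne
        have hlt := lt_of_le_of_ne hY1 hne
        exact (Real.cos_pos_of_mem_Ioo ⟨by linarith, hlt⟩).ne' h3
      · intro h
        apply Complex.ext
        · simp [pathPt_re, h]
        · simp

theorem radiusFiber_generic {v x : ℝ} (hs : Real.sin v ≠ 0) (hc : Real.cos v ≠ 0)
    (hm : MatchesPhase α v) (hx : x ∈ levelSet num den f ‖α‖ Y v) :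
    ∃ w, radiusFiber num den α x = {w} := by
  obtain ⟨ε₀, hε₀, hre⟩ := exists_sign_of_abs_eq hm.1
  obtain ⟨δ₀, hδ₀, him⟩ := exists_sign_of_abs_eq hm.2
  refine ⟨signFlip ε₀ δ₀ (pathPt Y x), Set.eq_singleton_iff_unique_mem.2
    ⟨P.signFlip_mem_radiusFiber M hα hx hε₀ hδ₀ hre him, fun w hw => ?_⟩⟩
  obtain ⟨ε, δ, -, -, h1, h2, h3⟩ := P.radiusFiber_cases M hα hx hre him hw
  rw [h1, h2.resolve_left hc, h3.resolve_left hs]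

theorem massEq_singleton_edge {y s v x : ℝ} (hE : EdgeLevel y s v) (hm : MatchesPhase α v)
    (h : levelSet num den f ‖α‖ Y v = {x}) (hY : Y x = y) {k : ℕ} (hk : 1 ≤ k)
    (hmul : pathMult num den Y x = k) :
    MassEq (fun z => num z / den z) α (phaseFiber num den f α Y v) k := by
  obtain ⟨w₁, w₂, h1, h2⟩ := P.radiusFiber_edge M hα hE hm (x := x) (by rw [h]; rfl)
  have h3 := h2.2 hY
  rw [← h3, Set.pair_eq_singleton] at h1
  refine Or.inr (Or.inl ⟨w₁, by rw [P.phaseFiber_eq M hα h, h1], ?_, hk⟩)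
  rw [P.mult_of_mem_radiusFiber M hα (x := x) (by rw [h1]; rfl), hmul]

/-- An interior crossing lifts to a mirror pair of simple points, while each edge point is its own
mirror image. Hence every complete shape has total multiplicity 2. -/
theorem massEq_edge {y s v : ℝ} (hE : EdgeLevel y s v) (hv : 0 < v) (hm : MatchesPhase α v) :
    ∃ i ≤ 2, MassEq (fun z => num z / den z) α (phaseFiber num den f α Y v) i ∧
      ((∃ x, v < pathPhase f Y x) → i = 2) ∧ ((∃ x, v ≤ pathPhase f Y x) → 1 ≤ i) := by
  have hc : 0 < ‖α‖ := norm_pos_iff.2 hα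
  rcases P.levelSet_shape M hc hE hv with ⟨h, hlt⟩ | ⟨x, h, h0, h1, hmul⟩ | ⟨x, h, hY, hmul⟩ |
    ⟨x, h, hY, hmul, hle⟩ | ⟨x₁, x₂, hlt, h, hY₁, hY₂, hmul₁, hmul₂⟩
  · refine ⟨0, by norm_num, Or.inl ⟨Set.eq_empty_of_forall_notMem fun w hw => ?_, rfl⟩, ?_, ?_⟩
    · have := P.log_mem_levelSet M hα hw
      rw [h] at this
      exact this
    · rintro ⟨x, hx⟩; exact absurd (hlt x) hx.not_gt
    · rintro ⟨x, hx⟩; exact absurd (hlt x) hx.not_gt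
  · refine ⟨2, le_rfl, Or.inr (Or.inr ?_), fun _ => rfl, fun _ => by norm_num⟩
    obtain ⟨w₁, w₂, h2, h3⟩ := P.radiusFiber_edge M hα hE hm (x := x) (by rw [h]; rfl)
    have hne : w₁ ≠ w₂ := by
      intro he
      have hYx := h3.1 he
      rcases hE with ⟨rfl, -⟩ | ⟨rfl, -⟩ <;> linarith
    refine ⟨w₁, w₂, hne, by rw [P.phaseFiber_eq M hα h, h2], ?_, ?_, rfl⟩
    · rw [P.mult_of_mem_radiusFiber M hα (x := x) (by rw [h2]; exact Or.inl rfl), hmul]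
    · rw [P.mult_of_mem_radiusFiber M hα (x := x) (by rw [h2]; exact Or.inr rfl), hmul]
  · exact ⟨2, le_rfl, P.massEq_singleton_edge M hα hE hm h hY (by norm_num) hmul, fun _ => rfl,
      fun _ => by norm_num⟩
  · refine ⟨1, by norm_num, P.massEq_singleton_edge M hα hE hm h hY le_rfl (by simpa using hmul),
      ?_, fun _ => le_rfl⟩
    rintro ⟨x', hx'⟩; exact absurd (hle x') hx'.not_ge
  · refine ⟨2, le_rfl, Or.inr (Or.inr ?_), fun _ => rfl, fun _ => by norm_num⟩
    obtain ⟨w₁, w₂, h2, h3⟩ := P.radiusFiber_edge M hα hE hm (x := x₁) (by rw [h]; exact Or.inl rfl)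
    obtain ⟨w₃, w₄, h4, h5⟩ := P.radiusFiber_edge M hα hE hm (x := x₂) (by rw [h]; exact Or.inr rfl)
    rw [← h3.2 hY₁, Set.pair_eq_singleton] at h2
    rw [← h5.2 hY₂, Set.pair_eq_singleton] at h4
    have m₁ : w₁ ∈ radiusFiber num den α x₁ := by rw [h2]; rfl
    have m₂ : w₃ ∈ radiusFiber num den α x₂ := by rw [h4]; rfl
    refine ⟨w₁, w₃, ?_, ?_, ?_, ?_, rfl⟩
    · rintro rfl
      exact hlt.ne (m₁.2.symm.trans m₂.2)
    · rw [P.phaseFiber_eq_union M hα h, h2, h4]; rfl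
    · rw [P.mult_of_mem_radiusFiber M hα m₁, hmul₁]
    · rw [P.mult_of_mem_radiusFiber M hα m₂, hmul₂]

theorem massEq_zero (hm : MatchesPhase α 0) :
    MassEq (fun z => num z / den z) α (phaseFiber num den f α Y 0) 1 := by
  obtain ⟨x, h, hY, hmul⟩ := P.levelSet_zero_shape M (norm_pos_iff.2 hα)
  exact P.massEq_singleton_edge M hα (Or.inl ⟨rfl, rfl, Real.sin_zero⟩) hm h hY le_rfl
    (by simpa using hmul)

theorem interior_of_generic {v x : ℝ} (hs : Real.sin v ≠ 0) (hc : Real.cos v ≠ 0)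
    (hx : pathPhase f Y x = v) : 0 < Y x ∧ Y x < Real.pi / 2 := by
  have hn : 0 < ‖α‖ := norm_pos_iff.2 hα
  refine ⟨lt_of_le_of_ne (P.nonneg x) fun h => hs ?_, lt_of_le_of_ne (P.le x) fun h => hc ?_⟩
  · rw [← hx]; exact P.sin_pathPhase M hn h.symm
  · rw [← hx]; exact P.cos_pathPhase M hn h

/-- When neither sine nor cosine of the phase vanishes, the curve is inside the strip, so there is
one simple crossing and the reflection is unique. -/
theorem massEq_generic {v : ℝ} (hs : Real.sin v ≠ 0) (hc : Real.cos v ≠ 0) (hv : 0 < v)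
    (hm : MatchesPhase α v) :
    ∃ i ≤ 1, MassEq (fun z => num z / den z) α (phaseFiber num den f α Y v) i ∧
      ((∃ x, v < pathPhase f Y x) → i = 1) ∧ ((∃ x, v ≤ pathPhase f Y x) → 1 ≤ i) := by
  have hn : 0 < ‖α‖ := norm_pos_iff.2 hα
  by_cases hex : ∃ x, v ≤ pathPhase f Y x
  · refine ⟨1, le_rfl, ?_, fun _ => rfl, fun _ => le_rfl⟩
    obtain ⟨x, h1, h2, -⟩ := P.exists_first M hn hv hex
    have hx : x ∈ levelSet num den f ‖α‖ Y v := ⟨h1, h2⟩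
    obtain ⟨h3, h4⟩ := P.interior_of_generic M hα hs hc h1
    have h : levelSet num den f ‖α‖ Y v = {x} := Set.eq_singleton_iff_unique_mem.2
      ⟨hx, fun x' hx' => P.eq_of_phase_eq_of_interior M hn h3 h4 (hx'.1.trans h1.symm)⟩
    obtain ⟨w, hw⟩ := P.radiusFiber_generic M hα hs hc hm hx
    refine Or.inr (Or.inl ⟨w, by rw [P.phaseFiber_eq M hα h, hw], ?_, le_rfl⟩)
    rw [P.mult_of_mem_radiusFiber M hα (x := x) (by rw [hw]; rfl),
      P.pathMult_interior M hn h3 h4, Nat.cast_one]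
  · refine ⟨0, by norm_num, Or.inl ⟨Set.eq_empty_of_forall_notMem fun w hw => ?_, rfl⟩, ?_, ?_⟩
    · exact hex ⟨_, hw.2.ge⟩
    · rintro ⟨x, hx⟩; exact absurd ⟨x, hx.le⟩ hex
    · intro h; exact absurd h hex

omit P in
theorem _root_.PhaseModel.norm_pos_of_alpha_point {w : ℂ} (hw : num w / den w = α) : 0 < ‖w‖ := by
  rw [norm_pos_iff]
  rintro rfl
  rw [M.num_zero, zero_div] at hw
  exact hα hw.symm

theorem pathPhase_nonneg (x : ℝ) : 0 ≤ pathPhase f Y x := by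
  have h := M.im_ge _ (P.mem_regStrip M (norm_pos_iff.2 hα) x)
  rw [planePt_im] at h
  exact (mul_nonneg (Nat.cast_nonneg p) (P.nonneg x)).trans h

/-- The levels given by an increasing sequence of phases. -/
theorem exists_levelSystem (V : ℕ → ℝ) (hV : StrictMono V) (hunb : ∀ B, ∃ k, B < V k)
    (hV0 : V 0 ≤ Real.pi / 2) (m : ℕ → ℕ)
    (hphase : ∀ w, num w / den w = α → ∃ k, pathPhase f Y (Real.log ‖w‖) = V k)
    (hmass : ∀ k, ∃ i ≤ m k,
      MassEq (fun z => num z / den z) α (phaseFiber num den f α Y (V k)) i ∧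
      ((∃ x, V k < pathPhase f Y x) → i = m k) ∧ ((∃ x, V k ≤ pathPhase f Y x) → 1 ≤ i)) :
    ∃ lev : ℂ → ℕ, LevelSystem (fun z => num z / den z) α lev m ∧
      ∀ w, num w / den w = α → pathPhase f Y (Real.log ‖w‖) = V (lev w) := by
  have hmono := P.monotone_pathPhase M (norm_pos_iff.2 hα)
  choose! lev hlev using hphase
  refine ⟨lev, ⟨fun w w' hw hw' h => ?_, fun k => ?_, fun R => ?_, ?_⟩, hlev⟩
  · rw [← hV.le_iff_le, ← hlev w hw, ← hlev w' hw']
    exact hmono (Real.log_le_log (M.norm_pos_of_alpha_point hα hw) h)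
  · obtain ⟨i, hi, h1, h2, -⟩ := hmass k
    refine ⟨i, hi, ?_, fun ⟨w, hw, hk⟩ => h2 ⟨Real.log ‖w‖, ?_⟩⟩
    · have e : phaseFiber num den f α Y (V k) = {w | num w / den w = α ∧ lev w = k} := by
        ext w
        constructor
        · rintro ⟨h3, h4⟩
          exact ⟨h3, hV.injective ((hlev w h3).symm.trans h4)⟩
        · rintro ⟨h3, h4⟩
          exact ⟨h3, by rw [hlev w h3, h4]⟩
      rwa [e] at h1
    · rw [hlev w hw]; exact hV hk
  · obtain ⟨B, hB⟩ := hunb (pathPhase f Y (Real.log R))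
    refine ⟨B, fun w hw hR => ?_⟩
    rw [← hV.le_iff_le, ← hlev w hw]
    exact (hmono (Real.log_le_log (M.norm_pos_of_alpha_point hα hw) hR)).trans hB.le
  · obtain ⟨i, -, h1, -, h3⟩ := hmass 0
    obtain ⟨x, hx⟩ := P.exists_pi_div_two_le M (norm_pos_iff.2 hα)
    have hi := h3 ⟨x, hV0.trans hx⟩
    rcases h1 with ⟨-, h⟩ | ⟨w, h, -⟩ | ⟨w, _, -, h, -⟩
    · omega
    · have : w ∈ phaseFiber num den f α Y (V 0) := by rw [h]; rfl
      exact ⟨w, this.1⟩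
    · have : w ∈ phaseFiber num den f α Y (V 0) := by rw [h]; exact Or.inl rfl
      exact ⟨w, this.1⟩

theorem exists_levelSystem_real (him : α.im = 0) :
    ∃ lev : ℂ → ℕ, LevelSystem (fun z => num z / den z) α lev (fun k => if k = 0 then 1 else 2) ∧
      ∀ w, num w / den w = α → pathPhase f Y (Real.log ‖w‖) = lev w * Real.pi := by
  have hpi := Real.pi_pos
  have hn : ‖α‖ ≠ 0 := norm_ne_zero_iff.2 hα
  have hm : ∀ k : ℕ, MatchesPhase α (k * Real.pi) := by
    intro k
    constructor
    · have h1 : |Real.cos (k * Real.pi)| = 1 := by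
        have := Real.abs_cos_int_mul_pi k
        simpa using this
      rw [abs_mul, h1, mul_one, abs_norm, Complex.norm_eq_sqrt_sq_add_sq, him]
      simp [Real.sqrt_sq_eq_abs]
    · simp [him, Real.sin_nat_mul_pi]
  refine P.exists_levelSystem M hα (fun k => k * Real.pi) ?_ ?_ ?_ _ ?_ ?_
  · intro i k hik
    have : (i : ℝ) < k := by exact_mod_cast hik
    exact mul_lt_mul_of_pos_right this hpi
  · intro B
    obtain ⟨k, hk⟩ := exists_nat_gt (B / Real.pi)
    exact ⟨k, (div_lt_iff₀ hpi).1 hk⟩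
  · simp; positivity
  · intro w hw
    obtain ⟨-, ε, δ, hε, hδ, -, -, h⟩ := P.exists_flip_of_alpha_point M hα hw
    rw [him] at h
    have hsin : Real.sin (pathPhase f Y (Real.log ‖w‖)) = 0 := by
      rcases mul_eq_zero.1 h.symm with h1 | h1
      · exact absurd h1 hδ.ne_zero
      · exact (mul_eq_zero.1 h1).resolve_left hn
    obtain ⟨k, hk⟩ := Real.sin_eq_zero_iff.1 hsin
    have h0 := P.pathPhase_nonneg M hα (Real.log ‖w‖)
    rw [← hk] at h0
    have hk0 : 0 ≤ k := by
      have := nonneg_of_mul_nonneg_left h0 hpi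
      exact_mod_cast this
    lift k to ℕ using hk0
    exact ⟨k, by rw [← hk]; simp⟩
  · intro k
    rcases Nat.eq_zero_or_pos k with rfl | hk
    · refine ⟨1, by simp, ?_, fun _ => by simp, fun _ => le_rfl⟩
      have := P.massEq_zero M hα (by simpa using hm 0)
      simpa using this
    · simp only [hk.ne', if_false]
      refine P.massEq_edge M hα (Or.inl ⟨rfl, rfl, Real.sin_nat_mul_pi k⟩) ?_ (hm k)
      have : (0 : ℝ) < k := by exact_mod_cast hk
      positivity

theorem exists_levelSystem_imag (hre : α.re = 0) :
    ∃ lev : ℂ → ℕ, LevelSystem (fun z => num z / den z) α lev (fun _ => 2) ∧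
      ∀ w, num w / den w = α →
        pathPhase f Y (Real.log ‖w‖) = Real.pi / 2 + lev w * Real.pi := by
  have hpi := Real.pi_pos
  have hn : ‖α‖ ≠ 0 := norm_ne_zero_iff.2 hα
  have hcos : ∀ k : ℕ, Real.cos (Real.pi / 2 + k * Real.pi) = 0 := by
    intro k
    rw [Real.cos_add, Real.cos_pi_div_two, Real.sin_nat_mul_pi]; ring
  have hm : ∀ k : ℕ, MatchesPhase α (Real.pi / 2 + k * Real.pi) := by
    intro k
    constructor
    · rw [hcos, hre, mul_zero]
    · have h1 : |Real.sin (Real.pi / 2 + k * Real.pi)| = 1 := by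
        have := Real.abs_cos_int_mul_pi k
        rw [add_comm, Real.sin_add_pi_div_two]
        simpa using this
      rw [abs_mul, h1, mul_one, abs_norm, Complex.norm_eq_sqrt_sq_add_sq, hre]
      simp [Real.sqrt_sq_eq_abs]
  refine P.exists_levelSystem M hα (fun k => Real.pi / 2 + k * Real.pi) ?_ ?_ ?_ _ ?_ ?_
  · intro i k h
    have : (i : ℝ) < k := by exact_mod_cast h
    have := mul_lt_mul_of_pos_right this hpi
    simp only; linarith
  · intro B
    obtain ⟨k, hk⟩ := exists_nat_gt (B / Real.pi)
    refine ⟨k, ?_⟩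
    have := (div_lt_iff₀ hpi).1 hk
    linarith
  · simp
  · intro w hw
    obtain ⟨-, ε, δ, hε, hδ, -, h, -⟩ := P.exists_flip_of_alpha_point M hα hw
    rw [hre] at h
    have hcos : Real.cos (pathPhase f Y (Real.log ‖w‖)) = 0 := by
      rcases mul_eq_zero.1 h.symm with h1 | h1
      · exact absurd h1 hε.ne_zero
      · exact (mul_eq_zero.1 h1).resolve_left hn
    obtain ⟨k, hk⟩ := Real.cos_eq_zero_iff.1 hcos
    have h0 := P.pathPhase_nonneg M hα (Real.log ‖w‖)
    have hk0 : 0 ≤ k := by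
      by_contra! hneg
      have h1 : (k : ℝ) ≤ -1 := by exact_mod_cast Int.le_sub_one_of_lt hneg
      rw [hk] at h0
      nlinarith
    lift k to ℕ using hk0
    exact ⟨k, by rw [hk]; push_cast; ring⟩
  · intro k
    exact P.massEq_edge M hα (Or.inr ⟨rfl, rfl, hcos k⟩) (by positivity) (hm k)

/-- The angle `β` is the argument of the reflection of `α` into the first quadrant. The sum and gap
conditions on consecutive phases are what the quadrant step uses. -/
theorem exists_levelSystem_generic (hre : α.re ≠ 0) (him : α.im ≠ 0) :
    ∃ (lev : ℂ → ℕ) (V : ℕ → ℝ), LevelSystem (fun z => num z / den z) α lev (fun _ => 1) ∧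
      (∀ w, num w / den w = α → pathPhase f Y (Real.log ‖w‖) = V (lev w)) ∧
      (∀ k, V k + V (k + 1) = (k + 1 : ℕ) * Real.pi ∧ V k < V (k + 1) ∧
        V (k + 1) < V k + Real.pi) ∧ 0 < V 0 ∧ V 0 < Real.pi / 2 := by
  have hpi := Real.pi_pos
  have hn : 0 < ‖α‖ := norm_pos_iff.2 hα
  set t := |α.re| / ‖α‖ with ht
  have hnsq : ‖α‖ ^ 2 = α.re ^ 2 + α.im ^ 2 := by
    rw [Complex.sq_norm, Complex.normSq_apply]; ring
  have hαt : ‖α‖ * t = |α.re| := by rw [ht]; field_simp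
  have ht0 : 0 < t := div_pos (abs_pos.2 hre) hn
  have ht1 : t < 1 := by
    rw [ht, div_lt_one hn]
    refine lt_of_pow_lt_pow_left₀ 2 hn.le ?_
    rw [sq_abs, hnsq]
    have := sq_pos_of_ne_zero him
    linarith
  set β := Real.arccos t with hβ
  have hβ0 : 0 < β := Real.arccos_pos.2 ht1
  have hβ1 : β < Real.pi / 2 := Real.arccos_lt_pi_div_two.2 ht0
  have hcosβ : Real.cos β = t := Real.cos_arccos (by linarith) ht1.le
  have hmatch : ∀ v, |Real.cos v| = t → MatchesPhase α v ∧ Real.sin v ≠ 0 ∧ Real.cos v ≠ 0 := by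
    intro v hv
    have h1 : |α.re| = |‖α‖ * Real.cos v| := by rw [abs_mul, hv, abs_norm, hαt]
    have h2 : |α.im| = |‖α‖ * Real.sin v| := by
      rw [← sq_eq_sq_iff_abs_eq_abs] at h1 ⊢
      have := Real.sin_sq_add_cos_sq v
      have h3 : (‖α‖ * Real.sin v) ^ 2 = ‖α‖ ^ 2 - (‖α‖ * Real.cos v) ^ 2 := by
        linear_combination ‖α‖ ^ 2 * this
      rw [h3, ← h1, hnsq]; ring
    refine ⟨⟨h1, h2⟩, fun h0 => him ?_, fun h0 => hre ?_⟩
    · rw [h0, mul_zero, abs_zero] at h2; exact abs_eq_zero.1 h2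
    · rw [h0, mul_zero, abs_zero] at h1; exact abs_eq_zero.1 h1
  -- This interleaves `β + mπ` and `(m + 1)π - β`, the solutions `v ≥ 0` of `|cos v| = cos β`, in
  -- increasing order.
  set V : ℕ → ℝ := fun k => k * (Real.pi / 2) + if Even k then β else Real.pi / 2 - β with hV
  have hVeven : ∀ m : ℕ, V (2 * m) = β + m * Real.pi := by
    intro m; simp [hV]; ring
  have hVodd : ∀ m : ℕ, V (2 * m + 1) = (m + 1 : ℕ) * Real.pi - β := by
    intro m; simp [hV]; ring
  have hcosV : ∀ k, |Real.cos (V k)| = t := by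
    intro k
    rcases Nat.even_or_odd' k with ⟨m, rfl | rfl⟩
    · rw [hVeven, Real.cos_add_nat_mul_pi, abs_mul, hcosβ, abs_pow, abs_neg, abs_one, one_pow,
        one_mul, abs_of_pos ht0]
    · rw [hVodd, Real.cos_nat_mul_pi_sub, abs_mul, hcosβ, abs_pow, abs_neg, abs_one, one_pow,
        one_mul, abs_of_pos ht0]
  have hstep : ∀ k, V k + V (k + 1) = (k + 1 : ℕ) * Real.pi ∧ V k < V (k + 1) ∧
        V (k + 1) < V k + Real.pi := by
    intro k
    rcases Nat.even_or_odd' k with ⟨m, rfl | rfl⟩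
    · rw [hVeven, hVodd]
      push_cast
      refine ⟨by ring, by linarith, by linarith⟩
    · rw [hVodd, show 2 * m + 1 + 1 = 2 * (m + 1) by ring, hVeven]
      push_cast
      refine ⟨by ring, by linarith, by linarith⟩
  have hVlow : ∀ k : ℕ, k * (Real.pi / 2) < V k := by
    intro k
    simp only [hV]
    split_ifs <;> linarith
  have hV0 : V 0 = β := by simp [hV]
  have hmono : StrictMono V := strictMono_nat_of_lt_succ fun k => (hstep k).2.1
  suffices h : ∃ lev : ℂ → ℕ, LevelSystem (fun z => num z / den z) α lev (fun _ => 1) ∧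
      ∀ w, num w / den w = α → pathPhase f Y (Real.log ‖w‖) = V (lev w) by
    obtain ⟨lev, h1, h2⟩ := h
    exact ⟨lev, V, h1, h2, hstep, by rw [hV0]; exact hβ0, by rw [hV0]; exact hβ1⟩
  refine P.exists_levelSystem M hα V hmono ?_ (by rw [hV0]; exact hβ1.le) (fun _ => 1) ?_ ?_
  · intro B
    obtain ⟨k, hk⟩ := exists_nat_gt (B / (Real.pi / 2))
    exact ⟨k, ((div_lt_iff₀ (by positivity)).1 hk).trans (hVlow k)⟩
  · intro w hw
    obtain ⟨-, ε, δ, hε, hδ, -, h, -⟩ := P.exists_flip_of_alpha_point M hα hw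
    set Φ := pathPhase f Y (Real.log ‖w‖) with hΦ
    have h0 : 0 ≤ Φ := P.pathPhase_nonneg M hα (Real.log ‖w‖)
    have habs : ‖α‖ * t = ‖α‖ * |Real.cos Φ| := by
      have h1 : |ε| = 1 := by rcases hε with rfl | rfl <;> norm_num
      rw [hαt, h, abs_mul, h1, one_mul, abs_mul, abs_norm]
    -- Doubling removes the absolute value and gives `Φ = ± β + kπ`; `Φ ≥ 0` then restricts the
    -- integer.
    have hcos : Real.cos (2 * Φ) = Real.cos (2 * β) := by
      have h3 := mul_left_cancel₀ hn.ne' habs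
      rw [Real.cos_two_mul, Real.cos_two_mul, hcosβ, h3, sq_abs]
    obtain ⟨k, hk | hk⟩ := Real.cos_eq_cos_iff.1 hcos
    · have hk0 : 0 ≤ -k := by
        by_contra! hneg
        have h1 : (1 : ℝ) ≤ k := by exact_mod_cast (by omega : 1 ≤ k)
        nlinarith
      obtain ⟨m, hm⟩ := Int.eq_ofNat_of_zero_le hk0
      refine ⟨2 * m, ?_⟩
      have hm' : (k : ℝ) = -m := by
        have : k = -(m : ℤ) := by omega
        rw [this]; push_cast; ring
      rw [hVeven]; rw [hm'] at hk; linarith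
    · have hk0 : 0 ≤ k - 1 := by
        by_contra! hneg
        have h1 : (k : ℝ) ≤ 0 := by exact_mod_cast (by omega : k ≤ 0)
        nlinarith
      obtain ⟨m, hm⟩ := Int.eq_ofNat_of_zero_le hk0
      refine ⟨2 * m + 1, ?_⟩
      have hm' : (k : ℝ) = m + 1 := by
        have : k = (m : ℤ) + 1 := by omega
        rw [this]; push_cast; ring
      rw [hVodd]; rw [hm'] at hk; push_cast; linarith
  · intro k
    obtain ⟨h1, h2, h3⟩ := hmatch _ (hcosV k)
    exact P.massEq_generic M hα h2 h3
      (lt_of_le_of_lt (by positivity) (hVlow k)) h1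

end IsLevelPath
end

/-! ### Quadrants and positions of `α`-points -/

noncomputable section
section Quadrants

theorem mem_quadrant_iff (l : ℤ) (z : ℂ) : z ∈ quadrant l ↔
    0 < (z * Complex.exp (-((l : ℂ) * (Real.pi : ℂ) / 2 * Complex.I))).re ∧
    0 < (z * Complex.exp (-((l : ℂ) * (Real.pi : ℂ) / 2 * Complex.I))).im := by
  set v := z * Complex.exp (-((l : ℂ) * (Real.pi : ℂ) / 2 * Complex.I)) with hv
  have hz : z ≠ 0 ↔ v ≠ 0 := by simp [hv, Complex.exp_ne_zero]
  have hpi := Real.pi_pos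
  change z ≠ 0 ∧ 0 < v.arg ∧ v.arg < Real.pi / 2 ↔ _
  rw [hz]
  constructor
  · rintro ⟨h0, h1, h2⟩
    have hn : 0 < ‖v‖ := norm_pos_iff.2 h0
    rw [← Complex.norm_mul_cos_arg v, ← Complex.norm_mul_sin_arg v]
    exact ⟨mul_pos hn (Real.cos_pos_of_mem_Ioo ⟨by linarith, h2⟩),
      mul_pos hn (Real.sin_pos_of_pos_of_lt_pi h1 (by linarith))⟩
  · rintro ⟨h1, h2⟩
    refine ⟨fun h => by simp [h] at h1, lt_of_le_of_ne (Complex.arg_nonneg_iff.2 h2.le) fun h => ?_,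
      (abs_lt.1 (Complex.abs_arg_lt_pi_div_two_iff.2 (Or.inl h1))).2⟩
    rw [(Complex.arg_eq_zero_iff.1 h.symm).2] at h2
    exact lt_irrefl _ h2

/-- A quadrant only depends on the signs of the coordinates. -/
theorem mem_quadrant_of_signs {l : ℤ} {z w : ℂ} (hz : z ∈ quadrant l) (hre : 0 < z.re * w.re)
    (him : 0 < z.im * w.im) : w ∈ quadrant l := by
  rw [mem_quadrant_iff] at hz ⊢
  set u := Complex.exp (-((l : ℂ) * (Real.pi : ℂ) / 2 * Complex.I)) with hu
  -- `u` is a power of `i`, so rotating by it permutes the coordinates up to sign.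
  have hu0 : u.re = 0 ∨ u.im = 0 := by
    have h : u = Complex.exp (((-(l * Real.pi / 2) : ℝ) : ℂ) * Complex.I) := by
      rw [hu]; push_cast; ring_nf
    rw [h, Complex.exp_ofReal_mul_I_re, Complex.exp_ofReal_mul_I_im, ← mul_eq_zero]
    have := Real.sin_two_mul (-(l * Real.pi / 2))
    have h2 : Real.sin (2 * -(l * Real.pi / 2)) = 0 := by
      rw [show 2 * -(l * Real.pi / 2) = -(l * Real.pi) by ring, Real.sin_neg, Real.sin_int_mul_pi,
        neg_zero]
    linarith
  have key : ∀ {a b c : ℝ}, 0 < a * b → 0 < a * c → 0 < b * c := by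
    intro a b c h1 h2
    have h3 : 0 < (a * a) * (b * c) := by nlinarith [mul_pos h1 h2]
    exact pos_of_mul_pos_right h3 (mul_self_nonneg a)
  simp only [Complex.mul_re, Complex.mul_im] at hz ⊢
  rcases hu0 with h | h
  · simp only [h, mul_zero, zero_sub, add_zero] at hz ⊢
    have h1 := key (b := w.im) (c := -u.im) him (by linarith)
    exact ⟨by linarith, key hre hz.2⟩
  · simp only [h, mul_zero, sub_zero, zero_add] at hz ⊢
    exact ⟨key hre hz.1, key him hz.2⟩

theorem mem_quadrant_add_one {l : ℤ} {z : ℂ} (h : -Complex.I * z ∈ quadrant l) :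
    z ∈ quadrant (l + 1) := by
  have e : z * Complex.exp (-(((l + 1 : ℤ) : ℂ) * (Real.pi : ℂ) / 2 * Complex.I)) =
      -Complex.I * z * Complex.exp (-((l : ℂ) * (Real.pi : ℂ) / 2 * Complex.I)) := by
    rw [show -(((l + 1 : ℤ) : ℂ) * (Real.pi : ℂ) / 2 * Complex.I) =
      -((l : ℂ) * (Real.pi : ℂ) / 2 * Complex.I) + -(Real.pi / 2 * Complex.I) by push_cast; ring,
      Complex.exp_add, Complex.exp_neg (Real.pi / 2 * Complex.I), Complex.exp_pi_div_two_mul_I,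
      Complex.inv_I]
    ring
  rw [mem_quadrant_iff] at h ⊢
  rwa [e]

theorem mem_quadrant_sub_one {l : ℤ} {z : ℂ} (h : Complex.I * z ∈ quadrant l) :
    z ∈ quadrant (l + -1) := by
  have e : z * Complex.exp (-(((l + -1 : ℤ) : ℂ) * (Real.pi : ℂ) / 2 * Complex.I)) =
      Complex.I * z * Complex.exp (-((l : ℂ) * (Real.pi : ℂ) / 2 * Complex.I)) := by
    rw [show -(((l + -1 : ℤ) : ℂ) * (Real.pi : ℂ) / 2 * Complex.I) =
      -((l : ℂ) * (Real.pi : ℂ) / 2 * Complex.I) + Real.pi / 2 * Complex.I by push_cast; ring,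
      Complex.exp_add, Complex.exp_pi_div_two_mul_I]
    ring
  rw [mem_quadrant_iff] at h ⊢
  rwa [e]

end Quadrants

namespace IsLevelPath

variable {p : ℕ} {num den f : ℂ → ℂ} {α : ℂ} {Y : ℝ → ℝ}
  (P : IsLevelPath num den ‖α‖ Y) (M : PhaseModel p num den f) (hα : α ≠ 0)

include P M hα

section Point

variable {w : ℂ} (hw : num w / den w = α)

include hw

theorem re_eq_zero_iff : w.re = 0 ↔ Y (Real.log ‖w‖) = Real.pi / 2 := by
  have hpi := Real.pi_pos
  obtain ⟨-, ε, δ, hε, hδ, h, -, -⟩ := P.exists_flip_of_alpha_point M hα hw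
  have h1 := congrArg Complex.re h
  rw [signFlip_re, pathPt_re] at h1
  have h0 := P.nonneg (Real.log ‖w‖)
  constructor
  · intro h2
    rw [h1, mul_eq_zero, mul_eq_zero] at h2
    rcases h2 with h2 | h2 | h2
    · exact absurd h2 hε.ne_zero
    · exact absurd h2 (Real.exp_pos _).ne'
    · by_contra h3
      exact (Real.cos_pos_of_mem_Ioo ⟨by linarith, lt_of_le_of_ne (P.le _) h3⟩).ne' h2
  · intro h2
    rw [h1, h2, Real.cos_pi_div_two]; ring

theorem im_eq_zero_iff : w.im = 0 ↔ Y (Real.log ‖w‖) = 0 := by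
  have hpi := Real.pi_pos
  obtain ⟨-, ε, δ, hε, hδ, h, -, -⟩ := P.exists_flip_of_alpha_point M hα hw
  have h1 := congrArg Complex.im h
  rw [signFlip_im, pathPt_im] at h1
  have h0 := P.le (Real.log ‖w‖)
  constructor
  · intro h2
    rw [h1, mul_eq_zero, mul_eq_zero] at h2
    rcases h2 with h2 | h2 | h2
    · exact absurd h2 hδ.ne_zero
    · exact absurd h2 (Real.exp_pos _).ne'
    · by_contra h3
      exact (Real.sin_pos_of_pos_of_lt_pi (lt_of_le_of_ne (P.nonneg _) (Ne.symm h3))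
        (by linarith)).ne' h2
  · intro h2
    rw [h1, h2, Real.sin_zero]; ring

/-- `Re w` and `Re α` carry the same reflection sign, and the cosine of the height is positive off
the imaginary edge. So the phase determines the sign of `Re w`. -/
theorem re_mul_pos (h : α.re ≠ 0) :
    0 < w.re * (α.re * Real.cos (pathPhase f Y (Real.log ‖w‖))) := by
  have hn : 0 < ‖α‖ := norm_pos_iff.2 hα
  have hpi := Real.pi_pos
  obtain ⟨-, ε, δ, hε, -, h1, h2, -⟩ := P.exists_flip_of_alpha_point M hα hw
  set x := Real.log ‖w‖
  have hc : Real.cos (pathPhase f Y x) ≠ 0 := fun h0 => h (by rw [h2, h0]; ring)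
  have hY : Y x < Real.pi / 2 :=
    lt_of_le_of_ne (P.le x) fun h0 => hc (P.cos_pathPhase M hn h0)
  have hpos : 0 < Real.cos (Y x) := Real.cos_pos_of_mem_Ioo ⟨by linarith [P.nonneg x], hY⟩
  have hre := congrArg Complex.re h1
  rw [signFlip_re, pathPt_re] at hre
  have h3 : w.re * (α.re * Real.cos (pathPhase f Y x)) =
      Real.exp x * Real.cos (Y x) * ‖α‖ * Real.cos (pathPhase f Y x) ^ 2 := by
    rw [h2, hre]
    linear_combination (Real.exp x * Real.cos (Y x) * ‖α‖ * Real.cos (pathPhase f Y x) ^ 2) *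
      hε.mul_self
  rw [h3]
  positivity

theorem im_mul_pos (h : α.im ≠ 0) :
    0 < w.im * (α.im * Real.sin (pathPhase f Y (Real.log ‖w‖))) := by
  have hn : 0 < ‖α‖ := norm_pos_iff.2 hα
  have hpi := Real.pi_pos
  obtain ⟨-, ε, δ, -, hδ, h1, -, h2⟩ := P.exists_flip_of_alpha_point M hα hw
  set x := Real.log ‖w‖
  have hs : Real.sin (pathPhase f Y x) ≠ 0 := fun h0 => h (by rw [h2, h0]; ring)
  have hY : 0 < Y x :=
    lt_of_le_of_ne (P.nonneg x) fun h0 => hs (P.sin_pathPhase M hn h0.symm)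
  have hpos : 0 < Real.sin (Y x) := Real.sin_pos_of_pos_of_lt_pi hY (by linarith [P.le x])
  have him := congrArg Complex.im h1
  rw [signFlip_im, pathPt_im] at him
  have h3 : w.im * (α.im * Real.sin (pathPhase f Y x)) =
      Real.exp x * Real.sin (Y x) * ‖α‖ * Real.sin (pathPhase f Y x) ^ 2 := by
    rw [h2, him]
    linear_combination (Real.exp x * Real.sin (Y x) * ‖α‖ * Real.sin (pathPhase f Y x) ^ 2) *
      hδ.mul_self
  rw [h3]
  positivity

theorem alphaMult_eq_one_of_interior (h0 : 0 < Y (Real.log ‖w‖))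
    (h1 : Y (Real.log ‖w‖) < Real.pi / 2) : alphaMult (fun z => num z / den z) α w = 1 := by
  rw [P.alphaMult_eq_pathPt M hα hw]
  exact P.pathMult_interior M (norm_pos_iff.2 hα) h0 h1

theorem alphaMult_of_edgeLevel {y s : ℝ} (hE : EdgeLevel y s (pathPhase f Y (Real.log ‖w‖))) :
    (Y (Real.log ‖w‖) = y → alphaMult (fun z => num z / den z) α w = 1 ∨
      alphaMult (fun z => num z / den z) α w = 2) ∧
    (Y (Real.log ‖w‖) ≠ y → alphaMult (fun z => num z / den z) α w = 1) := by
  have hn : 0 < ‖α‖ := norm_pos_iff.2 hα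
  constructor
  · intro h
    rw [P.alphaMult_eq_pathPt M hα hw]
    have hx : Real.log ‖w‖ ∈ levelSet num den f ‖α‖ Y (pathPhase f Y (Real.log ‖w‖)) :=
      ⟨rfl, (P.exists_flip_of_alpha_point M hα hw).1⟩
    rcases P.edge_point_cases M hn hE hx h with h1 | h1 | h1
    · exact Or.inr h1.1
    · exact Or.inl h1.1
    · exact Or.inl h1.1
  · intro h
    obtain ⟨h0, h1⟩ := (P.edge_or_interior M hn hE rfl).resolve_left h
    exact P.alphaMult_eq_one_of_interior M hα hw h0 h1

/-- Two `α`-points of the same absolute value are reflections of each other. -/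
theorem exists_flip_of_norm_eq {w' : ℂ} (hw' : num w' / den w' = α) (h : ‖w‖ = ‖w'‖) :
    ∃ ε δ, IsUnitSign ε ∧ IsUnitSign δ ∧ w = signFlip ε δ w' ∧ (α.re ≠ 0 → ε = 1) ∧
      (α.im ≠ 0 → δ = 1) := by
  obtain ⟨-, ε, δ, hε, hδ, h1, h2, h3⟩ := P.exists_flip_of_alpha_point M hα hw
  obtain ⟨-, ε', δ', hε', hδ', h1', h2', h3'⟩ := P.exists_flip_of_alpha_point M hα hw'
  rw [h] at h1 h2 h3
  have hmul : ∀ {a b : ℝ}, IsUnitSign a → IsUnitSign b → IsUnitSign (a * b) := by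
    rintro a b (rfl | rfl) (rfl | rfl) <;> simp [IsUnitSign]
  refine ⟨ε * ε', δ * δ', hmul hε hε', hmul hδ hδ', ?_, fun h0 => ?_, fun h0 => ?_⟩
  · have e1 := congrArg Complex.re h1
    have e1' := congrArg Complex.re h1'
    have e2 := congrArg Complex.im h1
    have e2' := congrArg Complex.im h1'
    simp only [signFlip_re, signFlip_im] at e1 e1' e2 e2'
    apply Complex.ext
    · rw [signFlip_re, e1, e1']
      linear_combination -(ε * (pathPt Y (Real.log ‖w'‖)).re) * hε'.mul_self
    · rw [signFlip_im, e2, e2']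
      linear_combination -(δ * (pathPt Y (Real.log ‖w'‖)).im) * hδ'.mul_self
  · have h4 : (ε - ε') * (‖α‖ * Real.cos (pathPhase f Y (Real.log ‖w'‖))) = 0 := by linarith
    rcases mul_eq_zero.1 h4 with h5 | h5
    · rw [sub_eq_zero.1 h5]; exact hε'.mul_self
    · exact absurd (by rw [h2, h5, mul_zero]) h0
  · have h4 : (δ - δ') * (‖α‖ * Real.sin (pathPhase f Y (Real.log ‖w'‖))) = 0 := by linarith
    rcases mul_eq_zero.1 h4 with h5 | h5
    · rw [sub_eq_zero.1 h5]; exact hδ'.mul_self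
    · exact absurd (by rw [h3, h5, mul_zero]) h0

end Point

end IsLevelPath
end

/-! ### The listings in the three cases -/

noncomputable section

theorem sum_range_one_two (k : ℕ) :
    ∑ i ∈ Finset.range (k + 1), (if i = 0 then 1 else 2) = 2 * k + 1 := by
  induction k with
  | zero => simp
  | succ k ih => rw [Finset.sum_range_succ, ih]; simp; ring

namespace LevelSystem

variable {F : ℂ → ℂ} {α : ℂ} {lev : ℂ → ℕ} {ω : ℕ∞} {z : ℕ → ℂ}

theorem lev_eq_of_one (S : LevelSystem F α lev (fun _ => 1)) (hz : IsAlphaSeq F α ω z) {n : ℕ}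
    (hn : n + 1 ∈ seqIndex ω) : lev (z (n + 1)) = n := by
  have h := S.index_bounds hz hn
  simp at h
  omega

theorem lev_eq_of_two (S : LevelSystem F α lev (fun _ => 2)) (hz : IsAlphaSeq F α ω z) {n : ℕ}
    (hn : n + 1 ∈ seqIndex ω) : lev (z (n + 1)) = n / 2 := by
  have h := S.index_bounds hz hn
  simp at h
  omega

theorem lev_eq_of_one_two (S : LevelSystem F α lev (fun k => if k = 0 then 1 else 2))
    (hz : IsAlphaSeq F α ω z) {n : ℕ} (hn : n ∈ seqIndex ω) : lev (z n) = n / 2 := by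
  have h := S.index_bounds hz hn
  have h1 := hn.1
  rw [sum_range_one_two] at h
  rcases Nat.eq_zero_or_eq_succ_pred (lev (z n)) with h2 | h2
  · rw [h2] at h ⊢; omega
  · have h3 := h.1
    rw [h2, Nat.succ_eq_add_one, sum_range_one_two] at h3
    omega

/-- Points of a sequence on different levels have different absolute values. -/
theorem norm_lt {m : ℕ → ℕ} (S : LevelSystem F α lev m) {w w' : ℂ} (hw : F w = α) (hw' : F w' = α)
    (h : lev w < lev w') : ‖w‖ < ‖w'‖ := by
  by_contra! h1
  exact absurd (S.mono _ _ hw' hw h1) (not_le.2 h)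

end LevelSystem

theorem seqIndex_of_le {ω : ℕ∞} {m n : ℕ} (hm : 1 ≤ m) (hmn : m ≤ n) (hn : (n : ℕ∞) ≤ ω) :
    m ∈ seqIndex ω :=
  ⟨hm, le_trans (by exact_mod_cast hmn) hn⟩

theorem one_mem_seqIndex {ω : ℕ∞} (h : 1 ≤ ω) : 1 ∈ seqIndex ω := ⟨le_rfl, by simpa using h⟩

namespace IsLevelPath

variable {p : ℕ} {num den f : ℂ → ℂ} {α : ℂ} {Y : ℝ → ℝ}
  (P : IsLevelPath num den ‖α‖ Y) (M : PhaseModel p num den f) (hα : α ≠ 0)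
  {F : ℂ → ℂ} (hF : F = fun z => num z / den z)

include P M hα hF

/-- Two consecutive `α`-points lie in adjacent quadrants. -/
theorem quadrant_step (hre : α.re ≠ 0) (him : α.im ≠ 0) {w w' : ℂ} (hw : F w = α) (hw' : F w' = α)
    {k : ℕ} (hsum : pathPhase f Y (Real.log ‖w‖) + pathPhase f Y (Real.log ‖w'‖) = k * Real.pi)
    (hlt : pathPhase f Y (Real.log ‖w‖) < pathPhase f Y (Real.log ‖w'‖))
    (hlt' : pathPhase f Y (Real.log ‖w'‖) < pathPhase f Y (Real.log ‖w‖) + Real.pi)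
    {l : ℤ} (hl : w ∈ quadrant l) :
    w' ∈ quadrant (l + (SignType.sign (α ^ 2).im : ℤ)) := by
  subst hF
  have h1 := P.re_mul_pos M hα hw hre
  have h2 := P.im_mul_pos M hα hw him
  have h1' := P.re_mul_pos M hα hw' hre
  have h2' := P.im_mul_pos M hα hw' him
  set φ := pathPhase f Y (Real.log ‖w‖)
  set φ' := pathPhase f Y (Real.log ‖w'‖)
  -- `sin (φ + φ') = 0` and `sin (φ' - φ) > 0` fix the signs of both mixed products; hence the next
  -- point has the signs of `± i w`, with the sign of `Im α ^ 2`.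
  have e1 : Real.sin φ * Real.cos φ' + Real.cos φ * Real.sin φ' = 0 := by
    rw [← Real.sin_add, hsum, Real.sin_nat_mul_pi]
  have e2 : 0 < Real.sin φ' * Real.cos φ - Real.cos φ' * Real.sin φ := by
    rw [← Real.sin_sub]
    exact Real.sin_pos_of_pos_of_lt_pi (by linarith) (by linarith)
  have e3 : 0 < Real.cos φ * Real.sin φ' := by linarith
  have e4 : 0 < Real.sin φ * -Real.cos φ' := by linarith
  have g1 : 0 < (α.re * α.im) * (w.re * w'.im) := by
    have := mul_pos h1 h2'
    exact pos_of_mul_pos_right (a := Real.cos φ * Real.sin φ') (by linarith) e3.le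
  have g2 : 0 < (α.re * α.im) * -(w.im * w'.re) := by
    have := mul_pos h2 h1'
    exact pos_of_mul_pos_right (a := Real.sin φ * -Real.cos φ') (by linarith) e4.le
  have hsq : (α ^ 2).im = 2 * (α.re * α.im) := by
    rw [pow_two, Complex.mul_im]; ring
  rcases lt_trichotomy (α.re * α.im) 0 with hs | hs | hs
  · rw [hsq, sign_neg (by linarith)]
    refine mem_quadrant_sub_one (mem_quadrant_of_signs hl ?_ ?_) <;> simp <;> nlinarith
  · exact absurd hs (mul_ne_zero hre him)
  · rw [hsq, sign_pos (by linarith)]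
    refine mem_quadrant_add_one (mem_quadrant_of_signs hl ?_ ?_) <;> simp <;> nlinarith

theorem generic_listing (hre : α.re ≠ 0) (him : α.im ≠ 0) :
    (∃ (ω : ℕ∞) (z : ℕ → ℂ), IsAlphaSeq F α ω z) ∧
    ∀ (ω : ℕ∞) (z : ℕ → ℂ), IsAlphaSeq F α ω z → 1 ≤ ω ∧
      (∀ w, F w = α → alphaMult F α w = 1) ∧
      0 < ‖z 1‖ ∧
      (∀ n : ℕ, 1 ≤ n → ((n + 1 : ℕ) : ℕ∞) ≤ ω → ‖z n‖ < ‖z (n + 1)‖) ∧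
      (∀ n : ℕ, 1 ≤ n → (n : ℕ∞) ≤ ω → (z n ^ 2).im ≠ 0) ∧
      (∀ n : ℕ, 1 ≤ n → ((n + 1 : ℕ) : ℕ∞) ≤ ω → ∀ l : ℤ, z n ∈ quadrant l →
        z (n + 1) ∈ quadrant (l + (SignType.sign (α ^ 2).im : ℤ))) ∧
      0 < α.im * (z 1).im ∧
      0 < α.re * (z 1).re := by
  obtain ⟨lev, V, S, hV, hstep, hV0, hV1⟩ := P.exists_levelSystem_generic M hα hre him
  rw [← hF] at S
  refine ⟨S.exists_isAlphaSeq, fun ω z hz => ?_⟩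
  have hω := S.one_le hz
  have hpt : ∀ n ∈ seqIndex ω, num (z n) / den (z n) = α := fun n hn => by
    simpa [hF] using hz.isAlphaPoint n hn.1 hn.2
  have h1 := hpt 1 (one_mem_seqIndex hω)
  have hlev1 : lev (z 1) = 0 := S.lev_eq_of_one hz (n := 0) (one_mem_seqIndex hω)
  have hΦ1 := hV _ h1
  rw [hlev1] at hΦ1
  have hre0 : ∀ {w}, num w / den w = α → w.re ≠ 0 := fun hw h0 => by
    have := P.re_mul_pos M hα hw hre
    rw [h0, zero_mul] at this; exact lt_irrefl _ this
  have him0 : ∀ {w}, num w / den w = α → w.im ≠ 0 := fun hw h0 => by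
    have := P.im_mul_pos M hα hw him
    rw [h0, zero_mul] at this; exact lt_irrefl _ this
  refine ⟨hω, fun w hw => ?_, M.norm_pos_of_alpha_point hα h1, fun n hn hn' => ?_, fun n hn hn' => ?_,
    fun n hn hn' l hl => ?_, ?_, ?_⟩
  · have hw' : num w / den w = α := by simpa [hF] using hw
    rw [hF]
    exact P.alphaMult_eq_one_of_interior M hα hw'
      (lt_of_le_of_ne (P.nonneg _) fun h => him0 hw' ((P.im_eq_zero_iff M hα hw').2 h.symm))
      (lt_of_le_of_ne (P.le _) fun h => hre0 hw' ((P.re_eq_zero_iff M hα hw').2 h))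
  · obtain ⟨n, rfl⟩ := Nat.exists_eq_add_of_le' hn
    have i1 := seqIndex_of_le hn (Nat.le_succ _) hn'
    have i2 := seqIndex_of_le (Nat.le_add_left 1 _) le_rfl hn'
    refine S.norm_lt (hz.isAlphaPoint _ i1.1 i1.2) (hz.isAlphaPoint _ i2.1 i2.2) ?_
    rw [S.lev_eq_of_one hz i1, S.lev_eq_of_one hz i2]; omega
  · have hw := hpt n ⟨hn, hn'⟩
    have : (z n ^ 2).im = 2 * ((z n).re * (z n).im) := by rw [pow_two, Complex.mul_im]; ring
    rw [this]
    exact mul_ne_zero two_ne_zero (mul_ne_zero (hre0 hw) (him0 hw))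
  · obtain ⟨n, rfl⟩ := Nat.exists_eq_add_of_le' hn
    have i1 := seqIndex_of_le hn (Nat.le_succ _) hn'
    have i2 := seqIndex_of_le (Nat.le_add_left 1 _) le_rfl hn'
    obtain ⟨s1, s2, s3⟩ := hstep n
    refine P.quadrant_step M hα hF hre him (hz.isAlphaPoint _ i1.1 i1.2)
      (hz.isAlphaPoint _ i2.1 i2.2) (k := n + 1) ?_ ?_ ?_ hl <;>
      rwa [hV _ (hpt _ i1), hV _ (hpt _ i2), S.lev_eq_of_one hz i1, S.lev_eq_of_one hz i2]
  · have h2 := P.im_mul_pos M hα h1 him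
    rw [hΦ1] at h2
    have h3 := Real.sin_pos_of_pos_of_lt_pi hV0 (by linarith)
    exact pos_of_mul_pos_left (b := Real.sin (V 0)) (by linarith) h3.le
  · have h2 := P.re_mul_pos M hα h1 hre
    rw [hΦ1] at h2
    have h3 := Real.cos_pos_of_mem_Ioo ⟨by linarith, hV1⟩
    exact pos_of_mul_pos_left (b := Real.cos (V 0)) (by linarith) h3.le

end IsLevelPath
end

noncomputable section

namespace IsLevelPath

variable {p : ℕ} {num den f : ℂ → ℂ} {α : ℂ} {Y : ℝ → ℝ}
  (P : IsLevelPath num den ‖α‖ Y) (M : PhaseModel p num den f) (hα : α ≠ 0)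
  {F : ℂ → ℂ} (hF : F = fun z => num z / den z)

include P M hα hF

/-- The levels carry 1, 2, 2, … points, so `z n` has phase `(n / 2) π` with integer division. Within
a level, equal moduli mean a mirror pair or a double real point, and different moduli mean the two
ends of a plateau on the real axis. Between levels the cosine changes sign. -/
theorem real_listing (him : α.im = 0) :
    (∃ (ω : ℕ∞) (z : ℕ → ℂ), IsAlphaSeq F α ω z) ∧
    ∀ (ω : ℕ∞) (z : ℕ → ℂ), IsAlphaSeq F α ω z → 1 ≤ ω ∧
      (∀ w, F w = α → w.re ≠ 0) ∧
      (∀ w, F w = α → w.im = 0 → alphaMult F α w = 1 ∨ alphaMult F α w = 2) ∧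
      (∀ w, F w = α → w.im ≠ 0 → alphaMult F α w = 1) ∧
      0 < ‖z 1‖ ∧
      (∀ n : ℕ, 1 ≤ n → ((2 * n : ℕ) : ℕ∞) ≤ ω →
        ‖z (2 * n - 1)‖ < ‖z (2 * n)‖ ∧
        (z (2 * n - 1)).re * (z (2 * n)).re < 0) ∧
      (∀ n : ℕ, 1 ≤ n → ((2 * n + 1 : ℕ) : ℕ∞) ≤ ω →
        ‖z (2 * n)‖ ≤ ‖z (2 * n + 1)‖ ∧
        (‖z (2 * n)‖ = ‖z (2 * n + 1)‖ → z (2 * n) = conj (z (2 * n + 1))) ∧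
        (‖z (2 * n)‖ < ‖z (2 * n + 1)‖ →
          (z (2 * n)).arg = (z (2 * n + 1)).arg ∧
          (z (2 * n)).arg ∈ ({0, Real.pi} : Set ℝ))) ∧
      (z 1).im = 0 ∧
      0 < α.re * (z 1).re := by
  have hn : 0 < ‖α‖ := norm_pos_iff.2 hα
  have hpi := Real.pi_pos
  have hre : α.re ≠ 0 := fun h => hα (Complex.ext h him)
  obtain ⟨lev, S, hV⟩ := P.exists_levelSystem_real M hα him
  rw [← hF] at S
  refine ⟨S.exists_isAlphaSeq, fun ω z hz => ?_⟩
  have hω := S.one_le hz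
  have hFw : ∀ {w}, F w = α → num w / den w = α := fun hw => by simpa [hF] using hw
  have hpt : ∀ n ∈ seqIndex ω, F (z n) = α := fun n hn => hz.isAlphaPoint n hn.1 hn.2
  have h1 := hpt 1 (one_mem_seqIndex hω)
  have hlev1 : lev (z 1) = 0 := S.lev_eq_of_one_two hz (one_mem_seqIndex hω)
  have hΦ1 := hV _ (hFw h1)
  rw [hlev1, Nat.cast_zero, zero_mul] at hΦ1
  have hre0 : ∀ {w}, F w = α → w.re ≠ 0 := fun hw h0 => by
    have := P.re_mul_pos M hα (hFw hw) hre
    rw [h0, zero_mul] at this; exact lt_irrefl _ this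
  have hmult : ∀ {w}, F w = α → (w.im = 0 → alphaMult F α w = 1 ∨ alphaMult F α w = 2) ∧
      (w.im ≠ 0 → alphaMult F α w = 1) := fun {w} hw => by
    have h := P.alphaMult_of_edgeLevel M hα (hFw hw) (y := 0) (s := 1)
      (Or.inl ⟨rfl, rfl, by rw [hV _ (hFw hw), Real.sin_nat_mul_pi]⟩)
    rwa [ne_eq, ← P.im_eq_zero_iff M hα (hFw hw), ← hF] at h
  refine ⟨hω, fun w hw => hre0 hw, fun w hw => (hmult hw).1, fun w hw => (hmult hw).2,
    M.norm_pos_of_alpha_point hα (hFw h1), fun n hn1 hn2 => ?_, fun n hn1 hn2 => ?_, ?_, ?_⟩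
  · have i1 : 2 * n - 1 ∈ seqIndex ω := seqIndex_of_le (by omega) (by omega) hn2
    have i2 : 2 * n ∈ seqIndex ω := seqIndex_of_le (by omega) le_rfl hn2
    have l1 := S.lev_eq_of_one_two hz i1
    have l2 := S.lev_eq_of_one_two hz i2
    refine ⟨S.norm_lt (hpt _ i1) (hpt _ i2) (by omega), ?_⟩
    have r1 := P.re_mul_pos M hα (hFw (hpt _ i1)) hre
    have r2 := P.re_mul_pos M hα (hFw (hpt _ i2)) hre
    have e : Real.cos (lev (z (2 * n)) * Real.pi) = -Real.cos (lev (z (2 * n - 1)) * Real.pi) := by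
      rw [show lev (z (2 * n)) = lev (z (2 * n - 1)) + 1 by omega, ← Real.cos_add_pi]
      push_cast; ring_nf
    rw [hV _ (hFw (hpt _ i1))] at r1
    rw [hV _ (hFw (hpt _ i2)), e] at r2
    have h3 := mul_pos r1 r2
    set c := Real.cos (lev (z (2 * n - 1)) * Real.pi)
    have h4 : 0 < (α.re * c) ^ 2 * -((z (2 * n - 1)).re * (z (2 * n)).re) := by linarith
    exact neg_pos.1 (pos_of_mul_pos_right h4 (sq_nonneg _))
  · have i1 : 2 * n ∈ seqIndex ω := seqIndex_of_le (by omega) (by omega) hn2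
    have i2 : 2 * n + 1 ∈ seqIndex ω := seqIndex_of_le (by omega) le_rfl hn2
    have l1 := S.lev_eq_of_one_two hz i1
    have l2 := S.lev_eq_of_one_two hz i2
    have w1 := hpt _ i1
    have w2 := hpt _ i2
    refine ⟨hz.norm_le _ i1.1 i2.2, fun he => ?_, fun hlt => ?_⟩
    · obtain ⟨ε, δ, -, hδ, h2, h3, -⟩ := P.exists_flip_of_norm_eq M hα (hFw w1) (hFw w2) he
      rw [h3 hre] at h2
      rcases hδ with rfl | rfl
      · rw [signFlip_one_one] at h2
        -- A point listed twice is not simple, hence real.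
        have h4 : (z (2 * n)).im = 0 := by
          by_contra h5
          exact hz.ne_of_mult_one i1 i2 (by omega) ((hmult w1).2 h5) h2
        rw [← h2]
        exact (Complex.conj_eq_iff_im.2 h4).symm
      · rwa [signFlip_one_neg] at h2
    · have hΦ : pathPhase f Y (Real.log ‖z (2 * n)‖) = pathPhase f Y (Real.log ‖z (2 * n + 1)‖) := by
        rw [hV _ (hFw w1), hV _ (hFw w2), l1, l2, show (2 * n + 1) / 2 = 2 * n / 2 by omega]
      have hlog := Real.log_lt_log (M.norm_pos_of_alpha_point hα (hFw w1)) hlt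
      rcases P.same_edge_of_pathPhase_eq M hn hlog hΦ with ⟨h2, h3⟩ | ⟨h2, -⟩
      · rw [← P.im_eq_zero_iff M hα (hFw w1)] at h2
        rw [← P.im_eq_zero_iff M hα (hFw w2)] at h3
        have r1 := P.re_mul_pos M hα (hFw w1) hre
        have r2 := P.re_mul_pos M hα (hFw w2) hre
        rw [← hΦ] at r2
        set c := α.re * Real.cos (pathPhase f Y (Real.log ‖z (2 * n)‖))
        have harg : ∀ {w : ℂ}, w.im = 0 → (0 < w.re → w.arg = 0) ∧ (w.re < 0 → w.arg = Real.pi) :=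
          fun h => ⟨fun h' => Complex.arg_eq_zero_iff.2 ⟨h'.le, h⟩,
            fun h' => Complex.arg_eq_pi_iff.2 ⟨h', h⟩⟩
        rcases lt_or_ge 0 c with hc | hc
        · rw [(harg h2).1 (pos_of_mul_pos_left r1 hc.le), (harg h3).1 (pos_of_mul_pos_left r2 hc.le)]
          simp
        · rw [(harg h2).2 (neg_of_mul_pos_left r1 hc), (harg h3).2 (neg_of_mul_pos_left r2 hc)]
          simp
      · exact absurd ((P.re_eq_zero_iff M hα (hFw w1)).2 h2) (hre0 w1)
  · obtain ⟨x, h2, h3, -⟩ := P.levelSet_zero_shape M hn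
    have h4 : Real.log ‖z 1‖ ∈ levelSet num den f ‖α‖ Y 0 :=
      ⟨hΦ1, (P.exists_flip_of_alpha_point M hα (hFw h1)).1⟩
    rw [h2] at h4
    rw [P.im_eq_zero_iff M hα (hFw h1), Set.mem_singleton_iff.1 h4, h3]
  · have h2 := P.re_mul_pos M hα (hFw h1) hre
    rw [hΦ1, Real.cos_zero] at h2
    linarith

/-- Every level carries two points, so `z (2n - 1)` and `z (2n)` share a phase. The rest mirrors the
real case, with the imaginary axis as the edge. -/
theorem imag_listing (hre : α.re = 0) :
    (∃ (ω : ℕ∞) (z : ℕ → ℂ), IsAlphaSeq F α ω z) ∧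
    ∀ (ω : ℕ∞) (z : ℕ → ℂ), IsAlphaSeq F α ω z → 1 ≤ ω ∧
      (∀ w, F w = α → w.im ≠ 0) ∧
      (∀ w, F w = α → w.re = 0 → alphaMult F α w = 1 ∨ alphaMult F α w = 2) ∧
      (∀ w, F w = α → w.re ≠ 0 → alphaMult F α w = 1) ∧
      0 < ‖z 1‖ ∧
      (∀ n : ℕ, 1 ≤ n → ((2 * n : ℕ) : ℕ∞) ≤ ω →
        ‖z (2 * n - 1)‖ ≤ ‖z (2 * n)‖ ∧
        (‖z (2 * n - 1)‖ = ‖z (2 * n)‖ → z (2 * n - 1) = -conj (z (2 * n))) ∧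
        (‖z (2 * n - 1)‖ < ‖z (2 * n)‖ →
          (z (2 * n - 1)).arg = (z (2 * n)).arg ∧
          (z (2 * n - 1)).arg ∈ ({-(Real.pi / 2), Real.pi / 2} : Set ℝ))) ∧
      (∀ n : ℕ, 1 ≤ n → ((2 * n + 1 : ℕ) : ℕ∞) ≤ ω →
        ‖z (2 * n)‖ < ‖z (2 * n + 1)‖ ∧
        (z (2 * n)).im * (z (2 * n + 1)).im < 0) ∧
      0 < α.im * (z 1).im ∧
      (2 ≤ ω → ‖z 1‖ < ‖z 2‖ → p ≤ 1) := by
  have hn : 0 < ‖α‖ := norm_pos_iff.2 hα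
  have hpi := Real.pi_pos
  have him : α.im ≠ 0 := fun h => hα (Complex.ext hre h)
  obtain ⟨lev, S, hV⟩ := P.exists_levelSystem_imag M hα hre
  rw [← hF] at S
  refine ⟨S.exists_isAlphaSeq, fun ω z hz => ?_⟩
  have hω := S.one_le hz
  have hFw : ∀ {w}, F w = α → num w / den w = α := fun hw => by simpa [hF] using hw
  have hpt : ∀ n ∈ seqIndex ω, F (z n) = α := fun n hn => hz.isAlphaPoint n hn.1 hn.2
  have h1 := hpt 1 (one_mem_seqIndex hω)
  have hlev : ∀ n ∈ seqIndex ω, lev (z n) = (n - 1) / 2 := fun n hn => by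
    obtain ⟨k, rfl⟩ := Nat.exists_eq_add_of_le' hn.1
    exact S.lev_eq_of_two hz hn
  have hΦ1 := hV _ (hFw h1)
  rw [hlev 1 (one_mem_seqIndex hω), Nat.sub_self, Nat.zero_div, Nat.cast_zero, zero_mul,
    add_zero] at hΦ1
  have him0 : ∀ {w}, F w = α → w.im ≠ 0 := fun hw h0 => by
    have := P.im_mul_pos M hα (hFw hw) him
    rw [h0, zero_mul] at this; exact lt_irrefl _ this
  have hmult : ∀ {w}, F w = α → (w.re = 0 → alphaMult F α w = 1 ∨ alphaMult F α w = 2) ∧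
      (w.re ≠ 0 → alphaMult F α w = 1) := fun {w} hw => by
    have h := P.alphaMult_of_edgeLevel M hα (hFw hw) (y := Real.pi / 2) (s := -1)
      (Or.inr ⟨rfl, rfl, by
        rw [hV _ (hFw hw), Real.cos_add, Real.cos_pi_div_two, Real.sin_nat_mul_pi]; ring⟩)
    rwa [ne_eq, ← P.re_eq_zero_iff M hα (hFw hw), ← hF] at h
  have hedge : ∀ {w w'}, F w = α → F w' = α → ‖w‖ < ‖w'‖ → lev w = lev w' →
      Y (Real.log ‖w‖) = Real.pi / 2 ∧ Y (Real.log ‖w'‖) = Real.pi / 2 := by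
    intro w w' hw hw' hlt he
    refine (P.same_edge_of_pathPhase_eq M hn
      (Real.log_lt_log (M.norm_pos_of_alpha_point hα (hFw hw)) hlt) ?_).resolve_left fun h => ?_
    · rw [hV _ (hFw hw), hV _ (hFw hw'), he]
    · exact absurd ((P.im_eq_zero_iff M hα (hFw hw)).2 h.1) (him0 hw)
  refine ⟨hω, fun w hw => him0 hw, fun w hw => (hmult hw).1, fun w hw => (hmult hw).2,
    M.norm_pos_of_alpha_point hα (hFw h1), fun n hn1 hn2 => ?_, fun n hn1 hn2 => ?_, ?_, ?_⟩
  · have i1 : 2 * n - 1 ∈ seqIndex ω := seqIndex_of_le (by omega) (by omega) hn2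
    have i2 : 2 * n ∈ seqIndex ω := seqIndex_of_le (by omega) le_rfl hn2
    have l1 := hlev _ i1
    have l2 := hlev _ i2
    have w1 := hpt _ i1
    have w2 := hpt _ i2
    refine ⟨hz.norm_mono i1.1 (by omega) i2.2, fun he => ?_, fun hlt => ?_⟩
    · obtain ⟨ε, δ, hε, -, h2, -, h3⟩ := P.exists_flip_of_norm_eq M hα (hFw w1) (hFw w2) he
      rw [h3 him] at h2
      rcases hε with rfl | rfl
      · rw [signFlip_one_one] at h2
        have h4 : (z (2 * n - 1)).re = 0 := by
          by_contra h5
          exact hz.ne_of_mult_one i1 i2 (by omega) ((hmult w1).2 h5) h2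
        rw [← h2]
        apply Complex.ext <;> simp [h4]
      · rwa [signFlip_neg_one] at h2
    · obtain ⟨h2, h3⟩ := hedge w1 w2 hlt (by omega)
      rw [← P.re_eq_zero_iff M hα (hFw w1)] at h2
      rw [← P.re_eq_zero_iff M hα (hFw w2)] at h3
      have r1 := P.im_mul_pos M hα (hFw w1) him
      have r2 := P.im_mul_pos M hα (hFw w2) him
      rw [hV _ (hFw w1)] at r1
      rw [hV _ (hFw w2), show lev (z (2 * n)) = lev (z (2 * n - 1)) by omega] at r2
      set c := α.im * Real.sin (Real.pi / 2 + lev (z (2 * n - 1)) * Real.pi)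
      have harg : ∀ {w : ℂ}, w.re = 0 → (0 < w.im → w.arg = Real.pi / 2) ∧
          (w.im < 0 → w.arg = -(Real.pi / 2)) :=
        fun h => ⟨fun h' => Complex.arg_eq_pi_div_two_iff.2 ⟨h, h'⟩,
          fun h' => Complex.arg_eq_neg_pi_div_two_iff.2 ⟨h, h'⟩⟩
      rcases lt_or_ge 0 c with hc | hc
      · rw [(harg h2).1 (pos_of_mul_pos_left r1 hc.le), (harg h3).1 (pos_of_mul_pos_left r2 hc.le)]
        simp
      · rw [(harg h2).2 (neg_of_mul_pos_left r1 hc), (harg h3).2 (neg_of_mul_pos_left r2 hc)]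
        simp
  · have i1 : 2 * n ∈ seqIndex ω := seqIndex_of_le (by omega) (by omega) hn2
    have i2 : 2 * n + 1 ∈ seqIndex ω := seqIndex_of_le (by omega) le_rfl hn2
    have l1 := hlev _ i1
    have l2 := hlev _ i2
    refine ⟨S.norm_lt (hpt _ i1) (hpt _ i2) (by omega), ?_⟩
    have r1 := P.im_mul_pos M hα (hFw (hpt _ i1)) him
    have r2 := P.im_mul_pos M hα (hFw (hpt _ i2)) him
    have e : Real.sin (Real.pi / 2 + lev (z (2 * n + 1)) * Real.pi) =
        -Real.sin (Real.pi / 2 + lev (z (2 * n)) * Real.pi) := by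
      rw [show lev (z (2 * n + 1)) = lev (z (2 * n)) + 1 by omega, ← Real.sin_add_pi]
      push_cast; ring_nf
    rw [hV _ (hFw (hpt _ i1))] at r1
    rw [hV _ (hFw (hpt _ i2)), e] at r2
    have h3 := mul_pos r1 r2
    set c := Real.sin (Real.pi / 2 + lev (z (2 * n)) * Real.pi)
    have h4 : 0 < (α.im * c) ^ 2 * -((z (2 * n)).im * (z (2 * n + 1)).im) := by linarith
    exact neg_pos.1 (pos_of_mul_pos_right h4 (sq_nonneg _))
  · have h2 := P.im_mul_pos M hα (hFw h1) him
    rw [hΦ1, Real.sin_pi_div_two] at h2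
    linarith
  · intro hω2 hlt
    have i2 : 2 ∈ seqIndex ω := ⟨by norm_num, by simpa using hω2⟩
    have l1 := hlev 1 (one_mem_seqIndex hω)
    have l2 := hlev 2 i2
    obtain ⟨h2, -⟩ := hedge h1 (hpt _ i2) hlt (by omega)
    -- With different moduli, `z 1` is on the imaginary edge with phase `π / 2`, and the phase is at
    -- least `p` times the height: `p π / 2 ≤ π / 2`.
    have h3 := M.im_ge _ (P.mem_regStrip M hn (Real.log ‖z 1‖))
    change _ ≤ pathPhase f Y _ at h3
    rw [hΦ1, planePt_im, h2] at h3
    have h4 : (p : ℝ) ≤ 1 := le_of_mul_le_mul_right (by linarith) Real.pi_div_two_pos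
    exact_mod_cast h4

end IsLevelPath

end

/-! ### Assembly -/

theorem mainTheorem9 {ι κ : Type*} (j : ℕ) (A : ℝ) (hA : 0 ≤ A)
    (a : ι → ℝ) (ha : ∀ ν, 0 < a ν) (hsa : Summable fun ν => (a ν)⁻¹)
    (b : κ → ℝ) (hb : ∀ μ, 0 < b μ) (hsb : Summable fun μ => (b μ)⁻¹)
    (F : ℂ → ℂ) (hF : F = oddPF (2 * j + 1) A a b)
    (hne : F ≠ fun z => z ^ (2 * j + 1))
    (α : ℂ) (hα : α ≠ 0) :
    (∃ (ω : ℕ∞) (z : ℕ → ℂ), IsAlphaSeq F α ω z) ∧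
    ∀ (ω : ℕ∞) (z : ℕ → ℂ), IsAlphaSeq F α ω z →
      1 ≤ ω ∧
      -- the case of non-real `α ^ 2`
      ((α ^ 2).im ≠ 0 →
        (∀ w, F w = α → alphaMult F α w = 1) ∧
        0 < ‖z 1‖ ∧
        (∀ n : ℕ, 1 ≤ n → ((n + 1 : ℕ) : ℕ∞) ≤ ω → ‖z n‖ < ‖z (n + 1)‖) ∧
        (∀ n : ℕ, 1 ≤ n → (n : ℕ∞) ≤ ω → (z n ^ 2).im ≠ 0) ∧
        (∀ n : ℕ, 1 ≤ n → ((n + 1 : ℕ) : ℕ∞) ≤ ω → ∀ l : ℤ, z n ∈ quadrant l →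
          z (n + 1) ∈ quadrant (l + (SignType.sign (α ^ 2).im : ℤ))) ∧
        0 < α.im * (z 1).im ∧
        0 < α.re * (z 1).re) ∧
      -- the case of real `α`
      (α.im = 0 →
        (∀ w, F w = α → w.re ≠ 0) ∧
        (∀ w, F w = α → w.im = 0 → alphaMult F α w = 1 ∨ alphaMult F α w = 2) ∧
        (∀ w, F w = α → w.im ≠ 0 → alphaMult F α w = 1) ∧
        0 < ‖z 1‖ ∧
        (∀ n : ℕ, 1 ≤ n → ((2 * n : ℕ) : ℕ∞) ≤ ω →
          ‖z (2 * n - 1)‖ < ‖z (2 * n)‖ ∧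
          (z (2 * n - 1)).re * (z (2 * n)).re < 0) ∧
        (∀ n : ℕ, 1 ≤ n → ((2 * n + 1 : ℕ) : ℕ∞) ≤ ω →
          ‖z (2 * n)‖ ≤ ‖z (2 * n + 1)‖ ∧
          (‖z (2 * n)‖ = ‖z (2 * n + 1)‖ → z (2 * n) = conj (z (2 * n + 1))) ∧
          (‖z (2 * n)‖ < ‖z (2 * n + 1)‖ →
            (z (2 * n)).arg = (z (2 * n + 1)).arg ∧
            (z (2 * n)).arg ∈ ({0, Real.pi} : Set ℝ))) ∧
        (z 1).im = 0 ∧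
        0 < α.re * (z 1).re) ∧
      -- the case of purely imaginary `α`
      (α.re = 0 →
        (∀ w, F w = α → w.im ≠ 0) ∧
        (∀ w, F w = α → w.re = 0 → alphaMult F α w = 1 ∨ alphaMult F α w = 2) ∧
        (∀ w, F w = α → w.re ≠ 0 → alphaMult F α w = 1) ∧
        0 < ‖z 1‖ ∧
        (∀ n : ℕ, 1 ≤ n → ((2 * n : ℕ) : ℕ∞) ≤ ω →
          ‖z (2 * n - 1)‖ ≤ ‖z (2 * n)‖ ∧
          (‖z (2 * n - 1)‖ = ‖z (2 * n)‖ → z (2 * n - 1) = -conj (z (2 * n))) ∧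
          (‖z (2 * n - 1)‖ < ‖z (2 * n)‖ →
            (z (2 * n - 1)).arg = (z (2 * n)).arg ∧
            (z (2 * n - 1)).arg ∈ ({-(Real.pi / 2), Real.pi / 2} : Set ℝ))) ∧
        (∀ n : ℕ, 1 ≤ n → ((2 * n + 1 : ℕ) : ℕ∞) ≤ ω →
          ‖z (2 * n)‖ < ‖z (2 * n + 1)‖ ∧
          (z (2 * n)).im * (z (2 * n + 1)).im < 0) ∧
        0 < α.im * (z 1).im ∧
        (2 ≤ ω → ‖z 1‖ < ‖z 2‖ → j = 0)) := by
  -- With `A = 0` and both products empty, `F` would be `z ^ p`.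
  have hne' : 0 < A ∨ Nonempty ι ∨ Nonempty κ := by
    by_contra! h
    obtain ⟨h1, h2, h3⟩ := h
    refine hne ?_
    rw [hF]
    funext w
    simp [oddPF, le_antisymm h1 hA]
  have M := pf_phaseModel j (p := 2 * j + 1) rfl hA ha hsa hb hsb hne'
  obtain ⟨Y, P⟩ := M.exists_levelPath (norm_pos_iff.2 hα)
  have hF' : F = fun w => pfNum (2 * j + 1) A a w / pfDen b w := by
    rw [hF]
    funext w
    exact oddPF_eq _ A a b w
  have hsq : (α ^ 2).im = 2 * (α.re * α.im) := by rw [pow_two, Complex.mul_im]; ring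
  have hgen := P.generic_listing M hα hF'
  have hreal := P.real_listing M hα hF'
  have himag := P.imag_listing M hα hF'
  constructor
  · by_cases him : α.im = 0
    · exact (hreal him).1
    by_cases hre : α.re = 0
    · exact (himag hre).1
    exact (hgen hre him).1
  intro ω z hz
  refine ⟨?_, fun h => ?_, fun him => ((hreal him).2 ω z hz).2, fun hre => ?_⟩
  · by_cases him : α.im = 0
    · exact ((hreal him).2 ω z hz).1
    by_cases hre : α.re = 0
    · exact ((himag hre).2 ω z hz).1
    exact ((hgen hre him).2 ω z hz).1
  · rw [hsq] at h
    have h1 := right_ne_zero_of_mul h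
    exact ((hgen (left_ne_zero_of_mul h1) (right_ne_zero_of_mul h1)).2 ω z hz).2
  · obtain ⟨-, h1, h2, h3, h4, h5, h6, h7, h8⟩ := (himag hre).2 ω z hz
    exact ⟨h1, h2, h3, h4, h5, h6, h7, fun hω hlt => by have := h8 hω hlt; omega⟩
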